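/- **Theorem (Existence of geodesics).** Let $D\subset\mathbb R^d$ be a bounded domain (nonempty, open, connected) with Lipschitz boundary. Let $\mathscr M^+(\overline D)$, $\mathscr M(\overline D)$, $\mathscr M(\overline D;\mathbb R^d)$ denote the finite nonnegative, signed and $\mathbb R^d$-valued Borel measures on $\overline D$, with the weak$^*$ topology (duality with $C(\overline D)$), and let $\mathscr L$ be Lebesgue measure on $\overline D$. Let $\delta\in(0,\infty)$. *Action.* For $\mu\in\mathscr M^+(\overline D)$, $\nu\in\mathscr M(\overline D;\mathbb R^d)$, $\zeta\in\mathscr M(\overline D)$ take the Lebesgue decompositions $\mu=u\mathscr L+\mu^\perp$, $\nu=w\mathscr L+\nu^\perp$, $\zeta=z\mathscr L+\zeta^\perp$, and write $\mu^\perp=u^\perp\mathscr L^\perp$, $\nu^\perp=w^\perp\mathscr L^\perp$ for a finite measure $\mathscr L^\perp$, singular with respect to $\mathscr L$, that dominates $\mu^\perp$ and $\nu^\perp$. Let $\varphi(u,w)=|w|^2/u$ if $u>0$, $\varphi(0,0)=0$ and $\varphi(0,w)=+\infty$ if $w\ne0$. Set $$\mathcal D(\mu,\nu,\zeta)=\int\varphi(u,w)\,d\mathscr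 L+\int\varphi(u^\perp,w^\perp)\,d\mathscr L^\perp+\frac1\delta A_Z(\zeta),$$ where $A_Z(\zeta)=\int z^2\,d\mathscr L$ if $\zeta^\perp=0$ and $A_Z(\zeta)=+\infty$ otherwise. (This does not depend on the choice of $\mathscr L^\perp$.) *Continuity equation.* $\mathcal{CE}[0,1]$ is the set of triples $(\mu_t,\nu_t,\zeta_t)_{t\in[0,1]}$ such that $t\mapsto\mu_t\in\mathscr M^+(\overline D)$ is weak$^*$ continuous, $t\mapsto\nu_t\in\mathscr M(\overline D;\mathbb R^d)$ and $t\mapsto\zeta_t\in\mathscr M(\overline D)$ are Borel measurable, $\int_0^1|\nu_t|(\overline D)\,dt<\infty$, $\int_0^1|\zeta_t|(\overline D)\,dt<\infty$, and $$\int_0^1\!\!\int_{\overline D}\partial_t\eta\,d\mu_t\,dt+\int_0^1\!\!\int_{\overline D}\nabla\eta\cdot d\nu_t\,dt+\int_0^1\!\!\int_{\overline D}\eta\,d\zeta_t\,dt=0$$ for all $\eta\in C^1$ on $(0,1)\times\overline D$ with compact support in $(0,1)\times\overline D$ ($\eta$ need not vanish on $\partial D$). *Distance.* For $\mu_A,\mu_B\in\mathscr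 M^+(\overline D)$ put $$W_\delta(\mu_A,\mu_B)=\inf\Big\{\Big(\int_0^1\mathcal D(\mu_t,\nu_t,\zeta_t)\,dt\Big)^{1/2}:\ (\mu_t,\nu_t,\zeta_t)\in\mathcal{CE}[0,1],\ \mu_0=\mu_A,\ \mu_1=\mu_B\Big\}\in[0,\infty].$$ Let $\mu_A,\mu_B\in\mathscr M^+(\overline D)$ with $W_\delta(\mu_A,\mu_B)<\infty$. Then: 1. the infimum defining $W_\delta(\mu_A,\mu_B)$ is attained; 2. for every minimizer $(\bar\mu_t,\bar\nu_t,\bar\zeta_t)_{t\in[0,1]}$ the curve $(\bar\mu_t)$ is a constant speed geodesic: $W_\delta(\bar\mu_s,\bar\mu_t)=|s-t|\,W_\delta(\mu_A,\mu_B)$ for all $s,t\in[0,1]$; 3. $$W_\delta(\mu_A,\mu_B)=\inf\Big\{\int_0^1\sqrt{\mathcal D(\mu_t,\nu_t,\zeta_t)}\,dt:\ (\mu_t,\nu_t,\zeta_t)\in\mathcal{CE}[0,1],\ \mu_0=\mu_A,\ \mu_1=\mu_B\Big\}.$$ -/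

import Mathlib

open MeasureTheory Set
open scoped ENNReal unitInterval

noncomputable section

namespace GeneralizedTransport

/-- `ℝ^d` with its Euclidean structure. -/
abbrev Space (d : ℕ) : Type := EuclideanSpace ℝ (Fin d)

/-- A bounded domain (nonempty, open and connected set) in `ℝ^d` with Lipschitz boundary: near each
boundary point there is a direction `u` such that `D` is, in a ball, the strict supergraph, in the
direction `u`, of a Lipschitz function of the component orthogonal to `u`. -/
structure IsBoundedLipschitzDomain {d : ℕ} (D : Set (Space d)) : Prop where
  isOpen : IsOpen D
  isConnected : IsConnected D
  isBounded : Bornology.IsBounded D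
  lipschitz_boundary : ∀ p ∈ frontier D, ∃ (u : Space d) (g : Space d → ℝ) (C : NNReal) (r : ℝ),
    ‖u‖ = 1 ∧ LipschitzWith C g ∧ 0 < r ∧
      ∀ x ∈ Metric.ball p r, x ∈ D ↔ g (x - inner ℝ u x • u) < inner ℝ u x

section Action

variable {X : Type*} [MeasurableSpace X] {d : ℕ}

/-- The `i`-th component of an `ℝ^d`-valued measure. -/
def component (ν : VectorMeasure X (Space d)) (i : Fin d) : SignedMeasure X :=
  ν.mapRange (EuclideanSpace.proj i : Space d →L[ℝ] ℝ).toLinearMap.toAddMonoidHom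
    (EuclideanSpace.proj i : Space d →L[ℝ] ℝ).continuous

/-- The function `φ(u, w)`, equal to `|w|² / u` for `u > 0`, to `0` for `u = 0`, `w = 0`, and to
`+∞` for `u = 0`, `w ≠ 0`. -/
def phi (u : ℝ) (w : Space d) : ℝ≥0∞ :=
  if 0 < u then ENNReal.ofReal (‖w‖ ^ 2 / u) else if w = 0 then 0 else ⊤

/-- The singular measure `L^⊥ = μ^⊥ + ∑ᵢ |νᵢ^⊥|`, where `^⊥` is the singular part with respect to
the reference measure `L`; both `μ^⊥` and `ν^⊥` are absolutely continuous with respect to it. -/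
def singularReference (L μ : Measure X) (ν : VectorMeasure X (Space d)) : Measure X :=
  μ.singularPart L + ∑ i, ((component ν i).singularPart L).totalVariation

/-- The Benamou-Brenier action
`A_BB(μ, ν) = ∫ φ(dμ/dL, dν/dL) dL + ∫ φ(dμ^⊥/dL^⊥, dν^⊥/dL^⊥) dL^⊥`. -/
def actionBB (L μ : Measure X) (ν : VectorMeasure X (Space d)) : ℝ≥0∞ :=
  (∫⁻ x, phi (μ.rnDeriv L x).toReal
      (WithLp.toLp 2 fun i => (component ν i).rnDeriv L x) ∂L) +
    ∫⁻ x, phi ((μ.singularPart L).rnDeriv (singularReference L μ ν) x).toReal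
      (WithLp.toLp 2 fun i =>
        ((component ν i).singularPart L).rnDeriv (singularReference L μ ν) x)
      ∂(singularReference L μ ν)

open Classical in
/-- The source action: `A_Z(ζ) = ∫ z² dL` if `ζ = z L`, and `+∞` if `ζ` has a singular part. -/
def actionZ (L : Measure X) (ζ : SignedMeasure X) : ℝ≥0∞ :=
  if ζ.singularPart L = 0 then ∫⁻ x, ENNReal.ofReal (ζ.rnDeriv L x ^ 2) ∂L else ⊤

/-- The action functional `𝓓(μ, ν, ζ) = A_BB(μ, ν) + (1/δ) A_Z(ζ)`. -/
def action (L : Measure X) (δ : ℝ) (μ : Measure X) (ν : VectorMeasure X (Space d))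
    (ζ : SignedMeasure X) : ℝ≥0∞ :=
  actionBB L μ ν + ENNReal.ofReal (1 / δ) * actionZ L ζ

end Action

variable {d : ℕ}

/-- Lebesgue measure on `closure D`. -/
def lebesgue (D : Set (Space d)) : Measure (closure D) :=
  Measure.comap Subtype.val (volume : Measure (Space d))

/-- The class `CE[0,1]` of solutions of `∂ₜμ + div ν = ζ`, for measures on the closure of `D`.
Since `closure D` is compact for bounded `D`, the topology of `FiniteMeasure` is the weak-*
topology of duality with `C(closure D)`. Test functions are the restrictions of `C¹` functions on
`ℝ × ℝ^d`, with compact support in `(0,1) × ℝ^d`; they need not vanish on `∂D`. -/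
structure ContinuityEquation (D : Set (Space d)) (μ : I → FiniteMeasure (closure D))
    (ν : I → VectorMeasure (closure D) (Space d)) (ζ : I → SignedMeasure (closure D)) : Prop where
  continuous_mass : Continuous μ
  measurable_momentum : ∀ B, MeasurableSet B → Measurable fun t => ν t B
  measurable_source : ∀ B, MeasurableSet B → Measurable fun t => ζ t B
  integrable_momentum : ∫⁻ t : I, (ν t).variation univ < ⊤
  integrable_source : ∫⁻ t : I, (ζ t).variation univ < ⊤
  weak_equation : ∀ η : ℝ × Space d → ℝ, ContDiff ℝ 1 η → HasCompactSupport η →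
    tsupport η ⊆ Ioo (0 : ℝ) 1 ×ˢ (univ : Set (Space d)) →
    (∫ t : I, ∫ x : closure D, deriv (fun s : ℝ => η (s, (x : Space d))) (t : ℝ)
        ∂(μ t : Measure (closure D))) +
      (∫ t : I, (ν t).integral
        (fun x : closure D => gradient (fun y : Space d => η ((t : ℝ), y)) (x : Space d))
        (innerSL ℝ)) +
      (∫ t : I, (ζ t).integral
        (fun x : closure D => η ((t : ℝ), (x : Space d))) (ContinuousLinearMap.lsmul ℝ ℝ)) = 0

/-- Solutions of the continuity equation that connect `μA` to `μB`. -/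
structure Connects (D : Set (Space d)) (μA μB : FiniteMeasure (closure D))
    (μ : I → FiniteMeasure (closure D)) (ν : I → VectorMeasure (closure D) (Space d))
    (ζ : I → SignedMeasure (closure D)) : Prop where
  continuityEquation : ContinuityEquation D μ ν ζ
  initial : μ 0 = μA
  final : μ 1 = μB

/-- The action `𝓓(μ_t, ν_t, ζ_t)` at time `t`. -/
def actionAt (D : Set (Space d)) (δ : ℝ) (μ : I → FiniteMeasure (closure D))
    (ν : I → VectorMeasure (closure D) (Space d)) (ζ : I → SignedMeasure (closure D))
    (t : I) : ℝ≥0∞ :=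
  action (lebesgue D) δ (μ t : Measure (closure D)) (ν t) (ζ t)

/-- The extended distance `W_δ(μA, μB)`: the infimum of `(∫₀¹ 𝓓(μ_t, ν_t, ζ_t) dt)^(1/2)` over all
solutions of the continuity equation that connect `μA` to `μB`. -/
def W (D : Set (Space d)) (δ : ℝ) (μA μB : FiniteMeasure (closure D)) : ℝ≥0∞ :=
  ⨅ (μ : I → FiniteMeasure (closure D)) (ν : I → VectorMeasure (closure D) (Space d))
    (ζ : I → SignedMeasure (closure D)) (_ : Connects D μA μB μ ν ζ),
    (∫⁻ t : I, actionAt D δ μ ν ζ t) ^ (1 / 2 : ℝ)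

/-- A minimizer in the definition of `W_δ(μA, μB)`. -/
def IsMinimizer (D : Set (Space d)) (δ : ℝ) (μA μB : FiniteMeasure (closure D))
    (μ : I → FiniteMeasure (closure D)) (ν : I → VectorMeasure (closure D) (Space d))
    (ζ : I → SignedMeasure (closure D)) : Prop :=
  Connects D μA μB μ ν ζ ∧ (∫⁻ t : I, actionAt D δ μ ν ζ t) ^ (1 / 2 : ℝ) = W D δ μA μB

end GeneralizedTransport

end

/-!
Both parts of the action are quadratic energies: `A_BB(μ, ν)` is `∫ |v|² dμ` for `ν = v μ` (and `+∞`
if there is no such `v`), and `A_Z(ζ)` is `∫ z² dL` for `ζ = z L` (`action_eq_energy`). The energy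
`∫ |v|² dμ` has the dual description `sup_b (2 ∫ b · dν - ∫ |b|² dμ)` over continuous `b`
(`energy_eq_iSup`). It gives measurability in time, and lower semicontinuity by the Riesz
representation theorem in `L²` (`exists_density_of_sq_le`).

The *speed* of a curve is the square root of its action, and the *length* is the integral of the
speed. For curves of finite length, the distributional continuity equation is equivalent to its
integrated form `∫ f dμ_t - ∫ f dμ_s = ∫_s^t (∫ ∇f · dν_r + ∫ f dζ_r) dr` for `C¹` functions `f` of
space (`IsFiniteLengthCurve.of_continuityEquation`, `IsFiniteLengthCurve.continuityEquation`). In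
this form, time changes, restrictions, reversals and concatenations of curves are curves again.
Reparametrization by arclength shows that the distance of the end points of a curve is at most its
length (`IsFiniteLengthCurve.W_le_lintegral_speed`); the converse is the Cauchy-Schwarz inequality.
Hence the distance is the infimum of the lengths (`W_eq_iInf_length`) and satisfies the triangle
inequality (`W_triangle`). For a minimizer, equality holds in the Cauchy-Schwarz inequality, so that
its speed is constant, and the triangle inequality turns it into a geodesic (`IsMinimizer.W_eq`).

Existence is the direct method (`exists_isMinimizer`). A minimizing sequence is chosen with bounded
speed, so the integrals `∫ f dμ_t` are equi-Lipschitz in time for each `C¹` function `f`, and the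
masses are bounded. Along an ultrafilter, the measures converge at each time, and integrals of
continuous functions converge uniformly in time (`exists_limit_curve`). The momenta and sources
define functionals on continuous functions of space-time whose limits are bounded in `L²` of the
limiting space-time measure; their densities are the momentum and source of the limit curve, and the
energies do not increase (`exists_limit_momentum`). The weak equation is linear, hence passes to the
limit.
-/

/-! ### Vector measures and integration of continuous functions -/

namespace GeneralizedTransport

open Filter Topology

section VectorMeasures

variable {X : Type*} [MeasurableSpace X]
  {E : Type*} [NormedAddCommGroup E] [InnerProductSpace ℝ E]

/-- The real-valued coordinate `⟪e, ν⟫` of a vector measure `ν`. -/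
noncomputable def coordinate (ν : VectorMeasure X E) (e : E) : SignedMeasure X :=
  ν.mapRange (innerSL ℝ e).toLinearMap.toAddMonoidHom (innerSL ℝ e).continuous

@[simp] lemma coordinate_apply (ν : VectorMeasure X E) (e : E) (B : Set X) :
    coordinate ν e B = inner ℝ e (ν B) := rfl

instance isFiniteMeasure_variation_signedMeasure (ν : SignedMeasure X) :
    IsFiniteMeasure ν.variation := by
  rw [← SignedMeasure.totalVariation_eq_variation, SignedMeasure.totalVariation]
  infer_instance

/-- A vector measure with values in a finite-dimensional space has finite variation. -/
instance isFiniteMeasure_variation [FiniteDimensional ℝ E] (ν : VectorMeasure X E) :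
    IsFiniteMeasure ν.variation := by
  let e := stdOrthonormalBasis ℝ E
  refine isFiniteMeasure_of_le (∑ i, (coordinate ν (e i)).variation)
    (VectorMeasure.variation_le_of_forall_enorm_le fun B _ => ?_)
  calc ‖ν B‖ₑ = ‖∑ i, inner ℝ (e i) (ν B) • e i‖ₑ := by rw [e.sum_repr' (ν B)]
    _ ≤ ∑ i, ‖inner ℝ (e i) (ν B) • e i‖ₑ := enorm_sum_le _ _
    _ = ∑ i, ‖coordinate ν (e i) B‖ₑ := by
        refine Finset.sum_congr rfl fun i _ => ?_
        have h1 : ‖e i‖ₑ = 1 := by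
          rw [← ofReal_norm, e.orthonormal.1 i, ENNReal.ofReal_one]
        rw [enorm_smul, h1, mul_one, coordinate_apply]
    _ ≤ ∑ i, (coordinate ν (e i)).variation B := by
        gcongr with i
        exact VectorMeasure.enorm_measure_le_variation _ _
    _ = (∑ i, (coordinate ν (e i)).variation) B := by
        simp [Measure.finsetSum_apply]

/-- Induction principle for bounded measurable functions: a property that holds for multiples of
indicators and is stable under finite sums and bounded pointwise limits holds for all of them. -/
lemma bounded_induction {P : (X → E) → Prop}
    (hind : ∀ (c : E) (B : Set X), MeasurableSet B → P (B.indicator fun _ => c))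
    (hadd : ∀ f g : X → E, StronglyMeasurable f → StronglyMeasurable g →
      (∃ C, ∀ x, ‖f x‖ ≤ C) → (∃ C, ∀ x, ‖g x‖ ≤ C) → P f → P g → P (f + g))
    (hlim : ∀ (F : ℕ → X → E) (f : X → E) (C : ℝ), (∀ n, StronglyMeasurable (F n)) →
      (∀ n x, ‖F n x‖ ≤ C) → (∀ x, Tendsto (fun n => F n x) atTop (𝓝 (f x))) →
      (∀ n, P (F n)) → P f)
    {f : X → E} (hf : StronglyMeasurable f) {C : ℝ} (hC : ∀ x, ‖f x‖ ≤ C) : P f := by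
  have hbdd : ∀ g : SimpleFunc X E, ∃ C, ∀ x, ‖g x‖ ≤ C := by
    intro g
    obtain ⟨C, hC⟩ := (g.finite_range.image norm).bddAbove
    exact ⟨C, fun x => hC ⟨g x, mem_range_self x, rfl⟩⟩
  have hsimple : ∀ g : SimpleFunc X E, P g := by
    intro g
    induction g using SimpleFunc.induction with
    | const c hs =>
      convert hind c _ hs using 1
      ext x
      simp [SimpleFunc.piecewise_apply, Set.indicator]
    | add _ hf hg =>
      rw [SimpleFunc.coe_add]
      exact hadd _ _ (SimpleFunc.stronglyMeasurable _) (SimpleFunc.stronglyMeasurable _)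
        (hbdd _) (hbdd _) hf hg
  rcases isEmpty_or_nonempty X with hX | ⟨⟨x₀⟩⟩
  · convert hind 0 ∅ MeasurableSet.empty
  have hC0 : 0 ≤ C := (norm_nonneg _).trans (hC x₀)
  refine hlim (fun n => hf.approxBounded C n) f C
    (fun n => SimpleFunc.stronglyMeasurable _)
    (fun n x => hf.norm_approxBounded_le hC0 n x)
    (fun x => hf.tendsto_approxBounded_of_norm_le (hC x)) (fun n => hsimple _)

omit [InnerProductSpace ℝ E] in
lemma integrable_of_bounded (ν : Measure X) [IsFiniteMeasure ν] {f : X → E}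
    (hf : StronglyMeasurable f) {C : ℝ} (hC : ∀ x, ‖f x‖ ≤ C) : Integrable f ν :=
  Integrable.of_bound hf.aestronglyMeasurable C (Eventually.of_forall hC)

variable [FiniteDimensional ℝ E]

lemma integral_indicator_const (ν : VectorMeasure X E) {B : Set X} (hB : MeasurableSet B) (c : E) :
    ν.integral (B.indicator fun _ => c) (innerSL ℝ) = inner ℝ c (ν B) := by
  have := VectorMeasure.integral_indicator (μ := ν) (f := fun _ => c) (B := innerSL ℝ) hB
  rw [this, VectorMeasure.integral_const, VectorMeasure.restrict_apply _ hB MeasurableSet.univ,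
    univ_inter]
  rfl

lemma norm_integral_le (ν : VectorMeasure X E) {f : X → E} {C : ℝ} (hC : ∀ x, ‖f x‖ ≤ C) :
    ‖ν.integral f (innerSL ℝ)‖ ≤ C * ν.variation.real univ := by
  rcases isEmpty_or_nonempty X with hX | ⟨⟨x₀⟩⟩
  · rw [VectorMeasure.integral_of_isEmpty, norm_zero]
    simp [Measure.eq_zero_of_isEmpty]
  have hC0 : 0 ≤ C := (norm_nonneg _).trans (hC x₀)
  refine (VectorMeasure.norm_integral_le_of_norm_le_const (μ := ν) (B := innerSL ℝ)
    (Eventually.of_forall hC)).trans ?_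
  have : ‖(innerSL ℝ : E →L[ℝ] E →L[ℝ] ℝ)‖ ≤ 1 := norm_innerSL_le ℝ
  gcongr
  exact mul_le_of_le_one_right hC0 this

/-- The integral of `f` with respect to the vector measure `v μ` is `∫ ⟪f, v⟫ dμ`. -/
lemma integral_withDensityᵥ {μ : Measure X} {v : X → E} (hv : Integrable v μ) {f : X → E}
    (hf : StronglyMeasurable f) {C : ℝ} (hC : ∀ x, ‖f x‖ ≤ C) :
    (μ.withDensityᵥ v).integral f (innerSL ℝ) = ∫ x, inner ℝ (f x) (v x) ∂μ := by
  have hint : ∀ g : X → E, StronglyMeasurable g → (∃ C, ∀ x, ‖g x‖ ≤ C) →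
      Integrable (fun x => (inner ℝ (g x) (v x) : ℝ)) μ := by
    rintro g hg ⟨C, hC⟩
    refine (hv.norm.const_mul C).mono
      (hg.aestronglyMeasurable.inner hv.aestronglyMeasurable) (Eventually.of_forall fun x => ?_)
    calc ‖(inner ℝ (g x) (v x) : ℝ)‖ ≤ ‖g x‖ * ‖v x‖ := norm_inner_le_norm _ _
      _ ≤ C * ‖v x‖ := by gcongr; exact hC x
      _ ≤ ‖C * ‖v x‖‖ := le_abs_self _
  refine bounded_induction (P := fun f => (μ.withDensityᵥ v).integral f (innerSL ℝ) =
    ∫ x, inner ℝ (f x) (v x) ∂μ) ?_ ?_ ?_ hf hC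
  · intro c B hB
    have h1 : (fun x => (inner ℝ (B.indicator (fun _ => c) x) (v x) : ℝ)) =
        B.indicator fun x => inner ℝ c (v x) := by
      ext x
      by_cases hx : x ∈ B <;> simp [hx]
    rw [integral_indicator_const _ hB, withDensityᵥ_apply hv hB, h1, integral_indicator hB,
      integral_inner hv.integrableOn]
  · rintro f g hf hg ⟨Cf, hCf⟩ ⟨Cg, hCg⟩ h1 h2
    have h3 := VectorMeasure.integral_fun_add (μ := μ.withDensityᵥ v) (B := innerSL ℝ)
      (integrable_of_bounded _ hf hCf) (integrable_of_bounded _ hg hCg)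
    change (μ.withDensityᵥ v).integral (fun x => f x + g x) (innerSL ℝ) = _
    rw [h3, h1, h2, ← integral_add (hint f hf ⟨Cf, hCf⟩) (hint g hg ⟨Cg, hCg⟩)]
    simp [inner_add_left]
  · intro F f C hF hC hlim h
    have h1 : Tendsto (fun n => (μ.withDensityᵥ v).integral (F n) (innerSL ℝ)) atTop
        (𝓝 ((μ.withDensityᵥ v).integral f (innerSL ℝ))) :=
      VectorMeasure.tendsto_integral_of_dominated_convergence (fun _ => C)
      (fun n => (hF n).aestronglyMeasurable) (integrable_const _)
      (fun n => Eventually.of_forall (hC n)) (Eventually.of_forall hlim)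
    have h2 : Tendsto (fun n => ∫ x, (inner ℝ (F n x) (v x) : ℝ) ∂μ) atTop
        (𝓝 (∫ x, inner ℝ (f x) (v x) ∂μ)) := by
      refine tendsto_integral_of_dominated_convergence (fun x => C * ‖v x‖)
        (fun n => (hF n).aestronglyMeasurable.inner hv.aestronglyMeasurable)
        (hv.norm.const_mul C) (fun n => Eventually.of_forall fun x => ?_)
        (Eventually.of_forall fun x => (hlim x).inner tendsto_const_nhds)
      calc ‖(inner ℝ (F n x) (v x) : ℝ)‖ ≤ ‖F n x‖ * ‖v x‖ := norm_inner_le_norm _ _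
        _ ≤ C * ‖v x‖ := by gcongr; exact hC n x
    simp_rw [h] at h1
    exact tendsto_nhds_unique h1 h2

/-- The integral of a bounded function depends measurably on the vector measure. -/
lemma measurable_integral {T : Type*} [MeasurableSpace T] {ν : T → VectorMeasure X E}
    [MeasurableSpace E] [BorelSpace E]
    (hν : ∀ B, MeasurableSet B → Measurable fun t => ν t B) {f : X → E}
    (hf : StronglyMeasurable f) {C : ℝ} (hC : ∀ x, ‖f x‖ ≤ C) :
    Measurable fun t => (ν t).integral f (innerSL ℝ) := by
  refine bounded_induction (P := fun f => Measurable fun t => (ν t).integral f (innerSL ℝ))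
    ?_ ?_ ?_ hf hC
  · intro c B hB
    simp_rw [integral_indicator_const _ hB]
    exact (hν B hB).const_inner
  · rintro f g hf hg ⟨Cf, hCf⟩ ⟨Cg, hCg⟩ h1 h2
    convert h1.add h2 using 2 with t
    exact VectorMeasure.integral_fun_add
      (integrable_of_bounded _ hf hCf) (integrable_of_bounded _ hg hCg)
  · intro F f C hF hC hlim h
    refine measurable_of_tendsto_metrizable h (tendsto_pi_nhds.2 fun t => ?_)
    exact VectorMeasure.tendsto_integral_of_dominated_convergence (fun _ => C)
      (fun n => (hF n).aestronglyMeasurable) (integrable_const _)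
      (fun n => Eventually.of_forall (hC n)) (Eventually.of_forall hlim)

/-- On the line, the inner product and the scalar multiplication are the same pairing. -/
lemma lsmul_eq_innerSL : (ContinuousLinearMap.lsmul ℝ ℝ : ℝ →L[ℝ] ℝ →L[ℝ] ℝ) = innerSL ℝ := by
  ext
  change _ = inner ℝ (1 : ℝ) 1
  simp

/-- Testing a coordinate with `f` amounts to testing the vector measure with `f • e`; this reduces
uniqueness for vector measures to the scalar case. -/
lemma coordinate_integral (ν : VectorMeasure X E) (e : E) {f : X → ℝ}
    (hf : StronglyMeasurable f) {C : ℝ} (hC : ∀ x, ‖f x‖ ≤ C) :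
    (coordinate ν e).integral f (innerSL ℝ) = ν.integral (fun x => f x • e) (innerSL ℝ) := by
  refine bounded_induction (P := fun f => (coordinate ν e).integral f (innerSL ℝ) =
    ν.integral (fun x => f x • e) (innerSL ℝ)) ?_ ?_ ?_ hf hC
  · intro c B hB
    have h1 : (fun x => B.indicator (fun _ => c) x • e) = B.indicator fun _ => c • e := by
      ext x
      by_cases hx : x ∈ B <;> simp [hx]
    rw [integral_indicator_const _ hB, h1, integral_indicator_const _ hB, coordinate_apply,
      inner_smul_left]
    simp [mul_comm]
  · rintro f g hf hg ⟨Cf, hCf⟩ ⟨Cg, hCg⟩ h1 h2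
    have h4 : ∀ f : X → ℝ, StronglyMeasurable f → ∀ C, (∀ x, ‖f x‖ ≤ C) →
        ν.Integrable fun x => f x • e := by
      intro f hf C hC
      refine integrable_of_bounded _ (hf.smul_const e) (C := C * ‖e‖) fun x => ?_
      rw [norm_smul]
      gcongr
      exact hC x
    have h3 := VectorMeasure.integral_fun_add (μ := coordinate ν e) (B := innerSL ℝ)
      (integrable_of_bounded _ hf hCf) (integrable_of_bounded _ hg hCg)
    change (coordinate ν e).integral (fun x => f x + g x) (innerSL ℝ) = _
    rw [h3, h1, h2, ← VectorMeasure.integral_fun_add (h4 f hf _ hCf) (h4 g hg _ hCg)]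
    simp [add_smul]
  · intro F f C hF hC hlim h
    have h1 : Tendsto (fun n => (coordinate ν e).integral (F n) (innerSL ℝ)) atTop
        (𝓝 ((coordinate ν e).integral f (innerSL ℝ))) :=
      VectorMeasure.tendsto_integral_of_dominated_convergence (fun _ => C)
      (fun n => (hF n).aestronglyMeasurable) (integrable_const _)
      (fun n => Eventually.of_forall (hC n)) (Eventually.of_forall hlim)
    have h2 : Tendsto (fun n => ν.integral (fun x => F n x • e) (innerSL ℝ)) atTop
        (𝓝 (ν.integral (fun x => f x • e) (innerSL ℝ))) :=
      VectorMeasure.tendsto_integral_of_dominated_convergence (fun _ => C * ‖e‖)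
      (fun n => ((hF n).smul_const e).aestronglyMeasurable) (integrable_const _)
      (fun n => Eventually.of_forall fun x => by
        rw [norm_smul]
        gcongr
        exact hC n x)
      (Eventually.of_forall fun x => (hlim x).smul_const e)
    simp_rw [h] at h1
    exact tendsto_nhds_unique h1 h2

end VectorMeasures

section Uniqueness

variable {X : Type*} [MeasurableSpace X] [TopologicalSpace X] [CompactSpace X] [BorelSpace X]
  [HasOuterApproxClosed X]
  {E : Type*} [NormedAddCommGroup E] [InnerProductSpace ℝ E] [FiniteDimensional ℝ E]

/-- The positive and the negative part of the Jordan decomposition have the same integrals of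
continuous functions, hence coincide. -/
lemma signedMeasure_eq_zero_of_integral_continuous {s : SignedMeasure X}
    (h : ∀ f : C(X, ℝ), s.integral f (innerSL ℝ) = 0) : s = 0 := by
  rw [← s.toSignedMeasure_toJordanDecomposition, JordanDecomposition.toSignedMeasure] at h ⊢
  rw [sub_eq_zero]
  congr 1
  refine ext_of_forall_integral_eq_of_IsFiniteMeasure fun f => ?_
  have hC : ∀ x, ‖f x‖ ≤ ‖f‖ := f.norm_coe_le_norm
  have hf : StronglyMeasurable f := f.continuous.stronglyMeasurable_of_hasCompactSupport
    (HasCompactSupport.of_compactSpace _)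
  have h1 := h f.toContinuousMap
  have h2 := VectorMeasure.integral_sub_vectorMeasure (f := f) (B := innerSL ℝ)
    (μ := s.toJordanDecomposition.posPart.toSignedMeasure)
    (ν := s.toJordanDecomposition.negPart.toSignedMeasure)
    (integrable_of_bounded _ hf hC) (integrable_of_bounded _ hf hC)
  have h3 : (innerSL ℝ : ℝ →L[ℝ] ℝ →L[ℝ] ℝ) = (ContinuousLinearMap.lsmul ℝ ℝ).flip := by
    ext; simp [innerSL_apply_apply]
  rw [h3] at h1 h2
  rw [VectorMeasure.integral_toSignedMeasure, VectorMeasure.integral_toSignedMeasure] at h2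
  exact sub_eq_zero.1 (h2.symm.trans h1)

/-- A vector measure on a compact metric space is determined by the integrals of continuous
functions. -/
lemma vectorMeasure_eq_zero_of_integral_continuous {ν : VectorMeasure X E}
    (h : ∀ f : C(X, E), ν.integral f (innerSL ℝ) = 0) : ν = 0 := by
  have h1 : ∀ e : E, coordinate ν e = 0 := by
    intro e
    refine signedMeasure_eq_zero_of_integral_continuous fun f => ?_
    have hf : StronglyMeasurable f := f.continuous.stronglyMeasurable_of_hasCompactSupport
      (HasCompactSupport.of_compactSpace _)
    rw [coordinate_integral ν e hf f.norm_coe_le_norm]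
    exact h ⟨fun x => f x • e, by fun_prop⟩
  ext B hB
  have h2 : inner ℝ (ν B) (ν B) = (0 : ℝ) := by
    rw [← coordinate_apply, h1]
    rfl
  simpa using h2

end Uniqueness

end GeneralizedTransport

/-! ### Quadratic energy of a vector measure and its dual description -/

namespace GeneralizedTransport

open Filter Topology

section Energy

variable {X : Type*} [MeasurableSpace X]
  {E : Type*} [NormedAddCommGroup E] [InnerProductSpace ℝ E]

/-- The quadratic energy `∫ |v|² dμ` of a vector measure `ν = v μ` with a square-integrable density
with respect to `μ`; it is `+∞` if there is no such density. -/
noncomputable def energy (μ : Measure X) (ν : VectorMeasure X E) : ℝ≥0∞ :=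
  ⨅ (v : X → E) (_ : MemLp v 2 μ) (_ : ν = μ.withDensityᵥ v), ∫⁻ x, ‖v x‖ₑ ^ 2 ∂μ

omit [InnerProductSpace ℝ E] in
lemma memLp_two_iff_lintegral {μ : Measure X} {v : X → E} (hv : AEStronglyMeasurable v μ) :
    MemLp v 2 μ ↔ ∫⁻ x, ‖v x‖ₑ ^ 2 ∂μ < ⊤ := by
  have h := eLpNorm_lt_top_iff_lintegral_rpow_enorm_lt_top (f := v) (μ := μ) (p := 2)
    (by norm_num) (by norm_num)
  simp only [ENNReal.toReal_ofNat, ENNReal.rpow_ofNat] at h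
  rw [← h]
  exact ⟨fun h => h.2, fun h => ⟨hv, h⟩⟩

/-- The infimum in the definition of the energy is over at most one density, up to null sets. -/
lemma energy_withDensityᵥ [CompleteSpace E] {μ : Measure X} [IsFiniteMeasure μ] {v : X → E}
    (hv : MemLp v 2 μ) : energy μ (μ.withDensityᵥ v) = ∫⁻ x, ‖v x‖ₑ ^ 2 ∂μ := by
  refine le_antisymm (iInf₂_le_of_le v hv (iInf_le _ rfl)) ?_
  refine le_iInf₂ fun w hw => le_iInf fun h => ?_
  have h1 := (hv.integrable one_le_two).ae_eq_of_withDensityᵥ_eq (hw.integrable one_le_two) h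
  exact (lintegral_congr_ae (h1.mono fun x hx => by simp only [hx])).le

lemma exists_density_of_energy_lt_top [CompleteSpace E] {μ : Measure X} [IsFiniteMeasure μ]
    {ν : VectorMeasure X E} (h : energy μ ν < ⊤) :
    ∃ v : X → E, StronglyMeasurable v ∧ MemLp v 2 μ ∧ ν = μ.withDensityᵥ v ∧
      energy μ ν = ∫⁻ x, ‖v x‖ₑ ^ 2 ∂μ := by
  obtain ⟨w, hw, rfl, -⟩ : ∃ w, MemLp w 2 μ ∧ ν = μ.withDensityᵥ w ∧ True := by
    by_contra! hcon
    refine h.ne (iInf_eq_top.2 fun w => iInf_eq_top.2 fun hw => iInf_eq_top.2 fun hν => ?_)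
    exact (hcon w hw hν).elim
  have hae := hw.1.ae_eq_mk
  have h1 : μ.withDensityᵥ w = μ.withDensityᵥ (hw.1.mk w) := WithDensityᵥEq.congr_ae hae
  have h2 : MemLp (hw.1.mk w) 2 μ := (memLp_congr_ae hae).1 hw
  exact ⟨hw.1.mk w, hw.1.stronglyMeasurable_mk, h2, h1, by rw [h1, energy_withDensityᵥ h2]⟩

lemma energy_zero [CompleteSpace E] (μ : Measure X) [IsFiniteMeasure μ] :
    energy μ (0 : VectorMeasure X E) = 0 := by
  have := energy_withDensityᵥ (E := E) (μ := μ) (v := 0) (MemLp.zero)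
  rw [withDensityᵥ_zero] at this
  simp [this]

lemma energy_smul_le [CompleteSpace E] (μ : Measure X) [IsFiniteMeasure μ]
    (ν : VectorMeasure X E) {c : ℝ} (hc : c ≠ 0) :
    energy μ (c • ν) ≤ ENNReal.ofReal (c ^ 2) * energy μ ν := by
  rcases eq_or_ne (energy μ ν) ⊤ with h | h
  · rw [h, ENNReal.mul_top (by simpa using hc)]
    exact le_top
  obtain ⟨v, hv, hv2, hν, he⟩ := exists_density_of_energy_lt_top h.lt_top
  rw [he]
  conv_lhs => rw [hν]
  rw [← withDensityᵥ_smul, energy_withDensityᵥ (hv2.const_smul c),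
    ← lintegral_const_mul _ (hv.enorm.pow_const 2)]
  refine (lintegral_congr fun x => ?_).le
  rw [Pi.smul_apply, enorm_smul, mul_pow, Real.enorm_eq_ofReal_abs, ← ENNReal.ofReal_pow (abs_nonneg _),
    sq_abs]

/-- The energy is quadratic. -/
lemma energy_smul [CompleteSpace E] (μ : Measure X) [IsFiniteMeasure μ]
    (ν : VectorMeasure X E) (c : ℝ) :
    energy μ (c • ν) = ENNReal.ofReal (c ^ 2) * energy μ ν := by
  rcases eq_or_ne c 0 with rfl | hc
  · simp [energy_zero]
  refine le_antisymm (energy_smul_le μ ν hc) ?_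
  have h := energy_smul_le μ (c • ν) (inv_ne_zero hc)
  rw [smul_smul, inv_mul_cancel₀ hc, one_smul] at h
  calc _ ≤ ENNReal.ofReal (c ^ 2) * (ENNReal.ofReal (c⁻¹ ^ 2) * energy μ (c • ν)) := by gcongr
    _ = energy μ (c • ν) := by
      rw [← mul_assoc, ← ENNReal.ofReal_mul (by positivity)]
      have : c ^ 2 * c⁻¹ ^ 2 = 1 := by field_simp
      rw [this, ENNReal.ofReal_one, one_mul]

/-- By the Cauchy-Schwarz inequality, momenta of finite energy have finite total variation, with a
bound that is linear in the square root of the energy. -/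
lemma variation_le_of_energy_lt_top [CompleteSpace E] {μ : Measure X} [IsFiniteMeasure μ]
    {ν : VectorMeasure X E} (h : energy μ ν < ⊤) :
    ν.variation univ ≤ (μ univ) ^ (1 / 2 : ℝ) * (energy μ ν) ^ (1 / 2 : ℝ) := by
  obtain ⟨v, hv, hv2, hν, he⟩ := exists_density_of_energy_lt_top h
  rw [he]
  have h1 : ν.variation ≤ μ.withDensity fun x => ‖v x‖ₑ := by
    refine VectorMeasure.variation_le_of_forall_enorm_le fun B hB => ?_
    rw [hν, withDensityᵥ_apply (hv2.integrable one_le_two) hB, withDensity_apply _ hB]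
    exact enorm_integral_le_lintegral_enorm _
  calc ν.variation univ ≤ ∫⁻ x, 1 * ‖v x‖ₑ ∂μ := by
        refine (h1 univ).trans ?_
        simp [withDensity_apply]
    _ ≤ (∫⁻ _, 1 ^ (2 : ℝ) ∂μ) ^ (1 / 2 : ℝ) * (∫⁻ x, ‖v x‖ₑ ^ (2 : ℝ) ∂μ) ^ (1 / 2 : ℝ) :=
        ENNReal.lintegral_mul_le_Lp_mul_Lq μ Real.HolderConjugate.two_two
          aemeasurable_const hv.enorm.aemeasurable
    _ = _ := by simp

end Energy

section Duality

variable {X : Type*} [MetricSpace X] [CompactSpace X] [MeasurableSpace X] [BorelSpace X]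
  {E : Type*} [NormedAddCommGroup E] [InnerProductSpace ℝ E] [FiniteDimensional ℝ E]

omit [InnerProductSpace ℝ E] [FiniteDimensional ℝ E] in
lemma stronglyMeasurable_continuousMap (b : C(X, E)) : StronglyMeasurable b :=
  b.continuous.stronglyMeasurable_of_hasCompactSupport (HasCompactSupport.of_compactSpace _)

omit [InnerProductSpace ℝ E] [FiniteDimensional ℝ E] in
lemma integrable_continuousMap (μ : Measure X) [IsFiniteMeasure μ] (b : C(X, E)) :
    Integrable b μ :=
  integrable_of_bounded μ (stronglyMeasurable_continuousMap b) b.norm_coe_le_norm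

/-- The duality pairing `b ↦ ∫ b · dν` of a vector measure with continuous functions. -/
noncomputable def pairing (ν : VectorMeasure X E) : C(X, E) →L[ℝ] ℝ :=
  LinearMap.mkContinuous
    { toFun := fun b => ν.integral b (innerSL ℝ)
      map_add' := fun a b => VectorMeasure.integral_fun_add
        (integrable_continuousMap _ a) (integrable_continuousMap _ b)
      map_smul' := fun c b => VectorMeasure.integral_fun_smul ν (innerSL ℝ) c b }
    (ν.variation.real univ)
    fun b => (norm_integral_le ν b.norm_coe_le_norm).trans_eq (mul_comm _ _)

lemma pairing_apply (ν : VectorMeasure X E) (b : C(X, E)) :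
    pairing ν b = ν.integral b (innerSL ℝ) := rfl

lemma measurable_pairing {T : Type*} [MeasurableSpace T] [MeasurableSpace E] [BorelSpace E]
    {ν : T → VectorMeasure X E} (hν : ∀ B, MeasurableSet B → Measurable fun t => ν t B)
    (b : C(X, E)) : Measurable fun t => pairing (ν t) b :=
  measurable_integral hν (stronglyMeasurable_continuousMap b) b.norm_coe_le_norm

lemma pairing_add (ν₁ ν₂ : VectorMeasure X E) (b : C(X, E)) :
    pairing (ν₁ + ν₂) b = pairing ν₁ b + pairing ν₂ b :=
  VectorMeasure.integral_add_vectorMeasure (integrable_continuousMap _ b)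
    (integrable_continuousMap _ b)

lemma pairing_smul (c : ℝ) (ν : VectorMeasure X E) (b : C(X, E)) :
    pairing (c • ν) b = c * pairing ν b :=
  VectorMeasure.integral_smul_vectorMeasure _ c

lemma pairing_withDensityᵥ {μ : Measure X} {v : X → E} (hv : Integrable v μ) (b : C(X, E)) :
    pairing (μ.withDensityᵥ v) b = ∫ x, inner ℝ (b x) (v x) ∂μ :=
  integral_withDensityᵥ hv (stronglyMeasurable_continuousMap b) b.norm_coe_le_norm

/-- The continuous function `|b|²`. -/
def normSq (b : C(X, E)) : C(X, ℝ) := ⟨fun x => ‖b x‖ ^ 2, by fun_prop⟩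

/-- Riesz representation: a linear functional on continuous functions that is bounded for the norm
of `L²(m)` is given by an `L²` density. -/
lemma exists_density_of_sq_le (m : Measure X) [IsFiniteMeasure m] (Λ : C(X, E) →ₗ[ℝ] ℝ)
    {A : ℝ} (hA : 0 ≤ A) (h : ∀ b, (Λ b) ^ 2 ≤ (∫ x, ‖b x‖ ^ 2 ∂m) * A) :
    ∃ v : X → E, StronglyMeasurable v ∧ MemLp v 2 m ∧
      (∀ b, Λ b = ∫ x, inner ℝ (b x) (v x) ∂m) ∧ ∫⁻ x, ‖v x‖ₑ ^ 2 ∂m ≤ ENNReal.ofReal A := by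
  let e : C(X, E) →L[ℝ] Lp E 2 m := ContinuousMap.toLp 2 m ℝ
  have hdense : DenseRange e := ContinuousMap.toLp_denseRange E m ℝ (by norm_num)
  have hcoe : ∀ b, e b =ᵐ[m] b := fun b => ContinuousMap.coeFn_toLp m b
  have hnorm : ∀ b, ‖e b‖ ^ 2 = ∫ x, ‖b x‖ ^ 2 ∂m := by
    intro b
    rw [← real_inner_self_eq_norm_sq, L2.inner_def]
    refine integral_congr_ae ((hcoe b).mono fun x hx => ?_)
    simp only [hx, real_inner_self_eq_norm_sq]
  have hbound : ∀ b, ‖Λ b‖ ≤ √A * ‖(e : C(X, E) →ₗ[ℝ] Lp E 2 m) b‖ := by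
    intro b
    refine abs_le_of_sq_le_sq' ?_ (by positivity) |> abs_le.2
    rw [mul_pow, Real.sq_sqrt hA, mul_comm]
    exact (h b).trans_eq (by rw [← hnorm b]; rfl)
  let T := Λ.extendOfNorm (e : C(X, E) →ₗ[ℝ] Lp E 2 m)
  have hT : ∀ b, T (e b) = Λ b := LinearMap.extendOfNorm_eq hdense ⟨_, hbound⟩
  have hTn : ‖T‖ ≤ √A := ContinuousLinearMap.opNorm_le_bound _ (Real.sqrt_nonneg A)
    (LinearMap.norm_extendOfNorm_apply_le hdense _ hbound)
  let w : Lp E 2 m := (InnerProductSpace.toDual ℝ (Lp E 2 m)).symm T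
  have hw : ‖w‖ ≤ √A := by simpa [w] using hTn
  refine ⟨w, Lp.stronglyMeasurable w, Lp.memLp w, fun b => ?_, ?_⟩
  · rw [← hT b, ← InnerProductSpace.toDual_symm_apply (x := e b) (y := T), L2.inner_def]
    refine integral_congr_ae ((hcoe b).mono fun x hx => ?_)
    simp only [hx]
    exact real_inner_comm _ _
  · have h1 : (∫⁻ x, ‖w x‖ₑ ^ 2 ∂m) = ‖w‖ₑ ^ 2 := by
      rw [Lp.enorm_def, eLpNorm_eq_lintegral_rpow_enorm_toReal (by norm_num) (by norm_num)]
      simp only [ENNReal.toReal_ofNat, ENNReal.rpow_ofNat]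
      rw [← ENNReal.rpow_ofNat, ← ENNReal.rpow_mul]
      simp
    rw [h1, ← ofReal_norm, ← ENNReal.ofReal_pow (norm_nonneg _)]
    refine ENNReal.ofReal_le_ofReal ?_
    calc ‖w‖ ^ 2 ≤ √A ^ 2 := by gcongr
      _ = A := Real.sq_sqrt hA

lemma sq_le_of_forall_two_mul_sub_le {x q A : ℝ} (h : ∀ c : ℝ, 2 * (c * x) - c ^ 2 * q ≤ A) :
    x ^ 2 ≤ q * A := by
  have h1 := discrim_le_zero (a := q) (b := -2 * x) (c := A) fun c => by linarith [h c]
  rw [discrim] at h1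
  linarith

/-- The elementary half of the duality, `2 ⟨b, v⟩ - |b|² ≤ |v|²` integrated against `μ`. -/
lemma two_mul_pairing_sub_le {μ : Measure X} [IsFiniteMeasure μ] {ν : VectorMeasure X E}
    (h : energy μ ν < ⊤) (b : C(X, E)) :
    2 * pairing ν b - ∫ x, ‖b x‖ ^ 2 ∂μ ≤ (energy μ ν).toReal := by
  obtain ⟨v, hv, hv2, hν, he⟩ := exists_density_of_energy_lt_top h
  have h1 : Integrable (fun x => ‖v x‖ ^ 2) μ := hv2.integrable_norm_pow two_ne_zero
  have h2 : Integrable (fun x => ‖b x‖ ^ 2) μ := integrable_continuousMap μ (normSq b)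
  have h3 : Integrable (fun x => (inner ℝ (b x) (v x) : ℝ)) μ := by
    refine (h1.add h2).mono ((stronglyMeasurable_continuousMap b).inner hv).aestronglyMeasurable
      (Eventually.of_forall fun x => ?_)
    refine (norm_inner_le_norm (𝕜 := ℝ) _ _).trans (le_trans ?_ (le_abs_self _))
    simp only [Pi.add_apply]
    nlinarith [sq_nonneg (‖b x‖ - ‖v x‖), sq_nonneg ‖b x‖, sq_nonneg ‖v x‖]
  have h4 : (energy μ ν).toReal = ∫ x, ‖v x‖ ^ 2 ∂μ := by
    rw [he, integral_eq_lintegral_of_nonneg_ae (Eventually.of_forall fun x => by positivity)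
      h1.aestronglyMeasurable]
    congr 1
    refine lintegral_congr fun x => ?_
    rw [← ofReal_norm, ENNReal.ofReal_pow (norm_nonneg _)]
  rw [h4, hν, pairing_withDensityᵥ (hv2.integrable one_le_two), ← integral_const_mul,
    ← integral_sub (h3.const_mul 2) h2]
  refine integral_mono ((h3.const_mul 2).sub h2) h1 fun x => ?_
  have := norm_sub_sq_real (b x) (v x)
  have h5 := sq_nonneg ‖b x - v x‖
  simp only
  linarith

omit [CompactSpace X] [FiniteDimensional ℝ E] [BorelSpace X] in
lemma integral_norm_smul_sq (μ : Measure X) (c : ℝ) (b : C(X, E)) :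
    ∫ x, ‖(c • b) x‖ ^ 2 ∂μ = c ^ 2 * ∫ x, ‖b x‖ ^ 2 ∂μ := by
  rw [← integral_const_mul]
  refine integral_congr_ae (Eventually.of_forall fun x => ?_)
  simp [norm_smul, mul_pow]

/-- The Cauchy-Schwarz inequality for the pairing. -/
lemma sq_pairing_le {μ : Measure X} [IsFiniteMeasure μ] {ν : VectorMeasure X E}
    (h : energy μ ν < ⊤) (b : C(X, E)) :
    (pairing ν b) ^ 2 ≤ (∫ x, ‖b x‖ ^ 2 ∂μ) * (energy μ ν).toReal := by
  refine sq_le_of_forall_two_mul_sub_le fun c => ?_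
  have h1 := two_mul_pairing_sub_le h (c • b)
  rw [integral_norm_smul_sq, map_smul, smul_eq_mul] at h1
  exact h1

omit [InnerProductSpace ℝ E] [FiniteDimensional ℝ E] in
lemma continuous_integral_normSq (μ : Measure X) [IsFiniteMeasure μ] :
    Continuous fun b : C(X, E) => ∫ x, ‖b x‖ ^ 2 ∂μ := by
  have h1 : Continuous fun b : C(X, E) => (∫ x, normSq b x ∂μ) := by
    have h2 : Continuous fun f : C(X, ℝ) => ∫ x, f x ∂μ := by
      have := (continuous_integral (μ := μ) (G := ℝ)).comp
        (ContinuousMap.toLp 1 μ ℝ : C(X, ℝ) →L[ℝ] Lp ℝ 1 μ).continuous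
      convert this using 2 with f
      exact (integral_congr_ae (ContinuousMap.coeFn_toLp μ f)).symm
    refine h2.comp ?_
    refine ContinuousMap.continuous_of_continuous_uncurry _ ?_
    change Continuous fun p : C(X, E) × X => ‖p.1 p.2‖ ^ 2
    fun_prop
  exact h1

/-- Dual formula: the energy is the supremum of countably many functions, each of which involves
`μ` and `ν` only through the integral of a continuous function. -/
lemma energy_eq_iSup (μ : Measure X) [IsFiniteMeasure μ] (ν : VectorMeasure X E) :
    energy μ ν = ⨆ n, ENNReal.ofReal (2 * pairing ν (TopologicalSpace.denseSeq C(X, E) n) -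
      ∫ x, ‖TopologicalSpace.denseSeq C(X, E) n x‖ ^ 2 ∂μ) := by
  refine le_antisymm ?_ ?_
  · set S := ⨆ n, ENNReal.ofReal (2 * pairing ν (TopologicalSpace.denseSeq C(X, E) n) -
      ∫ x, ‖TopologicalSpace.denseSeq C(X, E) n x‖ ^ 2 ∂μ) with hS
    rcases eq_or_ne S ⊤ with h | h
    · rw [h]; exact le_top
    have h1 : ∀ b : C(X, E), 2 * pairing ν b - ∫ x, ‖b x‖ ^ 2 ∂μ ≤ S.toReal := by
      intro b
      refine (TopologicalSpace.denseRange_denseSeq C(X, E)).induction_on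
        (p := fun b => 2 * pairing ν b - ∫ x, ‖b x‖ ^ 2 ∂μ ≤ S.toReal) b ?_ fun n => ?_
      · have := continuous_integral_normSq (E := E) μ
        exact isClosed_le (by fun_prop) continuous_const
      · rw [← ENNReal.ofReal_le_iff_le_toReal h]
        exact le_iSup (fun n => ENNReal.ofReal (2 * pairing ν (TopologicalSpace.denseSeq C(X, E) n) -
          ∫ x, ‖TopologicalSpace.denseSeq C(X, E) n x‖ ^ 2 ∂μ)) n
    have h2 : ∀ b : C(X, E), (pairing ν b) ^ 2 ≤ (∫ x, ‖b x‖ ^ 2 ∂μ) * S.toReal := by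
      intro b
      refine sq_le_of_forall_two_mul_sub_le fun c => ?_
      have h1 := h1 (c • b)
      rw [integral_norm_smul_sq, map_smul, smul_eq_mul] at h1
      exact h1
    -- The optimal `L²` bound for the pairing gives a density with energy at most `S`.
    obtain ⟨v, -, hv2, hv, hle⟩ := exists_density_of_sq_le μ (pairing ν : C(X, E) →ₗ[ℝ] ℝ)
      ENNReal.toReal_nonneg h2
    have h3 : ν = μ.withDensityᵥ v := by
      have h4 : ν + (-1 : ℝ) • μ.withDensityᵥ v = 0 := by
        refine vectorMeasure_eq_zero_of_integral_continuous fun b => ?_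
        rw [← pairing_apply, pairing_add, pairing_smul,
          pairing_withDensityᵥ (hv2.integrable one_le_two), ← hv b]
        simp
      rw [neg_one_smul, ← sub_eq_add_neg, sub_eq_zero] at h4
      exact h4
    rw [ENNReal.ofReal_toReal h] at hle
    exact (iInf₂_le_of_le v hv2 (iInf_le _ h3)).trans hle
  · refine iSup_le fun n => ?_
    rcases eq_or_ne (energy μ ν) ⊤ with h | h
    · rw [h]; exact le_top
    rw [ENNReal.ofReal_le_iff_le_toReal h]
    exact two_mul_pairing_sub_le h.lt_top _

/-- The dual formula makes the energy a countable supremum of measurable functions of time. -/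
lemma measurable_energy {T : Type*} [MeasurableSpace T] [MeasurableSpace E] [BorelSpace E]
    {μ : T → FiniteMeasure X} (hμ : ∀ f : C(X, ℝ), Measurable fun t => ∫ x, f x ∂(μ t : Measure X))
    {ν : T → VectorMeasure X E} (hν : ∀ B, MeasurableSet B → Measurable fun t => ν t B) :
    Measurable fun t => energy (μ t : Measure X) (ν t) := by
  simp_rw [energy_eq_iSup]
  refine Measurable.iSup fun n => ENNReal.measurable_ofReal.comp ?_
  exact ((measurable_pairing hν _).const_mul 2).sub (hμ (normSq _))

end Duality

end GeneralizedTransport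

/-! ### The action as a sum of energies -/

namespace GeneralizedTransport

open Filter Topology

section Action

variable {X : Type*} [MeasurableSpace X] {d : ℕ}

lemma actionZ_withDensityᵥ (L : Measure X) [IsFiniteMeasure L] {z : X → ℝ} (hz : MemLp z 2 L) :
    actionZ L (L.withDensityᵥ z) = ∫⁻ x, ‖z x‖ₑ ^ 2 ∂L := by
  have h0 : L.withDensityᵥ z = 0 + L.withDensityᵥ z := (zero_add _).symm
  have h1 : SignedMeasure.singularPart (L.withDensityᵥ z) L = 0 :=
    (SignedMeasure.eq_singularPart 0 z VectorMeasure.MutuallySingular.zero_left h0).symm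
  have h2 : z =ᵐ[L] SignedMeasure.rnDeriv (L.withDensityᵥ z) L :=
    SignedMeasure.eq_rnDeriv 0 z (hz.integrable one_le_two)
      VectorMeasure.MutuallySingular.zero_left h0
  rw [actionZ, if_pos h1]
  refine lintegral_congr_ae (h2.mono fun x hx => ?_)
  simp only [← hx]
  rw [Real.enorm_eq_ofReal_abs, ← ENNReal.ofReal_pow (abs_nonneg _), sq_abs]

/-- The source action is the quadratic energy with respect to the reference measure. -/
lemma actionZ_eq_energy (L : Measure X) [IsFiniteMeasure L] (ζ : SignedMeasure X) :
    actionZ L ζ = energy L ζ := by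
  rcases eq_or_ne (energy L ζ) ⊤ with h | h
  · rw [h]
    by_contra hA
    have h1 : ζ.singularPart L = 0 := by
      by_contra h1
      exact hA (by rw [actionZ, if_neg h1])
    have h2 := ζ.singularPart_add_withDensity_rnDeriv_eq L
    rw [h1, zero_add] at h2
    have h3 : MemLp (ζ.rnDeriv L) 2 L := by
      rw [memLp_two_iff_lintegral (ζ.measurable_rnDeriv L).aestronglyMeasurable]
      rw [actionZ, if_pos h1] at hA
      refine lt_of_eq_of_lt (lintegral_congr fun x => ?_) (lt_top_iff_ne_top.2 hA)
      rw [Real.enorm_eq_ofReal_abs, ← ENNReal.ofReal_pow (abs_nonneg _), sq_abs]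
    rw [← h2, energy_withDensityᵥ h3] at h
    exact ((memLp_two_iff_lintegral h3.1).1 h3).ne h
  · obtain ⟨z, -, hz2, hζ, he⟩ := exists_density_of_energy_lt_top h.lt_top
    rw [he]
    conv_lhs => rw [hζ]
    exact actionZ_withDensityᵥ L hz2

lemma component_withDensityᵥ {μ : Measure X} {v : X → Space d} (hv : Integrable v μ) (i : Fin d) :
    component (μ.withDensityᵥ v) i = μ.withDensityᵥ fun x => v x i := by
  have hvi : Integrable (fun x => v x i) μ := (EuclideanSpace.proj (𝕜 := ℝ) i).integrable_comp hv
  ext B hB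
  change (EuclideanSpace.proj i : Space d →L[ℝ] ℝ) (μ.withDensityᵥ v B) = _
  rw [withDensityᵥ_apply hv hB, withDensityᵥ_apply hvi hB,
    ← ContinuousLinearMap.integral_comp_comm _ hv.integrableOn]
  rfl

lemma ext_component {ν₁ ν₂ : VectorMeasure X (Space d)} (h : ∀ i, component ν₁ i = component ν₂ i) :
    ν₁ = ν₂ := by
  ext B hB i
  exact congrArg (fun s : SignedMeasure X => s B) (h i)

/-- No integrability is needed: the measure with a non-integrable density is zero by convention. -/
lemma mutuallySingular_withDensityᵥ {L μs : Measure X} [IsFiniteMeasure L] (h : μs ⟂ₘ L)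
    (f : X → ℝ) :
    VectorMeasure.MutuallySingular (μs.withDensityᵥ f) L.toENNRealVectorMeasure := by
  obtain ⟨S, hS, h1, h2⟩ := h
  refine VectorMeasure.MutuallySingular.mk S hS (fun t hts ht => ?_) fun t hts ht => ?_
  · by_cases hf : Integrable f μs
    · rw [withDensityᵥ_apply hf ht, Measure.restrict_zero_set (measure_mono_null hts h1),
        integral_zero_measure]
    · rw [Measure.withDensityᵥ, dif_neg hf]
      rfl
  · rw [Measure.toENNRealVectorMeasure_apply_measurable ht]
    exact measure_mono_null hts h2

lemma phi_eq_of_eq_smul {u : ℝ} (hu : 0 ≤ u) {w v : Space d} (h : w = u • v) :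
    phi u w = ENNReal.ofReal u * ‖v‖ₑ ^ 2 := by
  subst h
  rcases hu.eq_or_lt with rfl | hu
  · simp [phi]
  · rw [phi, if_pos hu, norm_smul, Real.norm_of_nonneg hu.le, ← ofReal_norm,
      ← ENNReal.ofReal_pow (norm_nonneg _), ← ENNReal.ofReal_mul hu.le]
    congr 1
    field_simp

/-- Where `w = u v`, the integrand `φ(u, w)` is `u |v|²`, so that `∫ φ(u, w) dρ = ∫ |v|² d(u ρ)`. -/
lemma lintegral_phi {ρ : Measure X} {u : X → ℝ≥0∞} (hu : Measurable u) (hfin : ∀ᵐ x ∂ρ, u x < ⊤)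
    {w v : X → Space d} (hw : ∀ᵐ x ∂ρ, w x = (u x).toReal • v x) :
    ∫⁻ x, phi (u x).toReal (w x) ∂ρ = ∫⁻ x, ‖v x‖ₑ ^ 2 ∂(ρ.withDensity u) := by
  rw [lintegral_withDensity_eq_lintegral_mul_non_measurable₀ _ hu.aemeasurable hfin]
  refine lintegral_congr_ae ?_
  filter_upwards [hfin, hw] with x h1 h2
  rw [phi_eq_of_eq_smul ENNReal.toReal_nonneg h2, ENNReal.ofReal_toReal h1.ne]
  rfl

lemma measurable_phi_comp {u : X → ℝ} (hu : Measurable u) {w : X → Space d} (hw : Measurable w) :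
    Measurable fun x => phi (u x) (w x) := by
  unfold phi
  refine Measurable.ite (measurableSet_lt measurable_const hu) ?_
    (Measurable.ite (hw (measurableSet_singleton 0)) measurable_const measurable_const)
  exact ENNReal.measurable_ofReal.comp ((hw.norm.pow_const 2).div hu)

/-- Where `φ(u, w)` is finite, `w` vanishes at the zeros of `u`; the convention `0⁻¹ = 0` then makes
`w / u` a velocity. -/
lemma eq_smul_of_lintegral_phi_lt_top {ρ : Measure X} {u : X → ℝ} (hu : Measurable u)
    (hu0 : ∀ x, 0 ≤ u x) {w : X → Space d} (hw : Measurable w)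
    (h : ∫⁻ x, phi (u x) (w x) ∂ρ < ⊤) :
    ∀ᵐ x ∂ρ, w x = u x • ((u x)⁻¹ • w x) := by
  filter_upwards [ae_lt_top (measurable_phi_comp hu hw) h.ne] with x hx
  rcases (hu0 x).eq_or_lt with h0 | h0
  · rw [phi, ← h0] at hx
    by_contra hcon
    have : w x ≠ 0 := fun h0 => hcon (by simp [h0])
    simp [this] at hx
  · rw [smul_smul, mul_inv_cancel₀ h0.ne', one_smul]

instance isFiniteMeasure_singularReference (L μ : Measure X) [IsFiniteMeasure μ]
    (ν : VectorMeasure X (Space d)) : IsFiniteMeasure (singularReference L μ ν) := by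
  unfold singularReference
  have : ∀ i, IsFiniteMeasure ((component ν i).singularPart L).totalVariation := fun i => by
    rw [SignedMeasure.totalVariation]; infer_instance
  infer_instance

lemma singularPart_absolutelyContinuous_singularReference (L μ : Measure X)
    (ν : VectorMeasure X (Space d)) : μ.singularPart L ≪ singularReference L μ ν :=
  Measure.absolutelyContinuous_of_le (Measure.le_add_right le_rfl)

lemma mutuallySingular_singularReference (L μ : Measure X) (ν : VectorMeasure X (Space d)) :
    singularReference L μ ν ⟂ₘ L := by
  refine (Measure.mutuallySingular_singularPart _ _).add_left ?_
  rw [← Measure.sum_fintype, Measure.MutuallySingular.sum_left]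
  intro i
  rw [SignedMeasure.singularPart_totalVariation]
  exact (Measure.mutuallySingular_singularPart _ _).add_left
    (Measure.mutuallySingular_singularPart _ _)

/-- For `ν = v μ` with `v ∈ L²(μ)`, the singular and the absolutely continuous part of the
Benamou-Brenier action add up to `∫ |v|² dμ`. -/
lemma actionBB_withDensityᵥ (L μ : Measure X) [IsFiniteMeasure L] [IsFiniteMeasure μ]
    {v : X → Space d} (hv : MemLp v 2 μ) :
    actionBB L μ (μ.withDensityᵥ v) = ∫⁻ x, ‖v x‖ₑ ^ 2 ∂μ := by
  set ν := μ.withDensityᵥ v with hν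
  have hvi := hv.integrable one_le_two
  have hμ := (Measure.haveLebesgueDecomposition_add μ L).symm
  set μs := μ.singularPart L
  have hsing : μs ⟂ₘ L := Measure.mutuallySingular_singularPart μ L
  set ρ := singularReference L μ ν
  have hac : μs ≪ ρ := singularPart_absolutelyContinuous_singularReference L μ ν
  have hvs : Integrable v μs := hvi.mono_measure ((Measure.le_add_right le_rfl).trans_eq hμ)
  have hva : Integrable v (L.withDensity (μ.rnDeriv L)) :=
    hvi.mono_measure ((Measure.le_add_left le_rfl).trans_eq hμ)
  have hproj : ∀ (m : Measure X) (f : X → Space d), Integrable f m → ∀ i,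
      Integrable (fun x => f x i) m :=
    fun m f hf i => (EuclideanSpace.proj (𝕜 := ℝ) i).integrable_comp hf
  have hLi : Integrable (fun x => (μ.rnDeriv L x).toReal • v x) L :=
    (integrable_withDensity_iff_integrable_smul' (μ.measurable_rnDeriv L)
      (μ.rnDeriv_lt_top L)).1 hva
  have hRi : Integrable (fun x => (μs.rnDeriv ρ x).toReal • v x) ρ :=
    (integrable_rnDeriv_smul_iff hac).2 hvs
  -- Lebesgue decomposition of the components of `ν`
  have hdec : ∀ i, component ν i = μs.withDensityᵥ (fun x => v x i) +
      L.withDensityᵥ fun x => ((μ.rnDeriv L x).toReal • v x) i := by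
    intro i
    have h2 : L.withDensityᵥ (fun x => ((μ.rnDeriv L x).toReal • v x) i) =
        (L.withDensity (μ.rnDeriv L)).withDensityᵥ fun x => v x i :=
      withDensityᵥ_smul_eq_withDensityᵥ_withDensity' (μ.measurable_rnDeriv L).aemeasurable
        (μ.rnDeriv_lt_top L) (hproj _ _ hLi i)
    rw [h2, hν, component_withDensityᵥ hvi]
    ext B hB
    rw [_root_.add_apply, withDensityᵥ_apply (hproj _ _ hvi i) hB,
      withDensityᵥ_apply (hproj _ _ hvs i) hB, withDensityᵥ_apply (hproj _ _ hva i) hB,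
      ← integral_add_measure (hproj _ _ hvs i).integrableOn (hproj _ _ hva i).integrableOn,
      ← Measure.restrict_add, hμ]
  have hmut : ∀ i, VectorMeasure.MutuallySingular (μs.withDensityᵥ fun x => v x i)
      L.toENNRealVectorMeasure := fun i => mutuallySingular_withDensityᵥ hsing _
  have hsp : ∀ i, (component ν i).singularPart L = μs.withDensityᵥ fun x => v x i := fun i =>
    (SignedMeasure.eq_singularPart _ _ (hmut i) (hdec i)).symm
  have hrn : ∀ᵐ x ∂L, (WithLp.toLp 2 fun i => (component ν i).rnDeriv L x : Space d) =
      (μ.rnDeriv L x).toReal • v x := by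
    have h1 : ∀ i, ∀ᵐ x ∂L, ((μ.rnDeriv L x).toReal • v x) i = (component ν i).rnDeriv L x :=
      fun i => SignedMeasure.eq_rnDeriv _ _ (hproj _ _ hLi i) (hmut i) (hdec i)
    filter_upwards [ae_all_iff.2 h1] with x hx
    ext i
    exact (hx i).symm
  have hrs : ∀ᵐ x ∂ρ, (WithLp.toLp 2 fun i => ((component ν i).singularPart L).rnDeriv ρ x :
      Space d) = (μs.rnDeriv ρ x).toReal • v x := by
    have h1 : ∀ i, ∀ᵐ x ∂ρ, ((μs.rnDeriv ρ x).toReal • v x) i =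
        ((component ν i).singularPart L).rnDeriv ρ x := by
      intro i
      refine SignedMeasure.eq_rnDeriv 0 _ (hproj _ _ hRi i)
        VectorMeasure.MutuallySingular.zero_left ?_
      rw [zero_add, hsp i]
      exact (withDensityᵥ_rnDeriv_smul hac (hproj _ _ hvs i)).symm
    filter_upwards [ae_all_iff.2 h1] with x hx
    ext i
    exact (hx i).symm
  rw [actionBB, lintegral_phi (μ.measurable_rnDeriv L) (μ.rnDeriv_lt_top L) hrn,
    lintegral_phi (μs.measurable_rnDeriv ρ) (μs.rnDeriv_lt_top ρ) hrs,
    Measure.withDensity_rnDeriv_eq _ _ hac, add_comm, ← lintegral_add_measure, hμ]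

lemma measurable_toLp_rnDeriv (s : Fin d → SignedMeasure X) (ρ : Measure X) :
    Measurable fun x => (WithLp.toLp 2 fun i => (s i).rnDeriv ρ x : Space d) :=
  (WithLp.measurable_toLp 2 (Fin d → ℝ)).comp
    (measurable_pi_lambda _ fun i => (s i).measurable_rnDeriv ρ)

/-- A vector measure of finite Benamou-Brenier action has a density in `L²(μ)`. -/
lemma exists_density_of_actionBB_lt_top (L μ : Measure X) [IsFiniteMeasure L] [IsFiniteMeasure μ]
    {ν : VectorMeasure X (Space d)} (h : actionBB L μ ν < ⊤) :
    ∃ v : X → Space d, MemLp v 2 μ ∧ ν = μ.withDensityᵥ v := by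
  classical
  have hμ := (Measure.haveLebesgueDecomposition_add μ L).symm
  set μs := μ.singularPart L
  set ρ := singularReference L μ ν with hR
  have hac : μs ≪ ρ := singularPart_absolutelyContinuous_singularReference L μ ν
  obtain ⟨S, hS, hRS, hLS⟩ := mutuallySingular_singularReference L μ ν
  rw [actionBB, ENNReal.add_lt_top] at h
  set w : X → Space d := fun x => WithLp.toLp 2 fun i => (component ν i).rnDeriv L x with hw
  set w' : X → Space d := fun x => WithLp.toLp 2 fun i =>
    ((component ν i).singularPart L).rnDeriv ρ x with hw'
  have hwm : Measurable w := measurable_toLp_rnDeriv _ _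
  have hwm' : Measurable w' := measurable_toLp_rnDeriv _ _
  set u := μ.rnDeriv L
  set u' := μs.rnDeriv ρ
  have hum : Measurable u := μ.measurable_rnDeriv L
  have hum' : Measurable u' := μs.measurable_rnDeriv ρ
  have h1 := eq_smul_of_lintegral_phi_lt_top hum.ennreal_toReal
    (fun _ => ENNReal.toReal_nonneg) hwm h.1
  have h2 := eq_smul_of_lintegral_phi_lt_top hum'.ennreal_toReal
    (fun _ => ENNReal.toReal_nonneg) hwm' h.2
  -- The density is built separately on the two sets that carry `L` and the singular parts.
  let v : X → Space d := S.piecewise (fun x => (u x).toReal⁻¹ • w x)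
    fun x => (u' x).toReal⁻¹ • w' x
  have hvm : Measurable v := Measurable.piecewise hS (hum.ennreal_toReal.inv.smul hwm)
    (hum'.ennreal_toReal.inv.smul hwm')
  have hvL : ∀ᵐ x ∂L, w x = (u x).toReal • v x := by
    have : ∀ᵐ x ∂L, x ∈ S := hLS
    filter_upwards [h1, this] with x hx hxS
    simpa [v, hxS] using hx
  have hvR : ∀ᵐ x ∂ρ, w' x = (u' x).toReal • v x := by
    have : ∀ᵐ x ∂ρ, x ∉ S := by
      rw [ae_iff]; simpa using hRS
    filter_upwards [h2, this] with x hx hxS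
    simpa [v, hxS] using hx
  have hv2 : MemLp v 2 μ := by
    rw [memLp_two_iff_lintegral hvm.aestronglyMeasurable, ← hμ, lintegral_add_measure,
      ← Measure.withDensity_rnDeriv_eq _ _ hac,
      ← lintegral_phi hum (μ.rnDeriv_lt_top L) hvL,
      ← lintegral_phi hum' (μs.rnDeriv_lt_top ρ) hvR]
    exact ENNReal.add_lt_top.2 ⟨h.2, h.1⟩
  have hvi := hv2.integrable one_le_two
  have hvs : Integrable v μs := hvi.mono_measure ((Measure.le_add_right le_rfl).trans_eq hμ)
  have hva : Integrable v (L.withDensity u) :=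
    hvi.mono_measure ((Measure.le_add_left le_rfl).trans_eq hμ)
  have hproj : ∀ (m : Measure X) (f : X → Space d), Integrable f m → ∀ i,
      Integrable (fun x => f x i) m :=
    fun m f hf i => (EuclideanSpace.proj (𝕜 := ℝ) i).integrable_comp hf
  refine ⟨v, hv2, ext_component fun i => ?_⟩
  -- identification of the absolutely continuous and of the singular part of each component
  have h3 : L.withDensityᵥ ((component ν i).rnDeriv L) =
      (L.withDensity u).withDensityᵥ fun x => v x i := by
    rw [← withDensityᵥ_smul_eq_withDensityᵥ_withDensity' hum.aemeasurable (μ.rnDeriv_lt_top L)]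
    · refine WithDensityᵥEq.congr_ae (hvL.mono fun x hx => ?_)
      exact congrArg (fun y : Space d => y i) hx
    · exact hproj _ _ ((integrable_withDensity_iff_integrable_smul' hum
        (μ.rnDeriv_lt_top L)).1 hva) i
  have h4 : (component ν i).singularPart L = μs.withDensityᵥ fun x => v x i := by
    rw [← withDensityᵥ_rnDeriv_smul hac (hproj _ _ hvs i)]
    have h5 : VectorMeasure.AbsolutelyContinuous ((component ν i).singularPart L)
        ρ.toENNRealVectorMeasure := by
      rw [SignedMeasure.absolutelyContinuous_ennreal_iff,
        VectorMeasure.ennrealToMeasure_toENNRealVectorMeasure]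
      refine Measure.absolutelyContinuous_of_le (Measure.le_add_left ?_)
      intro B
      rw [Measure.finsetSum_apply]
      exact Finset.single_le_sum (f := fun i => ((component ν i).singularPart L).totalVariation B)
        (fun _ _ => zero_le) (Finset.mem_univ i)
    conv_lhs => rw [← SignedMeasure.withDensityᵥ_rnDeriv_eq _ ρ h5]
    refine WithDensityᵥEq.congr_ae (hvR.mono fun x hx => ?_)
    exact congrArg (fun y : Space d => y i) hx
  rw [component_withDensityᵥ hvi,
    ← (component ν i).singularPart_add_withDensity_rnDeriv_eq L, h3, h4]
  ext B hB
  rw [_root_.add_apply, withDensityᵥ_apply (hproj _ _ hvi i) hB,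
    withDensityᵥ_apply (hproj _ _ hvs i) hB, withDensityᵥ_apply (hproj _ _ hva i) hB,
    ← integral_add_measure (hproj _ _ hvs i).integrableOn (hproj _ _ hva i).integrableOn,
    ← Measure.restrict_add, hμ]

/-- The Benamou-Brenier action is the quadratic energy with respect to `μ`. -/
lemma actionBB_eq_energy (L μ : Measure X) [IsFiniteMeasure L] [IsFiniteMeasure μ]
    (ν : VectorMeasure X (Space d)) : actionBB L μ ν = energy μ ν := by
  refine le_antisymm (le_iInf₂ fun v hv => le_iInf fun h => ?_) ?_
  · rw [h, actionBB_withDensityᵥ L μ hv]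
  · rcases eq_or_ne (actionBB L μ ν) ⊤ with h | h
    · rw [h]; exact le_top
    obtain ⟨v, hv, rfl⟩ := exists_density_of_actionBB_lt_top L μ h.lt_top
    rw [energy_withDensityᵥ hv, actionBB_withDensityᵥ L μ hv]

lemma action_eq_energy (L : Measure X) [IsFiniteMeasure L] (δ : ℝ) (μ : Measure X)
    [IsFiniteMeasure μ] (ν : VectorMeasure X (Space d)) (ζ : SignedMeasure X) :
    action L δ μ ν ζ = energy μ ν + ENNReal.ofReal (1 / δ) * energy L ζ := by
  rw [action, actionBB_eq_energy, actionZ_eq_energy]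

end Action

end GeneralizedTransport

/-! ### Calculus on the unit interval -/

namespace GeneralizedTransport

open Filter Topology

section Calculus

/-- A continuous function on the line whose distributional derivative vanishes on `(0, 1)` is
constant on `[0, 1]`. -/
lemma eq_of_forall_integral_deriv_mul_eq_zero {H : ℝ → ℝ} (hH : Continuous H)
    (h : ∀ ψ : ℝ → ℝ, ContDiff ℝ 1 ψ → HasCompactSupport ψ → tsupport ψ ⊆ Ioo 0 1 →
      ∫ t in (0 : ℝ)..1, deriv ψ t * H t = 0) {s t : ℝ} (hs : s ∈ Icc (0 : ℝ) 1)
    (ht : t ∈ Icc (0 : ℝ) 1) : H s = H t := by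
  have key : ∀ ε : ℝ, 0 < ε → ε < 1 / 2 → ∃ c, ∀ t ∈ Ioo ε (1 - ε), H t = c := by
    intro ε h0 h1
    -- `w` is a weight that is positive exactly on `(ε, 1 - ε)`.
    let w : ℝ → ℝ := fun t => max 0 (min (t - ε) (1 - ε - t))
    have hw : Continuous w := by fun_prop
    have hw0 : ∀ t, 0 ≤ w t := fun t => le_max_left _ _
    have hwpos : ∀ t ∈ Ioo ε (1 - ε), 0 < w t := fun t ht =>
      lt_max_of_lt_right (lt_min (by linarith [ht.1]) (by linarith [ht.2]))
    have hwl : ∀ t ≤ ε, w t = 0 := fun t ht =>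
      max_eq_left ((min_le_left _ _).trans (by linarith))
    have hwr : ∀ t, 1 - ε ≤ t → w t = 0 := fun t ht =>
      max_eq_left ((min_le_right _ _).trans (by linarith))
    have hWpos : 0 < ∫ t in (0 : ℝ)..1, w t := by
      rw [intervalIntegral.integral_pos_iff_support_of_nonneg_ae
        (Eventually.of_forall hw0) (hw.intervalIntegrable _ _)]
      refine ⟨one_pos, lt_of_lt_of_le ?_ (measure_mono (s := Ioo ε (1 - ε)) fun t ht =>
        ⟨(hwpos t ht).ne', by constructor <;> linarith [ht.1, ht.2]⟩)⟩
      rw [Real.volume_Ioo]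
      exact ENNReal.ofReal_pos.2 (by linarith)
    -- With this choice of `c`, the function `(H - c) w` is itself the derivative of a test function.
    let c := (∫ t in (0 : ℝ)..1, H t * w t) / ∫ t in (0 : ℝ)..1, w t
    let g : ℝ → ℝ := fun t => (H t - c) * w t
    have hg : Continuous g := by fun_prop
    have hg1 : ∫ t in (0 : ℝ)..1, g t = 0 := by
      have : ∀ t, g t = H t * w t - c * w t := fun t => by simp only [g]; ring
      simp_rw [this]
      rw [intervalIntegral.integral_sub
        ((show Continuous fun t => H t * w t by fun_prop).intervalIntegrable _ _)
        ((hw.const_mul c).intervalIntegrable _ _), intervalIntegral.integral_const_mul]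
      simp only [c]
      field_simp
      simp
    let ψ : ℝ → ℝ := fun t => ∫ r in (0 : ℝ)..t, g r
    have hψ : ∀ t, HasDerivAt ψ (g t) t := fun t => hg.integral_hasStrictDerivAt 0 t |>.hasDerivAt
    have hψd : deriv ψ = g := funext fun t => (hψ t).deriv
    have hψ0 : Function.support ψ ⊆ Icc ε (1 - ε) := by
      intro t ht
      by_contra hcon
      refine ht ?_
      rw [mem_Icc, not_and_or, not_le, not_le] at hcon
      rcases hcon with hcon | hcon
      · simp only [ψ]
        rw [intervalIntegral.integral_congr (g := fun _ => 0), intervalIntegral.integral_zero]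
        intro r hr
        have : r ≤ ε := hr.2.trans (max_le h0.le hcon.le)
        simp [g, hwl r this]
      · have h2 : ∫ r in t..1, g r = 0 := by
          rw [intervalIntegral.integral_congr (g := fun _ => 0), intervalIntegral.integral_zero]
          intro r hr
          have : 1 - ε ≤ r := (le_min hcon.le (by linarith)).trans hr.1
          simp [g, hwr r this]
        have h3 := intervalIntegral.integral_add_adjacent_intervals
          (hg.intervalIntegrable (μ := volume) 0 t) (hg.intervalIntegrable t 1)
        rw [h2, hg1, add_zero] at h3
        exact h3
    have hts : tsupport ψ ⊆ Icc ε (1 - ε) := closure_minimal hψ0 isClosed_Icc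
    have h4 := h ψ (contDiff_one_iff_deriv.2 ⟨fun t => (hψ t).differentiableAt, by rwa [hψd]⟩)
      (isCompact_Icc.of_isClosed_subset (isClosed_tsupport ψ) hts)
      (hts.trans (Icc_subset_Ioo h0 (by linarith)))
    rw [hψd] at h4
    have h5 : ∫ t in (0 : ℝ)..1, (H t - c) ^ 2 * w t = 0 := by
      have : ∀ t, (H t - c) ^ 2 * w t = g t * H t - c * g t := fun t => by simp only [g]; ring
      simp_rw [this]
      rw [intervalIntegral.integral_sub
        ((show Continuous fun t => g t * H t by fun_prop).intervalIntegrable _ _)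
        ((hg.const_mul c).intervalIntegrable _ _), intervalIntegral.integral_const_mul, h4, hg1]
      simp
    have h6 : Continuous fun t => (H t - c) ^ 2 * w t := by fun_prop
    rw [intervalIntegral.integral_eq_zero_iff_of_le_of_nonneg_ae zero_le_one
      (Eventually.of_forall fun t => mul_nonneg (sq_nonneg _) (hw0 t))
      (h6.intervalIntegrable _ _)] at h5
    have h7 := Measure.eqOn_Ioc_of_ae_eq volume h5 h6.continuousOn continuousOn_const
    refine ⟨c, fun t ht => ?_⟩
    have h8 : (H t - c) ^ 2 * w t = 0 := h7 ⟨by linarith [ht.1], by linarith [ht.2]⟩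
    have h9 := (mul_eq_zero.1 h8).resolve_right (hwpos t ht).ne'
    exact sub_eq_zero.1 (pow_eq_zero_iff two_ne_zero |>.1 h9)
  have hIoo : EqOn H (fun _ => H (1 / 2)) (Ioo 0 1) := by
    intro t ht
    obtain ⟨ε, h0, h1⟩ := exists_between (lt_min (lt_min ht.1 (sub_pos.2 ht.2))
      (by norm_num : (0 : ℝ) < 1 / 2))
    rw [lt_min_iff, lt_min_iff] at h1
    obtain ⟨c, hc⟩ := key ε h0 h1.2
    simp only
    rw [hc t ⟨h1.1.1, by linarith [h1.1.2]⟩, hc (1 / 2) ⟨h1.2, by linarith [h1.2]⟩]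
  have hIcc := hIoo.closure hH continuous_const
  rw [closure_Ioo zero_ne_one] at hIcc
  rw [hIcc hs, hIcc ht]

/-- If the integrable function `G` is the distributional derivative on `(0, 1)` of the continuous
function `m`, then `m` is a primitive of `G` on `[0, 1]`. -/
lemma sub_eq_integral_of_weak_derivative {m G : ℝ → ℝ} (hm : Continuous m) (hG : Integrable G)
    (h : ∀ ψ : ℝ → ℝ, ContDiff ℝ 1 ψ → HasCompactSupport ψ → tsupport ψ ⊆ Ioo 0 1 →
      (∫ t in (0 : ℝ)..1, deriv ψ t * m t) + ∫ t in (0 : ℝ)..1, ψ t * G t = 0)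
    {s t : ℝ} (hs : s ∈ Icc (0 : ℝ) 1) (ht : t ∈ Icc (0 : ℝ) 1) :
    m t - m s = ∫ r in s..t, G r := by
  -- The difference of `m` and of the primitive of `G` has vanishing distributional derivative.
  let Q : ℝ → ℝ := fun t => ∫ r in (0 : ℝ)..t, G r
  have hint : ∀ a b, IntervalIntegrable G volume a b := fun a b => hG.intervalIntegrable
  have hQ : Continuous Q := intervalIntegral.continuous_primitive hint 0
  have key := eq_of_forall_integral_deriv_mul_eq_zero (H := fun t => m t - Q t) (hm.sub hQ)
    (fun ψ h1 h2 h3 => ?_) hs ht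
  · have h4 := intervalIntegral.integral_add_adjacent_intervals (hint 0 s) (hint s t)
    simp only [Q] at key
    linarith
  · have hψ0 : ψ 0 = 0 := image_eq_zero_of_notMem_tsupport fun h => by simpa using h3 h
    have hψ1 : ψ 1 = 0 := image_eq_zero_of_notMem_tsupport fun h => by simpa using h3 h
    have hψ : AbsolutelyContinuousOnInterval ψ 0 1 := h1.contDiffOn.absolutelyContinuousOnInterval
    have hQa : AbsolutelyContinuousOnInterval Q 0 1 :=
      (hint 0 1).absolutelyContinuousOnInterval_intervalIntegral (by simp)
    have h5 := hψ.integral_mul_deriv_eq_deriv_mul hQa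
    rw [hψ0, hψ1] at h5
    have h6 : ∫ t in (0 : ℝ)..1, ψ t * deriv Q t = ∫ t in (0 : ℝ)..1, ψ t * G t := by
      refine intervalIntegral.integral_congr_ae ?_
      filter_upwards [(hint 0 1).ae_hasDerivAt_integral] with x hx hx2
      rw [(hx (uIoc_subset_uIcc hx2) 0 (by simp)).deriv]
    have h7 : Continuous (deriv ψ) := h1.continuous_deriv le_rfl
    have h8 := h ψ h1 h2 h3
    simp_rw [mul_sub]
    rw [intervalIntegral.integral_sub
      ((show Continuous fun t => deriv ψ t * m t by fun_prop).intervalIntegrable _ _)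
      ((show Continuous fun t => deriv ψ t * Q t by fun_prop).intervalIntegrable _ _)]
    rw [h6] at h5
    linarith

/-- Extension of a function on `[0, 1]` by zero. -/
noncomputable def extendZero (G : I → ℝ) : ℝ → ℝ := Function.extend Subtype.val G 0

lemma extendZero_coe (G : I → ℝ) (t : I) : extendZero G t = G t :=
  Subtype.val_injective.extend_apply _ _ _

lemma integrable_extendZero {G : I → ℝ} (hG : Integrable G) : Integrable (extendZero G) := by
  have h1 : Integrable (extendZero G ∘ ((↑) : I → ℝ)) := by
    convert hG using 1
    exact funext fun t => extendZero_coe G t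
  rw [unitInterval.measurePreserving_coe.integrable_comp_emb unitInterval.measurableEmbedding_coe]
    at h1
  refine (integrableOn_iff_integrable_of_support_subset fun r hr => ?_).1 h1
  by_contra hcon
  refine hr (Function.extend_apply' _ _ _ ?_)
  rintro ⟨t, rfl⟩
  exact hcon t.2

lemma setIntegral_Ioc_coe (g : ℝ → ℝ) {s t : I} (hst : s ≤ t) :
    ∫ r in Ioc s t, g r = ∫ r in (s : ℝ)..t, g r := by
  have h1 := unitInterval.measurePreserving_coe.setIntegral_preimage_emb
    unitInterval.measurableEmbedding_coe g (Ioc (s : ℝ) t)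
  rw [Measure.restrict_restrict measurableSet_Ioc, inter_eq_left.2
    (Ioc_subset_Icc_self.trans (Icc_subset_Icc s.2.1 t.2.2)),
    ← intervalIntegral.integral_of_le hst] at h1
  exact h1

lemma integral_unitInterval (g : ℝ → ℝ) : ∫ r : I, g r = ∫ r in (0 : ℝ)..1, g r := by
  have h1 := unitInterval.measurePreserving_coe.integral_comp
    unitInterval.measurableEmbedding_coe g
  rw [h1, intervalIntegral.integral_of_le zero_le_one, ← integral_Icc_eq_integral_Ioc]

lemma setIntegral_Ioc_add {G : I → ℝ} (hG : Integrable G) {s t u : I} (hst : s ≤ t) (htu : t ≤ u) :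
    ∫ r in Ioc s u, G r = (∫ r in Ioc s t, G r) + ∫ r in Ioc t u, G r := by
  rw [← setIntegral_union (Ioc_disjoint_Ioc_of_le le_rfl) measurableSet_Ioc hG.integrableOn
    hG.integrableOn, Ioc_union_Ioc_eq_Ioc hst htu]

lemma setIntegral_Ioc_zero_one (G : I → ℝ) : ∫ r in Ioc (0 : I) 1, G r = ∫ r, G r := by
  have h : Ioc (0 : I) 1 =ᵐ[volume] (univ : Set I) := by
    have : (univ : Set I) = Icc 0 1 := by
      exact (eq_univ_of_forall (s := Icc (0 : I) 1) fun t => ⟨t.2.1, t.2.2⟩).symm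
    rw [this]
    exact Ioc_ae_eq_Icc
  rw [setIntegral_congr_set h, setIntegral_univ]

/-- A function on `[0, 1]` whose increments over short intervals are bounded by an arbitrarily small
multiple of a fixed additive interval function takes the same value at `0` and `1`. -/
lemma eq_of_forall_local_bound {Ψ γ : I → ℝ}
    (h : ∀ ε > 0, ∃ η > 0, ∀ s t : I, s ≤ t → (t : ℝ) - s < η → |Ψ t - Ψ s| ≤ ε * (γ t - γ s)) :
    Ψ 1 = Ψ 0 := by
  have key : ∀ ε > 0, |Ψ 1 - Ψ 0| ≤ ε * (γ 1 - γ 0) := by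
    intro ε hε
    obtain ⟨η, hη, h⟩ := h ε hε
    obtain ⟨N, hN⟩ := exists_nat_one_div_lt hη
    have hN0 : (0 : ℝ) < N + 1 := by positivity
    -- telescoping over the uniform partition into `N + 1` intervals
    let τ : ℕ → I := fun k => projIcc 0 1 zero_le_one ((k : ℝ) / (N + 1))
    have hτ : ∀ k ≤ N + 1, (τ k : ℝ) = k / (N + 1) := by
      intro k hk
      have h1 : (k : ℝ) ≤ N + 1 := by exact_mod_cast hk
      simp only [τ]
      rw [projIcc_of_mem zero_le_one ⟨by positivity, (div_le_one hN0).2 h1⟩]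
    have h0 : τ 0 = 0 := Subtype.ext (by rw [hτ 0 (by omega)]; simp)
    have h1 : τ (N + 1) = 1 := Subtype.ext (by rw [hτ (N + 1) le_rfl]; push_cast; simp [hN0.ne'])
    have h2 : ∀ n ≤ N + 1, |Ψ (τ n) - Ψ 0| ≤ ε * (γ (τ n) - γ 0) := by
      intro n
      induction n with
      | zero => intro _; simp [h0]
      | succ n ih =>
        intro hn
        have h3 := ih (by omega)
        have h4 : (τ (n + 1) : ℝ) - τ n = 1 / (N + 1) := by
          rw [hτ _ hn, hτ n (by omega)]
          push_cast
          ring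
        have h5 := h (τ n) (τ (n + 1)) (by
          rw [← Subtype.coe_le_coe]
          have : 0 < 1 / ((N : ℝ) + 1) := by positivity
          linarith) (by rw [h4]; exact hN)
        calc |Ψ (τ (n + 1)) - Ψ 0| = |(Ψ (τ (n + 1)) - Ψ (τ n)) + (Ψ (τ n) - Ψ 0)| := by ring_nf
          _ ≤ _ := (abs_add_le _ _).trans (by linarith)
    simpa [h1] using h2 (N + 1) le_rfl
  have hlim : Tendsto (fun ε : ℝ => ε * (γ 1 - γ 0)) (𝓝[>] 0) (𝓝 0) := by
    have : Tendsto (fun ε : ℝ => ε * (γ 1 - γ 0)) (𝓝 0) (𝓝 (0 * (γ 1 - γ 0))) :=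
      tendsto_id.mul_const _
    rw [zero_mul] at this
    exact this.mono_left nhdsWithin_le_nhds
  have h1 : |Ψ 1 - Ψ 0| ≤ 0 := ge_of_tendsto hlim (eventually_mem_nhdsWithin.mono key)
  exact sub_eq_zero.1 (abs_nonpos_iff.1 h1)

end Calculus

end GeneralizedTransport

/-! ### Curves of finite length -/

namespace GeneralizedTransport

open Filter Topology

section ContinuousDependence

variable {X : Type*} [MetricSpace X] [CompactSpace X] [MeasurableSpace X] [BorelSpace X]
  {E : Type*} [NormedAddCommGroup E] [InnerProductSpace ℝ E] [FiniteDimensional ℝ E]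

omit [BorelSpace X] in
lemma abs_integral_le_norm_mul_mass (μ : FiniteMeasure X) (f : C(X, ℝ)) :
    |∫ x, f x ∂(μ : Measure X)| ≤ ‖f‖ * μ.mass := by
  have h := norm_integral_le_of_norm_le_const (μ := (μ : Measure X)) (f := f) (C := ‖f‖)
    (Eventually.of_forall f.norm_coe_le_norm)
  exact h

lemma continuous_integral_left (f : C(X, ℝ)) :
    Continuous fun μ : FiniteMeasure X => ∫ x, f x ∂(μ : Measure X) := by
  rw [continuous_iff_continuousAt]
  intro μ
  exact (FiniteMeasure.tendsto_iff_forall_integral_tendsto.1 tendsto_id)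
    (BoundedContinuousFunction.mkOfCompact f)

/-- Joint continuity holds because the mass is continuous, hence locally bounded, for the weak-*
topology. -/
lemma continuous_integral_pair :
    Continuous fun p : C(X, ℝ) × FiniteMeasure X => ∫ x, p.1 x ∂(p.2 : Measure X) := by
  rw [continuous_iff_continuousAt]
  rintro ⟨f, μ⟩
  have h1 : Tendsto (fun p : C(X, ℝ) × FiniteMeasure X => ∫ x, (p.1 - f) x ∂(p.2 : Measure X))
      (𝓝 (f, μ)) (𝓝 0) := by
    refine squeeze_zero_norm (a := fun p => ‖p.1 - f‖ * p.2.mass)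
      (fun p => abs_integral_le_norm_mul_mass p.2 (p.1 - f)) ?_
    have : Continuous fun p : C(X, ℝ) × FiniteMeasure X => ‖p.1 - f‖ * p.2.mass := by
      have := (FiniteMeasure.continuous_mass (Ω := X)).comp
        (continuous_snd : Continuous fun p : C(X, ℝ) × FiniteMeasure X => p.2)
      have h2 : Continuous fun p : C(X, ℝ) × FiniteMeasure X => (p.2.mass : ℝ) :=
        NNReal.continuous_coe.comp this
      fun_prop
    simpa using this.tendsto (f, μ)
  have h2 : Tendsto (fun p : C(X, ℝ) × FiniteMeasure X => ∫ x, f x ∂(p.2 : Measure X))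
      (𝓝 (f, μ)) (𝓝 (∫ x, f x ∂(μ : Measure X))) :=
    ((continuous_integral_left f).comp continuous_snd).tendsto (f, μ)
  have h3 := h1.add h2
  rw [zero_add] at h3
  refine h3.congr fun p => ?_
  rw [← integral_add (integrable_continuousMap _ _) (integrable_continuousMap _ _)]
  simp

/-- The pairing with a continuously varying function depends measurably on time. -/
lemma measurable_pairing_of_continuous {T : Type*} [TopologicalSpace T] [MeasurableSpace T]
    [OpensMeasurableSpace T] [MeasurableSpace E] [BorelSpace E]
    {ν : T → VectorMeasure X E} (hν : ∀ B, MeasurableSet B → Measurable fun t => ν t B)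
    {b : T → C(X, E)} (hb : Continuous b) : Measurable fun t => pairing (ν t) (b t) := by
  let _ : MeasurableSpace C(X, E) := borel _
  have : BorelSpace C(X, E) := ⟨rfl⟩
  let u : C(X, E) → T → ℝ := fun b t => pairing (ν t) b
  have h0 : ∀ t, Continuous fun b => u b t := fun t => (pairing (ν t)).continuous
  have h1 : ∀ b, Measurable (u b) := fun b => measurable_pairing hν b
  have h2 : Measurable (Function.uncurry u) := measurable_uncurry_of_continuous_of_measurable h0 h1
  have h3 : Measurable fun t => (b t, t) := hb.measurable.prodMk measurable_id
  have h4 := h2.comp h3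
  have h5 : (Function.uncurry u ∘ fun t => (b t, t)) = fun t => pairing (ν t) (b t) := by
    funext t
    simp only [Function.comp_apply, Function.uncurry_apply_pair, u]
  rwa [h5] at h4

end ContinuousDependence

variable {d : ℕ} {D : Set (Space d)}

lemma continuous_gradient {f : Space d → ℝ} (hf : ContDiff ℝ 1 f) : Continuous (gradient f) :=
  (InnerProductSpace.toDual ℝ (Space d)).symm.continuous.comp (hf.continuous_fderiv one_ne_zero)

/-- The gradient of a `C¹` function, as a continuous function on the closure of `D`. -/
noncomputable def gradientMap (D : Set (Space d)) {f : Space d → ℝ} (hf : ContDiff ℝ 1 f) :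
    C(closure D, Space d) :=
  ⟨fun x => gradient f x, (continuous_gradient hf).comp continuous_subtype_val⟩

/-- The restriction of a `C¹` function to the closure of `D`. -/
def valueMap (D : Set (Space d)) {f : Space d → ℝ} (hf : ContDiff ℝ 1 f) :
    C(closure D, ℝ) :=
  ⟨fun x => f x, hf.continuous.comp continuous_subtype_val⟩

variable [CompactSpace (closure D)] {δ : ℝ} {μ : I → FiniteMeasure (closure D)}
  {ν : I → VectorMeasure (closure D) (Space d)} {ζ : I → SignedMeasure (closure D)}

/-- The speed `𝓓(μ_t, ν_t, ζ_t)^(1/2)` of a curve. -/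
noncomputable def speed (D : Set (Space d)) (δ : ℝ) (μ : I → FiniteMeasure (closure D))
    (ν : I → VectorMeasure (closure D) (Space d)) (ζ : I → SignedMeasure (closure D))
    (t : I) : ℝ≥0∞ :=
  actionAt D δ μ ν ζ t ^ (1 / 2 : ℝ)

/-- Curves of finite length: weak-* continuous in the mass, measurable in momentum and source. No
equation is imposed. -/
structure HasFiniteLength (D : Set (Space d)) (δ : ℝ) (μ : I → FiniteMeasure (closure D))
    (ν : I → VectorMeasure (closure D) (Space d)) (ζ : I → SignedMeasure (closure D)) : Prop where
  continuous_mass : Continuous μ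
  measurable_momentum : ∀ B, MeasurableSet B → Measurable fun t => ν t B
  measurable_source : ∀ B, MeasurableSet B → Measurable fun t => ζ t B
  length_lt_top : ∫⁻ t : I, speed D δ μ ν ζ t < ⊤

/-- The rate of change `∫ ∇f · dν_r + ∫ f dζ_r` of `∫ f dμ_r` prescribed by the continuity
equation. -/
noncomputable def rate (ν : I → VectorMeasure (closure D) (Space d))
    (ζ : I → SignedMeasure (closure D)) {f : Space d → ℝ} (hf : ContDiff ℝ 1 f) (r : I) : ℝ :=
  pairing (ν r) (gradientMap D hf) + pairing (ζ r) (valueMap D hf)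

/-- Curves of finite length that solve the continuity equation in its integrated form: for each `C¹`
function `f` of space, the increments of `t ↦ ∫ f dμ_t` are the integrals of the rate of change. -/
structure IsFiniteLengthCurve (D : Set (Space d)) [CompactSpace (closure D)] (δ : ℝ)
    (μ : I → FiniteMeasure (closure D)) (ν : I → VectorMeasure (closure D) (Space d))
    (ζ : I → SignedMeasure (closure D)) : Prop extends HasFiniteLength D δ μ ν ζ where
  balance : ∀ (f : Space d → ℝ) (hf : ContDiff ℝ 1 f) (s t : I), s ≤ t →
    (∫ x : closure D, f x ∂(μ t : Measure (closure D))) -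
      ∫ x : closure D, f x ∂(μ s : Measure (closure D)) = ∫ r in Ioc s t, rate ν ζ hf r

variable [IsFiniteMeasure (lebesgue D)]

omit [CompactSpace (closure D)] in
lemma actionAt_eq (t : I) : actionAt D δ μ ν ζ t = energy (μ t : Measure (closure D)) (ν t) +
    ENNReal.ofReal (1 / δ) * energy (lebesgue D) (ζ t) :=
  action_eq_energy _ _ _ _ _

omit [CompactSpace (closure D)] in
lemma energy_momentum_le (t : I) :
    energy (μ t : Measure (closure D)) (ν t) ≤ actionAt D δ μ ν ζ t := by
  rw [actionAt_eq]
  exact le_self_add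

omit [CompactSpace (closure D)] in
lemma energy_source_le (hδ : 0 < δ) (t : I) :
    energy (lebesgue D) (ζ t) ≤ ENNReal.ofReal δ * actionAt D δ μ ν ζ t := by
  rw [actionAt_eq, mul_add, ← mul_assoc, ← ENNReal.ofReal_mul hδ.le, mul_one_div_cancel hδ.ne',
    ENNReal.ofReal_one, one_mul]
  exact le_add_self

lemma measurable_actionAt (hμ : Continuous μ)
    (hν : ∀ B, MeasurableSet B → Measurable fun t => ν t B)
    (hζ : ∀ B, MeasurableSet B → Measurable fun t => ζ t B) :
    Measurable (actionAt D δ μ ν ζ) := by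
  have h1 : Measurable fun t => energy (μ t : Measure (closure D)) (ν t) :=
    measurable_energy (fun f => ((continuous_integral_left f).comp hμ).measurable) hν
  have h2 : Measurable fun t => energy (lebesgue D) (ζ t) :=
    measurable_energy (μ := fun _ => ⟨lebesgue D, inferInstance⟩)
      (fun f => measurable_const) hζ
  have h3 : actionAt D δ μ ν ζ = fun t => energy (μ t : Measure (closure D)) (ν t) +
    ENNReal.ofReal (1 / δ) * energy (lebesgue D) (ζ t) := funext fun t => actionAt_eq t
  rw [h3]
  exact h1.add (h2.const_mul _)

namespace HasFiniteLength

lemma measurable_speed (h : HasFiniteLength D δ μ ν ζ) : Measurable (speed D δ μ ν ζ) :=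
  (measurable_actionAt h.continuous_mass h.measurable_momentum h.measurable_source).pow_const _

omit [CompactSpace (closure D)] [IsFiniteMeasure (lebesgue D)] in
lemma actionAt_lt_top_of_speed_lt_top {t : I} (h : speed D δ μ ν ζ t < ⊤) :
    actionAt D δ μ ν ζ t < ⊤ := by
  by_contra hcon
  rw [not_lt_top_iff] at hcon
  rw [speed, hcon, ENNReal.top_rpow_of_pos (by norm_num)] at h
  exact lt_irrefl _ h

lemma ae_speed_lt_top (h : HasFiniteLength D δ μ ν ζ) : ∀ᵐ t, speed D δ μ ν ζ t < ⊤ :=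
  ae_lt_top h.measurable_speed h.length_lt_top.ne

lemma integrable_speed (h : HasFiniteLength D δ μ ν ζ) :
    Integrable fun t => (speed D δ μ ν ζ t).toReal :=
  integrable_toReal_of_lintegral_ne_top h.measurable_speed.aemeasurable h.length_lt_top.ne

omit [CompactSpace (closure D)] [IsFiniteMeasure (lebesgue D)] in
lemma toReal_actionAt (t : I) :
    (actionAt D δ μ ν ζ t).toReal = (speed D δ μ ν ζ t).toReal ^ 2 := by
  rw [speed, ← ENNReal.toReal_pow, ← ENNReal.rpow_natCast, ← ENNReal.rpow_mul]
  simp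

omit [CompactSpace (closure D)] [IsFiniteMeasure (lebesgue D)] in
lemma exists_mass_le (h : Continuous μ) : ∃ M : ℝ, 0 ≤ M ∧ ∀ t, ((μ t).mass : ℝ) ≤ M := by
  have h1 : Continuous fun t => ((μ t).mass : ℝ) :=
    NNReal.continuous_coe.comp (FiniteMeasure.continuous_mass.comp h)
  obtain ⟨M, hM⟩ := (isCompact_range h1).bddAbove
  exact ⟨M, NNReal.zero_le_coe.trans (hM (mem_range_self (0 : I))), fun t => hM (mem_range_self t)⟩

lemma abs_pairing_momentum_le {t : I} (ht : speed D δ μ ν ζ t < ⊤) (b : C(closure D, Space d)) :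
    |pairing (ν t) b| ≤ ‖b‖ * √((μ t).mass : ℝ) * (speed D δ μ ν ζ t).toReal := by
  have hact := actionAt_lt_top_of_speed_lt_top ht
  have h1 : energy (μ t : Measure (closure D)) (ν t) ≤ actionAt D δ μ ν ζ t :=
    energy_momentum_le t
  have h2 := sq_pairing_le (h1.trans_lt hact) b
  refine abs_le_of_sq_le_sq' ?_ (by positivity) |> abs_le.2
  have h3 : ∫ x, ‖b x‖ ^ 2 ∂(μ t : Measure (closure D)) ≤ ‖b‖ ^ 2 * ((μ t).mass : ℝ) := by
    refine (le_abs_self _).trans ((abs_integral_le_norm_mul_mass (μ t) (normSq b)).trans ?_)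
    gcongr
    rw [ContinuousMap.norm_le _ (by positivity)]
    intro x
    rw [Real.norm_of_nonneg (show 0 ≤ normSq b x from sq_nonneg ‖b x‖)]
    exact pow_le_pow_left₀ (norm_nonneg _) (b.norm_coe_le_norm x) 2
  calc (pairing (ν t) b) ^ 2 ≤ (‖b‖ ^ 2 * ((μ t).mass : ℝ)) * (actionAt D δ μ ν ζ t).toReal := by
        refine h2.trans (mul_le_mul h3 (ENNReal.toReal_mono hact.ne h1) ENNReal.toReal_nonneg
          (by positivity))
    _ = _ := by rw [toReal_actionAt, mul_pow, mul_pow, Real.sq_sqrt NNReal.zero_le_coe]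

lemma abs_pairing_source_le (hδ : 0 < δ) {t : I} (ht : speed D δ μ ν ζ t < ⊤)
    (c : C(closure D, ℝ)) : |pairing (ζ t) c| ≤
      ‖c‖ * √((lebesgue D).real univ * δ) * (speed D δ μ ν ζ t).toReal := by
  have hact := actionAt_lt_top_of_speed_lt_top ht
  have h1 : energy (lebesgue D) (ζ t) ≤ ENNReal.ofReal δ * actionAt D δ μ ν ζ t :=
    energy_source_le hδ t
  have h1t : ENNReal.ofReal δ * actionAt D δ μ ν ζ t < ⊤ :=
    ENNReal.mul_lt_top ENNReal.ofReal_lt_top hact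
  have h2 := sq_pairing_le (h1.trans_lt h1t) c
  refine abs_le_of_sq_le_sq' ?_ (by positivity) |> abs_le.2
  have h3 : ∫ x, ‖c x‖ ^ 2 ∂(lebesgue D) ≤ ‖c‖ ^ 2 * (lebesgue D).real univ := by
    refine (le_abs_self _).trans
      ((abs_integral_le_norm_mul_mass ⟨lebesgue D, inferInstance⟩ (normSq c)).trans ?_)
    refine mul_le_mul_of_nonneg_right ?_ NNReal.zero_le_coe
    rw [ContinuousMap.norm_le _ (by positivity)]
    intro x
    rw [Real.norm_of_nonneg (show 0 ≤ normSq c x from sq_nonneg ‖c x‖)]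
    exact pow_le_pow_left₀ (norm_nonneg _) (c.norm_coe_le_norm x) 2
  calc (pairing (ζ t) c) ^ 2 ≤ (‖c‖ ^ 2 * (lebesgue D).real univ) *
        (ENNReal.ofReal δ * actionAt D δ μ ν ζ t).toReal := by
        refine h2.trans (mul_le_mul h3 (ENNReal.toReal_mono h1t.ne h1) ENNReal.toReal_nonneg
          (by positivity))
    _ = _ := by
        rw [ENNReal.toReal_mul, ENNReal.toReal_ofReal hδ.le, toReal_actionAt, mul_pow, mul_pow,
          Real.sq_sqrt (by positivity)]
        ring

/-- Along a curve of finite length, momentum and source are controlled by the speed. -/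
lemma exists_pairing_bound (h : HasFiniteLength D δ μ ν ζ) (hδ : 0 < δ) : ∃ C : ℝ, 0 ≤ C ∧
    ∀ᵐ t, (∀ b, |pairing (ν t) b| ≤ C * ‖b‖ * (speed D δ μ ν ζ t).toReal) ∧
      ∀ c, |pairing (ζ t) c| ≤ C * ‖c‖ * (speed D δ μ ν ζ t).toReal := by
  obtain ⟨M, hM0, hM⟩ := exists_mass_le h.continuous_mass
  refine ⟨max √M √((lebesgue D).real univ * δ), by positivity, ?_⟩
  filter_upwards [h.ae_speed_lt_top] with t ht
  refine ⟨fun b => (abs_pairing_momentum_le ht b).trans ?_,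
    fun c => (abs_pairing_source_le hδ ht c).trans ?_⟩
  · gcongr ?_ * _
    rw [mul_comm]
    gcongr
    exact (Real.sqrt_le_sqrt (hM t)).trans (le_max_left _ _)
  · gcongr ?_ * _
    rw [mul_comm]
    gcongr
    exact le_max_right _ _

lemma integrable_pairing_momentum (h : HasFiniteLength D δ μ ν ζ) (hδ : 0 < δ)
    {b : I → C(closure D, Space d)} (hb : Continuous b) :
    Integrable fun t => pairing (ν t) (b t) := by
  obtain ⟨C, hC0, hC⟩ := h.exists_pairing_bound hδ
  obtain ⟨K, hK⟩ := (isCompact_range hb.norm).bddAbove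
  refine (h.integrable_speed.const_mul (C * K)).mono
    (measurable_pairing_of_continuous h.measurable_momentum hb).aestronglyMeasurable ?_
  filter_upwards [hC] with t ht
  refine ((ht.1 (b t)).trans ?_).trans (le_abs_self _)
  gcongr
  exact hK (mem_range_self t)

lemma integrable_pairing_source (h : HasFiniteLength D δ μ ν ζ) (hδ : 0 < δ)
    {c : I → C(closure D, ℝ)} (hc : Continuous c) :
    Integrable fun t => pairing (ζ t) (c t) := by
  obtain ⟨C, hC0, hC⟩ := h.exists_pairing_bound hδ
  obtain ⟨K, hK⟩ := (isCompact_range hc.norm).bddAbove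
  refine (h.integrable_speed.const_mul (C * K)).mono
    (measurable_pairing_of_continuous h.measurable_source hc).aestronglyMeasurable ?_
  filter_upwards [hC] with t ht
  refine ((ht.2 (c t)).trans ?_).trans (le_abs_self _)
  gcongr
  exact hK (mem_range_self t)

lemma integrable_rate (h : HasFiniteLength D δ μ ν ζ) (hδ : 0 < δ) {f : Space d → ℝ}
    (hf : ContDiff ℝ 1 f) : Integrable (rate ν ζ hf) :=
  (h.integrable_pairing_momentum hδ (b := fun _ => gradientMap D hf) continuous_const).add
    (h.integrable_pairing_source hδ (c := fun _ => valueMap D hf) continuous_const)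

end HasFiniteLength

end GeneralizedTransport

/-! ### The continuity equation in integrated form -/

namespace GeneralizedTransport

open Filter Topology

variable {d : ℕ} {D : Set (Space d)} [CompactSpace (closure D)] {δ : ℝ}
  {μ : I → FiniteMeasure (closure D)} {ν : I → VectorMeasure (closure D) (Space d)}
  {ζ : I → SignedMeasure (closure D)} [IsFiniteMeasure (lebesgue D)]

omit [CompactSpace (closure D)] [IsFiniteMeasure (lebesgue D)] in
/-- A `C¹` function of space becomes a compactly supported one, with the same values and gradients on
the closure of `D`, after multiplication with `χ`. -/
lemma exists_cutoff (hD : Bornology.IsBounded D) : ∃ χ : Space d → ℝ, ContDiff ℝ 1 χ ∧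
    HasCompactSupport χ ∧ ∀ x ∈ closure D, χ =ᶠ[𝓝 x] 1 := by
  obtain ⟨R, hR0, hR⟩ := hD.closure.subset_ball_lt 0 0
  let χ : ContDiffBump (0 : Space d) := ⟨R, R + 1, hR0, by linarith⟩
  exact ⟨χ, χ.contDiff, χ.hasCompactSupport, fun x hx =>
    χ.eventuallyEq_one_of_mem_ball (hR hx)⟩

omit [CompactSpace (closure D)] [IsFiniteMeasure (lebesgue D)] in
lemma gradient_const_mul {f : Space d → ℝ} (hf : ContDiff ℝ 1 f) (c : ℝ) (x : Space d) :
    gradient (fun y => c * f y) x = c • gradient f x := by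
  have h1 : fderiv ℝ (fun y => c * f y) x = c • fderiv ℝ f x :=
    fderiv_const_mul (hf.differentiable one_ne_zero x) c
  rw [gradient, h1, map_smulₛₗ]
  rfl

/-- A solution of the continuity equation of finite length satisfies its integrated form. The test
functions are products of a function of time, a cutoff, and a function of space. -/
lemma IsFiniteLengthCurve.of_continuityEquation (hδ : 0 < δ) (hD : Bornology.IsBounded D)
    (h : ContinuityEquation D μ ν ζ) (hl : ∫⁻ t, speed D δ μ ν ζ t < ⊤) :
    IsFiniteLengthCurve D δ μ ν ζ := by
  have hfl : HasFiniteLength D δ μ ν ζ :=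
    ⟨h.continuous_mass, h.measurable_momentum, h.measurable_source, hl⟩
  refine ⟨hfl, fun f hf s t hst => ?_⟩
  obtain ⟨χ, hχ1, hχ2, hχ3⟩ := exists_cutoff hD
  let m : I → ℝ := fun t => ∫ x, f x ∂(μ t : Measure (closure D))
  have hm : Continuous m := (continuous_integral_left (valueMap D hf)).comp h.continuous_mass
  let G : I → ℝ := rate ν ζ hf
  have hG : Integrable G := hfl.integrable_rate hδ hf
  have key := sub_eq_integral_of_weak_derivative (m := IccExtend zero_le_one m)
    (G := extendZero G) (hm.Icc_extend' ) (integrable_extendZero hG) (fun ψ h1 h2 h3 => ?_) s.2 t.2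
  · rw [IccExtend_val, IccExtend_val, ← setIntegral_Ioc_coe _ hst] at key
    simp_rw [extendZero_coe] at key
    exact key
  · have h4 := h.weak_equation (fun p => ψ p.1 * (χ p.2 * f p.2))
      ((h1.comp contDiff_fst).mul ((hχ1.comp contDiff_snd).mul (hf.comp contDiff_snd))) ?_ ?_
    · have hval : ∀ x ∈ closure D, χ x * f x = f x := fun x hx => by
        rw [(hχ3 x hx).self_of_nhds, Pi.one_apply, one_mul]
      have e1 : ∀ t : I, ∫ x : closure D, deriv (fun s => ψ s * (χ (x : Space d) * f x)) (t : ℝ)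
          ∂(μ t : Measure (closure D)) = deriv ψ t * m t := by
        intro t
        rw [← integral_const_mul]
        refine integral_congr_ae (Eventually.of_forall fun x => ?_)
        simp only
        rw [deriv_mul_const (h1.differentiable one_ne_zero _), hval x x.2]
      have hgrad : ∀ (t : ℝ) (x : closure D), gradient (fun y => ψ t * (χ y * f y)) (x : Space d) =
          ψ t • gradient f (x : Space d) := by
        intro t x
        rw [← gradient_const_mul hf]
        have : (fun y => ψ t * (χ y * f y)) =ᶠ[𝓝 (x : Space d)] fun y => ψ t * f y := by
          filter_upwards [hχ3 x x.2] with y hy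
          rw [hy, Pi.one_apply, one_mul]
        rw [gradient, gradient, this.fderiv_eq]
      have e2 : ∀ t : I, (ν t).integral (fun x : closure D =>
          gradient (fun y : Space d => ψ t * (χ y * f y)) (x : Space d)) (innerSL ℝ) =
          ψ t * pairing (ν t) (gradientMap D hf) := by
        intro t
        simp_rw [hgrad]
        exact VectorMeasure.integral_fun_smul _ _ _ _
      have e3 : ∀ t : I, (ζ t).integral (fun x : closure D => ψ t * (χ (x : Space d) * f x))
          (ContinuousLinearMap.lsmul ℝ ℝ) = ψ t * pairing (ζ t) (valueMap D hf) := by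
        intro t
        rw [lsmul_eq_innerSL]
        have : (fun x : closure D => ψ t * (χ (x : Space d) * f x)) =
            fun x : closure D => ψ t • f x := funext fun x => by rw [hval x x.2, smul_eq_mul]
        rw [this]
        exact VectorMeasure.integral_fun_smul _ _ _ _
      simp only [e1, e2, e3] at h4
      have hψb : ∀ {g : I → ℝ}, Integrable g → Integrable fun t : I => ψ t * g t := by
        intro g hg
        obtain ⟨C, hC⟩ := h2.exists_bound_of_continuous h1.continuous
        refine Integrable.bdd_mul hg (c := C)
          (h1.continuous.comp continuous_subtype_val).aestronglyMeasurable
          (Eventually.of_forall fun t => hC t)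
      have i2 := hψb (hfl.integrable_pairing_momentum hδ (b := fun _ => gradientMap D hf)
        continuous_const)
      have i3 := hψb (hfl.integrable_pairing_source hδ (c := fun _ => valueMap D hf)
        continuous_const)
      rw [add_assoc, ← integral_add i2 i3] at h4
      rw [← integral_unitInterval, ← integral_unitInterval]
      have k1 : ∫ t : I, deriv ψ t * IccExtend zero_le_one m (t : ℝ) = ∫ t : I, deriv ψ t * m t :=
        integral_congr_ae (Eventually.of_forall fun t => by simp only [IccExtend_val])
      have k2 : ∫ t : I, ψ t * extendZero G (t : ℝ) = ∫ t : I, (ψ t * pairing (ν t)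
          (gradientMap D hf) + ψ t * pairing (ζ t) (valueMap D hf)) :=
        integral_congr_ae (Eventually.of_forall fun t => by
          simp only [extendZero_coe, G, rate, mul_add])
      rw [k1, k2]
      exact h4
    · refine HasCompactSupport.intro' (h2.prod (hχ2.mul_right (f' := f)))
        ((isClosed_tsupport _).prod (isClosed_tsupport _)) fun p hp => ?_
      rw [mem_prod, not_and_or] at hp
      rcases hp with hp | hp
      · simp only [image_eq_zero_of_notMem_tsupport hp, zero_mul]
      · have : χ p.2 * f p.2 = 0 := image_eq_zero_of_notMem_tsupport (f := χ * f) hp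
        rw [this, mul_zero]
    · have h5 : tsupport (fun p : ℝ × Space d => ψ p.1 * (χ p.2 * f p.2)) ⊆
          Prod.fst ⁻¹' tsupport ψ := by
        refine closure_minimal (fun p hp => ?_) ((isClosed_tsupport ψ).preimage continuous_fst)
        by_contra hcon
        exact hp (by simp only [image_eq_zero_of_notMem_tsupport hcon, zero_mul])
      exact fun p hp => ⟨h3 (h5 hp), mem_univ _⟩

section TestFunctions

variable {η : ℝ × Space d → ℝ}

omit [CompactSpace (closure D)] [IsFiniteMeasure (lebesgue D)] in
lemma contDiff_slice (hη : ContDiff ℝ 1 η) (t : ℝ) : ContDiff ℝ 1 fun y => η (t, y) :=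
  hη.comp (contDiff_const.prodMk contDiff_id)

omit [CompactSpace (closure D)] [IsFiniteMeasure (lebesgue D)] in
lemma hasDerivAt_slice (hη : ContDiff ℝ 1 η) (t : ℝ) (x : Space d) :
    HasDerivAt (fun s => η (s, x)) (fderiv ℝ η (t, x) (1, 0)) t :=
  (hη.differentiable one_ne_zero (t, x)).hasFDerivAt.comp_hasDerivAt t
    ((hasDerivAt_id t).prodMk (hasDerivAt_const t x))

omit [CompactSpace (closure D)] [IsFiniteMeasure (lebesgue D)] in
lemma continuous_deriv_slice (hη : ContDiff ℝ 1 η) :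
    Continuous fun p : ℝ × Space d => deriv (fun s => η (s, p.2)) p.1 := by
  have : (fun p : ℝ × Space d => deriv (fun s => η (s, p.2)) p.1) =
      fun p => fderiv ℝ η p (1, 0) := funext fun p => (hasDerivAt_slice hη p.1 p.2).deriv
  rw [this]
  exact (hη.continuous_fderiv one_ne_zero).clm_apply continuous_const

omit [CompactSpace (closure D)] [IsFiniteMeasure (lebesgue D)] in
lemma continuous_gradient_slice (hη : ContDiff ℝ 1 η) :
    Continuous fun p : ℝ × Space d => gradient (fun y => η (p.1, y)) p.2 := by
  have : (fun p : ℝ × Space d => gradient (fun y => η (p.1, y)) p.2) = fun p =>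
      (InnerProductSpace.toDual ℝ (Space d)).symm
        ((fderiv ℝ η p).comp (ContinuousLinearMap.inr ℝ ℝ (Space d))) := by
    funext p
    rw [gradient]
    congr 1
    exact ((hη.differentiable one_ne_zero p).hasFDerivAt.comp p.2
      (hasFDerivAt_prodMk_right p.1 p.2)).fderiv
  rw [this]
  exact (InnerProductSpace.toDual ℝ (Space d)).symm.continuous.comp
    ((hη.continuous_fderiv one_ne_zero).clm_comp continuous_const)

/-- The time derivative of a test function at time `t`, as a function on the closure of `D`. -/
noncomputable def timeDerivMap (D : Set (Space d)) (hη : ContDiff ℝ 1 η) (t : ℝ) :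
    C(closure D, ℝ) :=
  ⟨fun x => deriv (fun s => η (s, x)) t, (continuous_deriv_slice hη).comp
    (g := fun p : ℝ × Space d => deriv (fun s => η (s, p.2)) p.1)
    (f := fun x : closure D => (t, (x : Space d))) (by fun_prop)⟩

omit [CompactSpace (closure D)] [IsFiniteMeasure (lebesgue D)] in
lemma continuous_timeDerivMap (hη : ContDiff ℝ 1 η) :
    Continuous fun t : I => timeDerivMap D hη t := by
  refine ContinuousMap.continuous_of_continuous_uncurry _ ?_
  exact (continuous_deriv_slice hη).comp
    (g := fun p : ℝ × Space d => deriv (fun s => η (s, p.2)) p.1)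
    (f := fun p : I × closure D => ((p.1 : ℝ), (p.2 : Space d))) (by fun_prop)

omit [CompactSpace (closure D)] [IsFiniteMeasure (lebesgue D)] in
lemma continuous_gradientMap_slice (hη : ContDiff ℝ 1 η) :
    Continuous fun t : I => gradientMap D (contDiff_slice hη t) := by
  refine ContinuousMap.continuous_of_continuous_uncurry _ ?_
  exact (continuous_gradient_slice hη).comp
    (g := fun p : ℝ × Space d => gradient (fun y => η (p.1, y)) p.2)
    (f := fun p : I × closure D => ((p.1 : ℝ), (p.2 : Space d))) (by fun_prop)

omit [CompactSpace (closure D)] [IsFiniteMeasure (lebesgue D)] in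
lemma continuous_valueMap_slice (hη : ContDiff ℝ 1 η) :
    Continuous fun t : I => valueMap D (contDiff_slice hη t) := by
  refine ContinuousMap.continuous_of_continuous_uncurry _ ?_
  exact hη.continuous.comp (f := fun p : I × closure D => ((p.1 : ℝ), (p.2 : Space d)))
    (by fun_prop)

omit [IsFiniteMeasure (lebesgue D)] in
/-- Uniform first-order Taylor expansion of a test function in time. -/
lemma norm_valueMap_slice_sub_le (hη : ContDiff ℝ 1 η) {ε κ : ℝ}
    (hκ : ∀ s t : I, dist s t < κ → dist (timeDerivMap D hη s) (timeDerivMap D hη t) ≤ ε)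
    (hε : 0 ≤ ε) {s t : I} (hst : s ≤ t) (h : (t : ℝ) - s < κ) :
    ‖valueMap D (contDiff_slice hη t) - valueMap D (contDiff_slice hη s) -
      ((t : ℝ) - s) • timeDerivMap D hη s‖ ≤ ε * (t - s) := by
  have hst' : (s : ℝ) ≤ t := hst
  rw [ContinuousMap.norm_le _ (mul_nonneg hε (sub_nonneg.2 hst'))]
  intro x
  let a : ℝ := deriv (fun s => η (s, x)) s
  have h0 : ∀ r : ℝ, HasDerivAt (fun r => η (r, x) - r * a)
      (fderiv ℝ η (r, x) (1, 0) - a) r := fun r => by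
    have := (hasDerivAt_id r).mul_const a
    rw [one_mul] at this
    exact (hasDerivAt_slice hη r x).sub this
  have h1 := (convex_Icc (s : ℝ) t).norm_image_sub_le_of_norm_hasDerivWithin_le
    (f := fun r => η (r, x) - r * a) (f' := fun r => fderiv ℝ η (r, x) (1, 0) - a) (C := ε)
    (fun r _ => (h0 r).hasDerivWithinAt)
    (fun r hr => ?_) (left_mem_Icc.2 hst') (right_mem_Icc.2 hst')
  · rw [Real.norm_of_nonneg (sub_nonneg.2 hst')] at h1
    have h2 : (valueMap D (contDiff_slice hη t) - valueMap D (contDiff_slice hη s) -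
        ((t : ℝ) - s) • timeDerivMap D hη s) x = η (t, x) - t * a - (η (s, x) - s * a) := by
      change η (t, x) - η (s, x) - (t - s) * a = _
      ring
    rw [h2]
    exact h1
  · have hrI : r ∈ I := ⟨s.2.1.trans hr.1, hr.2.trans t.2.2⟩
    have h2 : dist (⟨r, hrI⟩ : I) s < κ := by
      rw [Subtype.dist_eq, Real.dist_eq, abs_of_nonneg (sub_nonneg.2 hr.1)]
      linarith [hr.2]
    have h3 : dist (timeDerivMap D hη r) (timeDerivMap D hη s) ≤ ε := hκ ⟨r, hrI⟩ s h2
    have h4 := (ContinuousMap.dist_apply_le_dist (f := timeDerivMap D hη r)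
      (g := timeDerivMap D hη s) x).trans h3
    rw [dist_eq_norm] at h4
    rw [← (hasDerivAt_slice hη r x).deriv]
    exact h4

end TestFunctions

lemma HasFiniteLength.lintegral_variation_momentum_lt_top (h : HasFiniteLength D δ μ ν ζ) :
    ∫⁻ t, (ν t).variation univ < ⊤ := by
  obtain ⟨M, hM0, hM⟩ := HasFiniteLength.exists_mass_le h.continuous_mass
  have h1 : ∀ᵐ t, (ν t).variation univ ≤
      ENNReal.ofReal M ^ (1 / 2 : ℝ) * speed D δ μ ν ζ t := by
    filter_upwards [h.ae_speed_lt_top] with t ht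
    have hact := HasFiniteLength.actionAt_lt_top_of_speed_lt_top ht
    have h1 : energy (μ t : Measure (closure D)) (ν t) ≤ actionAt D δ μ ν ζ t :=
      energy_momentum_le t
    refine (variation_le_of_energy_lt_top (h1.trans_lt hact)).trans ?_
    rw [speed]
    gcongr
    rw [← FiniteMeasure.ennreal_mass, ← ENNReal.ofReal_coe_nnreal]
    exact ENNReal.ofReal_le_ofReal (hM t)
  refine (lintegral_mono_ae h1).trans_lt ?_
  rw [lintegral_const_mul _ h.measurable_speed]
  exact ENNReal.mul_lt_top (by finiteness) h.length_lt_top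

lemma HasFiniteLength.lintegral_variation_source_lt_top (hδ : 0 < δ)
    (h : HasFiniteLength D δ μ ν ζ) : ∫⁻ t, (ζ t).variation univ < ⊤ := by
  have h1 : ∀ᵐ t, (ζ t).variation univ ≤
      (lebesgue D univ) ^ (1 / 2 : ℝ) * ENNReal.ofReal δ ^ (1 / 2 : ℝ) *
        speed D δ μ ν ζ t := by
    filter_upwards [h.ae_speed_lt_top] with t ht
    have hact := HasFiniteLength.actionAt_lt_top_of_speed_lt_top ht
    have h1 : energy (lebesgue D) (ζ t) ≤ ENNReal.ofReal δ * actionAt D δ μ ν ζ t :=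
      energy_source_le hδ t
    refine (variation_le_of_energy_lt_top
      (h1.trans_lt (ENNReal.mul_lt_top ENNReal.ofReal_lt_top hact))).trans ?_
    rw [speed, mul_assoc]
    refine mul_le_mul_right ?_ _
    rw [← ENNReal.mul_rpow_of_nonneg _ _ (one_half_pos (α := ℝ)).le]
    exact ENNReal.rpow_le_rpow h1 (one_half_pos (α := ℝ)).le
  refine (lintegral_mono_ae h1).trans_lt ?_
  rw [lintegral_const_mul _ h.measurable_speed]
  exact ENNReal.mul_lt_top (by finiteness) h.length_lt_top

/-- A curve of finite length that satisfies the integrated form of the continuity equation is a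
solution in the sense of distributions. For a test function `η`, the derivative of
`F(t) = ∫ η(t, ·) dμ_t` is identified by comparing increments of `F` over short intervals with
integrals of the expected derivative `K`; no differentiability in time of the curve is used. -/
lemma IsFiniteLengthCurve.continuityEquation (hδ : 0 < δ) (h : IsFiniteLengthCurve D δ μ ν ζ) :
    ContinuityEquation D μ ν ζ where
  continuous_mass := h.continuous_mass
  measurable_momentum := h.measurable_momentum
  measurable_source := h.measurable_source
  integrable_momentum := h.lintegral_variation_momentum_lt_top
  integrable_source := h.lintegral_variation_source_lt_top hδ
  weak_equation := by
    intro η hη hηc hηs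
    let a : I → C(closure D, ℝ) := fun t => timeDerivMap D hη t
    let b : I → C(closure D, Space d) := fun t => gradientMap D (contDiff_slice hη t)
    let c : I → C(closure D, ℝ) := fun t => valueMap D (contDiff_slice hη t)
    have ha : Continuous a := continuous_timeDerivMap hη
    have hb : Continuous b := continuous_gradientMap_slice hη
    have hc : Continuous c := continuous_valueMap_slice hη
    let p : I × I → ℝ := fun q => ∫ x, a q.1 x ∂(μ q.2 : Measure (closure D))
    have hp : Continuous p := continuous_integral_pair.comp
      ((ha.comp continuous_fst).prodMk (h.continuous_mass.comp continuous_snd))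
    have hpd : Continuous fun r => p (r, r) := by fun_prop
    have i1 : Integrable fun r : I => p (r, r) :=
      hpd.integrable_of_hasCompactSupport (HasCompactSupport.of_compactSpace _)
    have i2 := h.integrable_pairing_momentum hδ hb
    have i3 := h.integrable_pairing_source hδ hc
    let K : I → ℝ := fun r => p (r, r) + pairing (ν r) (b r) + pairing (ζ r) (c r)
    have hK : Integrable K := (i1.add i2).add i3
    let F : I → ℝ := fun t => ∫ x, c t x ∂(μ t : Measure (closure D))
    obtain ⟨M, hM0, hM⟩ := HasFiniteLength.exists_mass_le h.continuous_mass
    obtain ⟨C, hC0, hC⟩ := h.exists_pairing_bound hδ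
    let g : I → ℝ := fun r => M + 1 + 2 * C * (speed D δ μ ν ζ r).toReal
    have hg : Integrable g := (integrable_const _).add (h.integrable_speed.const_mul _)
    have key := eq_of_forall_local_bound (Ψ := fun t => F t - ∫ r in Ioc 0 t, K r)
      (γ := fun t => ∫ r in Ioc 0 t, g r) fun ε hε => ?_
    · have hzero : ∀ t : ℝ, t ∉ Ioo (0 : ℝ) 1 → ∀ x, η (t, x) = 0 := fun t ht x =>
        image_eq_zero_of_notMem_tsupport fun hx => ht (hηs hx).1
      have hF : ∀ t : I, (t : ℝ) ∉ Ioo (0 : ℝ) 1 → F t = 0 := fun t ht => by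
        change ∫ x : closure D, η (t, x) ∂(μ t : Measure (closure D)) = 0
        simp [hzero t ht]
      rw [hF 0 (by simp), hF 1 (by simp), Ioc_self, setIntegral_empty, setIntegral_Ioc_zero_one,
        sub_zero, zero_sub, neg_eq_zero] at key
      have hsplit : ∫ r, K r = (∫ r, p (r, r)) + (∫ r, pairing (ν r) (b r)) +
          ∫ r, pairing (ζ r) (c r) := by
        rw [← integral_add i1 i2]
        exact integral_add (i1.add i2) i3
      rw [hsplit] at key
      rw [lsmul_eq_innerSL]
      exact key
    · obtain ⟨κ₁, hκ₁, h₁⟩ := Metric.uniformContinuous_iff.1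
        (CompactSpace.uniformContinuous_of_continuous ha) ε hε
      obtain ⟨κ₂, hκ₂, h₂⟩ := Metric.uniformContinuous_iff.1
        (CompactSpace.uniformContinuous_of_continuous hb) ε hε
      obtain ⟨κ₃, hκ₃, h₃⟩ := Metric.uniformContinuous_iff.1
        (CompactSpace.uniformContinuous_of_continuous hc) ε hε
      obtain ⟨κ₄, hκ₄, h₄⟩ := Metric.uniformContinuous_iff.1
        (CompactSpace.uniformContinuous_of_continuous hp) ε hε
      refine ⟨min (min κ₁ κ₂) (min κ₃ κ₄), by positivity, fun s t hst hlt => ?_⟩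
      rw [lt_min_iff, lt_min_iff, lt_min_iff] at hlt
      have hst' : (s : ℝ) ≤ t := hst
      have hdist : ∀ r ∈ Ioc s t, dist s r ≤ (t : ℝ) - s := fun r hr => by
        have h1 : (s : ℝ) < r := hr.1
        have h2 : (r : ℝ) ≤ t := hr.2
        rw [Subtype.dist_eq, Real.dist_eq, abs_sub_comm, abs_of_nonneg (by linarith)]
        linarith
      have hvol : volume.real (Ioc s t) = (t : ℝ) - s := by
        rw [measureReal_def, unitInterval.volume_Ioc, ENNReal.toReal_ofReal (sub_nonneg.2 hst')]
      -- variation of the test function in time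
      have e1 : |(∫ x, c t x ∂(μ t : Measure (closure D))) -
          (∫ x, c s x ∂(μ t : Measure (closure D))) - (t - s) * p (s, t)| ≤ ε * (t - s) * M := by
        have h5 := abs_integral_le_norm_mul_mass (μ t) (c t - c s - ((t : ℝ) - s) • a s)
        have h6 : ∫ x, (c t - c s - ((t : ℝ) - s) • a s) x ∂(μ t : Measure (closure D)) =
            (∫ x, c t x ∂(μ t : Measure (closure D))) -
              (∫ x, c s x ∂(μ t : Measure (closure D))) - (t - s) * p (s, t) := by
          have j1 : ∫ x, (c t - c s) x ∂(μ t : Measure (closure D)) =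
              (∫ x, c t x ∂(μ t : Measure (closure D))) -
                ∫ x, c s x ∂(μ t : Measure (closure D)) :=
            integral_sub (integrable_continuousMap _ _) (integrable_continuousMap _ _)
          have j2 : ∫ x, ((t : ℝ) - s) * a s x ∂(μ t : Measure (closure D)) =
              ((t : ℝ) - s) * p (s, t) := integral_const_mul _ _
          rw [← j1, ← j2]
          exact integral_sub (integrable_continuousMap _ (c t - c s))
            ((integrable_continuousMap _ (a s)).const_mul _)
        rw [h6] at h5
        refine h5.trans (mul_le_mul (norm_valueMap_slice_sub_le hη
          (fun s t hst => (h₁ hst).le) hε.le hst hlt.1.1) (hM t) NNReal.zero_le_coe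
          (mul_nonneg hε.le (sub_nonneg.2 hst')))
      have e2 : |(t - s) * p (s, t) - ∫ r in Ioc s t, p (r, r)| ≤ ε * (t - s) := by
        have h5 : (t - s) * p (s, t) - ∫ r in Ioc s t, p (r, r) =
            ∫ r in Ioc s t, (p (s, t) - p (r, r)) := by
          rw [integral_sub (integrable_const _) i1.integrableOn, setIntegral_const, hvol,
            smul_eq_mul]
        rw [h5]
        refine (norm_setIntegral_le_of_norm_le_const (f := fun r => p (s, t) - p (r, r))
          (C := ε) (measure_lt_top _ _)
          fun r hr => ?_).trans_eq (by rw [hvol])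
        refine (h₄ (a := (s, t)) (b := (r, r)) ?_).le
        rw [Prod.dist_eq]
        refine max_lt ((hdist r hr).trans_lt hlt.2.2) ?_
        have h1 : (s : ℝ) < r := hr.1
        have h2 : (r : ℝ) ≤ t := hr.2
        simp only
        rw [Subtype.dist_eq, Real.dist_eq, abs_of_nonneg (by linarith)]
        linarith [hlt.2.2]
      -- variation of the measure in time
      have e3 : (∫ x, c s x ∂(μ t : Measure (closure D))) -
          (∫ x, c s x ∂(μ s : Measure (closure D))) =
          ∫ r in Ioc s t, (pairing (ν r) (b s) + pairing (ζ r) (c s)) :=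
        h.balance _ (contDiff_slice hη s) s t hst
      have i4 : Integrable fun r => pairing (ν r) (b s) + pairing (ζ r) (c s) :=
        (h.integrable_pairing_momentum hδ (b := fun _ => b s) continuous_const).add
          (h.integrable_pairing_source hδ (c := fun _ => c s) continuous_const)
      have i23 : Integrable fun r => pairing (ν r) (b r) + pairing (ζ r) (c r) := i2.add i3
      have e4 : |(∫ r in Ioc s t, (pairing (ν r) (b s) + pairing (ζ r) (c s))) -
          ∫ r in Ioc s t, (pairing (ν r) (b r) + pairing (ζ r) (c r))| ≤
          ε * ∫ r in Ioc s t, 2 * C * (speed D δ μ ν ζ r).toReal := by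
        rw [← integral_sub i4.integrableOn i23.integrableOn, ← integral_const_mul]
        refine norm_integral_le_of_norm_le (f := fun r =>
          pairing (ν r) (b s) + pairing (ζ r) (c s) - (pairing (ν r) (b r) + pairing (ζ r) (c r)))
          ((h.integrable_speed.const_mul (2 * C)).const_mul ε).integrableOn ?_
        filter_upwards [ae_restrict_of_ae hC, ae_restrict_mem measurableSet_Ioc] with r hr hrI
        have h5 := hr.1 (b s - b r)
        have h6 := hr.2 (c s - c r)
        rw [map_sub] at h5 h6
        have h7 : ‖b s - b r‖ ≤ ε := by
          rw [← dist_eq_norm]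
          exact (h₂ ((hdist r hrI).trans_lt hlt.1.2)).le
        have h8 : ‖c s - c r‖ ≤ ε := by
          rw [← dist_eq_norm]
          exact (h₃ ((hdist r hrI).trans_lt hlt.2.1)).le
        have h9 : C * ‖b s - b r‖ * (speed D δ μ ν ζ r).toReal ≤
            C * ε * (speed D δ μ ν ζ r).toReal := by gcongr
        have h10 : C * ‖c s - c r‖ * (speed D δ μ ν ζ r).toReal ≤
            C * ε * (speed D δ μ ν ζ r).toReal := by gcongr
        rw [Real.norm_eq_abs]
        calc _ = |(pairing (ν r) (b s) - pairing (ν r) (b r)) +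
              (pairing (ζ r) (c s) - pairing (ζ r) (c r))| := by ring_nf
          _ ≤ _ := (abs_add_le _ _).trans (by linarith)
      have e5 : ∫ r in Ioc s t, K r = (∫ r in Ioc s t, p (r, r)) +
          ∫ r in Ioc s t, (pairing (ν r) (b r) + pairing (ζ r) (c r)) := by
        rw [← integral_add i1.integrableOn i23.integrableOn]
        refine integral_congr_ae (Eventually.of_forall fun r => ?_)
        simp only [K]
        ring
      have e6 : ∫ r in Ioc s t, g r = (M + 1) * (t - s) +
          ∫ r in Ioc s t, 2 * C * (speed D δ μ ν ζ r).toReal := by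
        simp only [g]
        rw [integral_add (integrable_const _) (h.integrable_speed.const_mul _).integrableOn,
          setIntegral_const, hvol, smul_eq_mul, mul_comm]
      change |(F t - ∫ r in Ioc 0 t, K r) - (F s - ∫ r in Ioc 0 s, K r)| ≤
        ε * ((∫ r in Ioc 0 t, g r) - ∫ r in Ioc 0 s, g r)
      rw [setIntegral_Ioc_add hK (s.2.1 : (0 : I) ≤ s) hst,
        setIntegral_Ioc_add hg (s.2.1 : (0 : I) ≤ s) hst, add_sub_cancel_left, e5, e6]
      simp only [F]
      rw [abs_le] at e1 e2 e4 ⊢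
      constructor <;> nlinarith [e1.1, e1.2, e2.1, e2.2, e4.1, e4.2, e3]

end GeneralizedTransport

/-! ### Time changes -/

namespace GeneralizedTransport

open Filter Topology NNReal

section TimeChange

/-- A monotone time change `τ` with derivative `q`: the image of `q(t) dt` under `τ` is Lebesgue
measure on the interval `[τ 0, τ 1]`. -/
structure IsTimeChange (τ : I → I) (q : I → ℝ≥0) : Prop where
  continuous : Continuous τ
  monotone : Monotone τ
  measurable : Measurable q
  map_eq : Measure.map τ (volume.withDensity fun t => (q t : ℝ≥0∞)) =
    volume.restrict (Icc (τ 0) (τ 1))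

lemma volume_Ioc_zero_compl : volume ((Ioc (0 : I) 1)ᶜ) = 0 := by
  have : (Ioc (0 : I) 1)ᶜ = {0} := by
    ext t
    simp only [mem_compl_iff, mem_Ioc, not_and_or, not_lt, not_le, mem_singleton_iff]
    constructor
    · rintro (h | h)
      · exact le_antisymm h t.2.1
      · exact absurd h (not_lt.2 t.2.2)
    · rintro rfl
      exact Or.inl le_rfl
  rw [this, measure_singleton]

/-- It suffices that `q` be the derivative of `τ` in integrated form. -/
lemma IsTimeChange.of_setLIntegral {τ : I → I} {q : I → ℝ≥0} (hτ : Continuous τ)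
    (hm : Monotone τ) (hq : Measurable q)
    (h : ∀ t, ∫⁻ r in Ioc 0 t, (q r : ℝ≥0∞) = ENNReal.ofReal (τ t - τ 0)) : IsTimeChange τ q := by
  refine ⟨hτ, hm, hq, ?_⟩
  let κ : Measure I := volume.withDensity fun t => (q t : ℝ≥0∞)
  have hκ : ∀ t, κ (Iic t) = ENNReal.ofReal (τ t - τ 0) := fun t => by
    have h1 : κ (Iic t) = κ (Ioc 0 t) := by
      refine measure_congr (ae_eq_set.2 ⟨?_, ?_⟩)
      · refine withDensity_absolutelyContinuous _ _ (measure_mono_null ?_ volume_Ioc_zero_compl)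
        exact fun r hr hr2 => hr.2 ⟨hr2.1, hr.1⟩
      · rw [sdiff_eq_empty.2 Ioc_subset_Iic_self, measure_empty]
    rw [h1, withDensity_apply _ measurableSet_Ioc, h]
  have hfin : IsFiniteMeasure κ := by
    refine ⟨?_⟩
    have : (univ : Set I) = Iic 1 := (eq_univ_of_forall fun t => t.2.2).symm
    rw [this, hκ]
    exact ENNReal.ofReal_lt_top
  refine Measure.ext_of_Iic _ _ fun a => ?_
  rw [Measure.map_apply hτ.measurable measurableSet_Iic, Measure.restrict_apply measurableSet_Iic]
  rcases lt_or_ge a (τ 0) with h0 | h0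
  · have e1 : τ ⁻¹' Iic a = ∅ := eq_empty_of_forall_notMem fun t (ht : τ t ≤ a) =>
      absurd (hm t.2.1 : τ 0 ≤ τ t) (not_le.2 (ht.trans_lt h0))
    have e2 : Iic a ∩ Icc (τ 0) (τ 1) = ∅ := eq_empty_of_forall_notMem fun t ht =>
      absurd ht.2.1 (not_le.2 (ht.1.trans_lt h0))
    rw [e1, e2, measure_empty, measure_empty]
  · have hc : IsCompact (τ ⁻¹' Iic a) := (isClosed_Iic.preimage hτ).isCompact
    obtain ⟨t, ht, hmax⟩ := hc.exists_isGreatest ⟨0, h0⟩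
    have e1 : τ ⁻¹' Iic a = Iic t :=
      Subset.antisymm (fun r hr => hmax hr) fun r (hr : r ≤ t) => (hm hr).trans ht
    have e2 : Iic a ∩ Icc (τ 0) (τ 1) = Icc (τ 0) (τ t) := by
      refine Subset.antisymm (fun r hr => ⟨hr.2.1, ?_⟩)
        fun r hr => ⟨hr.2.trans ht, hr.1, hr.2.trans (hm t.2.2)⟩
      by_contra hcon
      rw [not_le] at hcon
      obtain ⟨t', ht', hr'⟩ := intermediate_value_Icc (a := t) (b := 1) t.2.2 hτ.continuousOn
        (show r ∈ Icc (τ t) (τ 1) from ⟨hcon.le, hr.2.2⟩)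
      have h2 : t' ≤ t := hmax (show τ t' ≤ a from hr'.trans_le hr.1)
      have h3 : r ≤ τ t := hr' ▸ hm h2
      exact absurd hcon (not_lt.2 h3)
    rw [e1, e2, hκ, unitInterval.volume_Icc]

end TimeChange

variable {d : ℕ} {D : Set (Space d)} [CompactSpace (closure D)] {δ : ℝ}
  {μ : I → FiniteMeasure (closure D)} {ν : I → VectorMeasure (closure D) (Space d)}
  {ζ : I → SignedMeasure (closure D)} [IsFiniteMeasure (lebesgue D)]

omit [CompactSpace (closure D)] in
lemma speed_smul (c : ℝ) {μ₁ : I → FiniteMeasure (closure D)}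
    {ν₁ : I → VectorMeasure (closure D) (Space d)} {ζ₁ : I → SignedMeasure (closure D)} {t r : I}
    (hμ : μ₁ t = μ r) (hν : ν₁ t = c • ν r) (hζ : ζ₁ t = c • ζ r) :
    speed D δ μ₁ ν₁ ζ₁ t = ENNReal.ofReal |c| * speed D δ μ ν ζ r := by
  have h1 : actionAt D δ μ₁ ν₁ ζ₁ t = ENNReal.ofReal |c| ^ 2 * actionAt D δ μ ν ζ r := by
    rw [actionAt_eq, actionAt_eq, hμ, hν, hζ, energy_smul, energy_smul, mul_add,
      ← ENNReal.ofReal_pow (abs_nonneg c), sq_abs, mul_left_comm]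
  rw [speed, speed, h1, ENNReal.mul_rpow_of_nonneg _ _ one_half_pos.le, ← ENNReal.rpow_natCast,
    ← ENNReal.rpow_mul]
  norm_num

omit [CompactSpace (closure D)] in
lemma speed_timeChange (τ : I → I) (q : I → ℝ≥0) (t : I) :
    speed D δ (μ ∘ τ) (fun t => (q t : ℝ) • ν (τ t)) (fun t => (q t : ℝ) • ζ (τ t)) t =
      (q t : ℝ≥0∞) * speed D δ μ ν ζ (τ t) := by
  rw [speed_smul (q t : ℝ) (μ := μ) (ν := ν) (ζ := ζ) (r := τ t) (t := t)
    (μ₁ := μ ∘ τ) (ν₁ := fun t => (q t : ℝ) • ν (τ t)) (ζ₁ := fun t => (q t : ℝ) • ζ (τ t)) rfl rfl rfl,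
    abs_of_nonneg (q t).coe_nonneg, ENNReal.ofReal_coe_nnreal]

/-- The length of a time-changed curve is the length of the part of the curve that is traversed. -/
lemma HasFiniteLength.lintegral_speed_timeChange (h : HasFiniteLength D δ μ ν ζ) {τ : I → I}
    {q : I → ℝ≥0} (hτ : IsTimeChange τ q) :
    ∫⁻ t, speed D δ (μ ∘ τ) (fun t => (q t : ℝ) • ν (τ t)) (fun t => (q t : ℝ) • ζ (τ t)) t =
      ∫⁻ t in Icc (τ 0) (τ 1), speed D δ μ ν ζ t := by
  simp_rw [speed_timeChange]
  have hm := h.measurable_speed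
  rw [← hτ.map_eq, lintegral_map hm hτ.continuous.measurable,
    lintegral_withDensity_eq_lintegral_mul _ hτ.measurable.coe_nnreal_ennreal
      (show Measurable fun t => speed D δ μ ν ζ (τ t) from hm.comp hτ.continuous.measurable)]
  rfl

omit [CompactSpace (closure D)] [IsFiniteMeasure (lebesgue D)] in
lemma rate_smul (q : I → ℝ) (τ : I → I) {f : Space d → ℝ} (hf : ContDiff ℝ 1 f)
    [CompactSpace (closure D)] (r : I) :
    rate (fun t => q t • ν (τ t)) (fun t => q t • ζ (τ t)) hf r = q r * rate ν ζ hf (τ r) := by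
  simp only [rate, pairing_smul, mul_add]

/-- Finite length curves are invariant under monotone time changes. -/
lemma IsFiniteLengthCurve.timeChange (h : IsFiniteLengthCurve D δ μ ν ζ) {τ : I → I}
    {q : I → ℝ≥0} (hτ : IsTimeChange τ q) :
    IsFiniteLengthCurve D δ (μ ∘ τ) (fun t => (q t : ℝ) • ν (τ t))
      (fun t => (q t : ℝ) • ζ (τ t)) where
  continuous_mass := h.continuous_mass.comp hτ.continuous
  measurable_momentum B hB := hτ.measurable.coe_nnreal_real.smul
    ((h.measurable_momentum B hB).comp hτ.continuous.measurable)
  measurable_source B hB := hτ.measurable.coe_nnreal_real.smul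
    ((h.measurable_source B hB).comp hτ.continuous.measurable)
  length_lt_top := by
    rw [h.lintegral_speed_timeChange hτ]
    exact (setLIntegral_le_lintegral _ _).trans_lt h.length_lt_top
  balance f hf s t hst := by
    rw [Function.comp_apply, Function.comp_apply, h.balance f hf _ _ (hτ.monotone hst)]
    let κ : Measure I := volume.withDensity fun t => (q t : ℝ≥0∞)
    have hnull : ∀ c : I, κ (τ ⁻¹' {c}) = 0 := fun c => by
      rw [← Measure.map_apply hτ.continuous.measurable (measurableSet_singleton c), hτ.map_eq]
      exact Measure.absolutelyContinuous_of_le Measure.restrict_le_self (measure_singleton c)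
    -- `τ` may be constant on intervals, but these are null sets for `q(t) dt`.
    have hset : (Ioc s t : Set I) =ᵐ[κ] τ ⁻¹' Ioc (τ s) (τ t) := by
      refine ae_eq_set.2 ⟨measure_mono_null (fun r hr => ?_) (hnull (τ s)), measure_mono_null
        (fun r hr => ?_) (hnull (τ t))⟩
      · by_contra hcon
        exact hr.2 ⟨lt_of_le_of_ne (hτ.monotone hr.1.1.le) (Ne.symm hcon), hτ.monotone hr.1.2⟩
      · by_contra hcon
        refine hr.2 ⟨hτ.monotone.reflect_lt hr.1.1, le_of_lt ?_⟩
        exact hτ.monotone.reflect_lt (lt_of_le_of_ne hr.1.2 hcon)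
    have h1 : ∫ r in Ioc s t, rate (fun t => (q t : ℝ) • ν (τ t)) (fun t => (q t : ℝ) • ζ (τ t))
        hf r = ∫ r in Ioc s t, rate ν ζ hf (τ r) ∂κ := by
      rw [setIntegral_withDensity_eq_setIntegral_smul hτ.measurable _ measurableSet_Ioc]
      refine integral_congr_ae (Eventually.of_forall fun r => ?_)
      exact rate_smul (fun t => (q t : ℝ)) τ hf r
    have h2 : ∫ r in τ ⁻¹' Ioc (τ s) (τ t), rate ν ζ hf (τ r) ∂κ =
        ∫ r in Ioc (τ s) (τ t), rate ν ζ hf r ∂(κ.map τ) :=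
      (setIntegral_map measurableSet_Ioc
        ((measurable_pairing_of_continuous h.measurable_momentum
          (b := fun _ => gradientMap D hf) continuous_const).add
          (measurable_pairing_of_continuous h.measurable_source
          (b := fun _ => valueMap D hf) continuous_const)).aestronglyMeasurable
        hτ.continuous.aemeasurable).symm
    rw [h1, setIntegral_congr_set hset, h2, hτ.map_eq, Measure.restrict_restrict measurableSet_Ioc,
      inter_eq_left.2]
    exact fun r hr => ⟨(hτ.monotone s.2.1).trans hr.1.le, hr.2.trans (hτ.monotone t.2.2)⟩

lemma HasFiniteLength.lintegral_speed_reverse (h : HasFiniteLength D δ μ ν ζ) :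
    ∫⁻ t, speed D δ (fun t => μ (unitInterval.symm t))
      (fun t => (-1 : ℝ) • ν (unitInterval.symm t))
      (fun t => (-1 : ℝ) • ζ (unitInterval.symm t)) t = ∫⁻ t, speed D δ μ ν ζ t := by
  have h1 : ∀ t, speed D δ (fun t => μ (unitInterval.symm t))
      (fun t => (-1 : ℝ) • ν (unitInterval.symm t))
      (fun t => (-1 : ℝ) • ζ (unitInterval.symm t)) t = speed D δ μ ν ζ (unitInterval.symm t) :=
    fun t => by
      rw [speed_smul (-1) (μ := μ) (ν := ν) (ζ := ζ) (t := t) (r := unitInterval.symm t)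
        (μ₁ := fun t => μ (unitInterval.symm t))
        (ν₁ := fun t => (-1 : ℝ) • ν (unitInterval.symm t))
        (ζ₁ := fun t => (-1 : ℝ) • ζ (unitInterval.symm t)) rfl rfl rfl]
      simp
  simp_rw [h1]
  exact unitInterval.measurePreserving_symm.lintegral_comp h.measurable_speed

/-- Time reversal. -/
lemma IsFiniteLengthCurve.reverse (h : IsFiniteLengthCurve D δ μ ν ζ) :
    IsFiniteLengthCurve D δ (fun t => μ (unitInterval.symm t))
      (fun t => (-1 : ℝ) • ν (unitInterval.symm t))
      (fun t => (-1 : ℝ) • ζ (unitInterval.symm t)) where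
  continuous_mass := h.continuous_mass.comp unitInterval.continuous_symm
  measurable_momentum B hB :=
    ((h.measurable_momentum B hB).comp unitInterval.continuous_symm.measurable).const_smul (-1 : ℝ)
  measurable_source B hB :=
    ((h.measurable_source B hB).comp unitInterval.continuous_symm.measurable).const_smul (-1 : ℝ)
  length_lt_top := by
    rw [h.lintegral_speed_reverse]
    exact h.length_lt_top
  balance f hf s t hst := by
    have h1 := h.balance f hf _ _ (unitInterval.symm_le_symm.2 hst)
    rw [← neg_inj, neg_sub, h1, ← integral_neg]
    have h2 : ∀ r, -rate (fun t => (-1 : ℝ) • ν (unitInterval.symm t))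
      (fun t => (-1 : ℝ) • ζ (unitInterval.symm t)) hf r = rate ν ζ hf (unitInterval.symm r) :=
      fun r => by rw [rate_smul (fun _ => -1) unitInterval.symm hf]; ring
    simp_rw [h2]
    have h3 := unitInterval.measurePreserving_symm.setIntegral_preimage_emb
      unitInterval.symmMeasurableEquiv.measurableEmbedding (rate ν ζ hf)
      (Ioc (unitInterval.symm t) (unitInterval.symm s))
    rw [← h3]
    refine setIntegral_congr_set ?_
    have h4 : unitInterval.symm ⁻¹' Ioc (unitInterval.symm t) (unitInterval.symm s) = Ico s t := by
      ext r
      simp [and_comm]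
    rw [h4]
    exact Ico_ae_eq_Ioc

end GeneralizedTransport

/-! ### Restriction and concatenation of curves -/

namespace GeneralizedTransport

open Filter Topology NNReal

variable {d : ℕ} {D : Set (Space d)} [CompactSpace (closure D)] {δ : ℝ}
  {μ : I → FiniteMeasure (closure D)} {ν : I → VectorMeasure (closure D) (Space d)}
  {ζ : I → SignedMeasure (closure D)} [IsFiniteMeasure (lebesgue D)]

/-- The affine time change that maps `[0, 1]` to `[s, t]`. -/
lemma exists_affine_timeChange {s t : I} (hst : s ≤ t) :
    ∃ (τ : I → I) (q : I → ℝ≥0), IsTimeChange τ q ∧ τ 0 = s ∧ τ 1 = t := by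
  have hst' : (0 : ℝ) ≤ t - s := sub_nonneg.2 hst
  let τ : I → I := fun r => ⟨s + r * (t - s), by
    have := s.2.1; have := mul_nonneg r.2.1 hst'; linarith, by
    have := t.2.2; have := mul_le_mul_of_nonneg_right r.2.2 hst'; linarith⟩
  have h0 : τ 0 = s := Subtype.ext (by simp [τ])
  refine ⟨τ, fun _ => Real.toNNReal (t - s), IsTimeChange.of_setLIntegral ?_ ?_ measurable_const ?_, h0,
    Subtype.ext (by simp [τ])⟩
  · exact Continuous.subtype_mk (by fun_prop) _
  · intro a b hab
    have : (a : ℝ) ≤ b := hab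
    exact add_le_add le_rfl (mul_le_mul_of_nonneg_right this hst')
  · intro r
    rw [setLIntegral_const, unitInterval.volume_Ioc, h0]
    rw [← ENNReal.ofReal, ← ENNReal.ofReal_mul hst']
    congr 1
    simp only [τ, Icc.coe_zero]
    ring

/-- The time change that traverses `[0, 1]` during the first half of the time interval. -/
lemma isTimeChange_left : IsTimeChange (fun t : I => ⟨min (2 * t) 1, by
      have := t.2.1; positivity, min_le_right _ _⟩)
    (fun t => if (t : ℝ) ≤ 1 / 2 then 2 else 0) := by
  refine IsTimeChange.of_setLIntegral (Continuous.subtype_mk (by fun_prop) _) ?_ ?_ ?_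
  · intro a b hab
    have : (a : ℝ) ≤ b := hab
    exact min_le_min (mul_le_mul_of_nonneg_left this zero_le_two) le_rfl
  · exact Measurable.ite (measurableSet_le measurable_subtype_coe measurable_const)
      measurable_const measurable_const
  · intro t
    let c : I := ⟨1 / 2, by norm_num, by norm_num⟩
    have h1 : (fun r : I => (((if (r : ℝ) ≤ 1 / 2 then 2 else 0 : ℝ≥0)) : ℝ≥0∞)) =
        (Iic c).indicator fun _ => 2 := by
      funext r
      by_cases hr : (r : ℝ) ≤ 1 / 2
      · rw [if_pos hr, indicator_of_mem (show r ∈ Iic c from hr)]; rfl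
      · rw [if_neg hr, indicator_of_notMem (show r ∉ Iic c from hr)]; rfl
    rw [h1, setLIntegral_indicator measurableSet_Iic, setLIntegral_const, inter_comm,
      Ioc_inter_Iic, unitInterval.volume_Ioc]
    have h2 : ((t ⊓ c : I) : ℝ) = min (t : ℝ) (1 / 2) := by
      rcases le_total t c with h | h
      · rw [inf_eq_left.2 h, min_eq_left (show (t : ℝ) ≤ 1 / 2 from h)]
      · rw [inf_eq_right.2 h, min_eq_right (show 1 / 2 ≤ (t : ℝ) from h)]
    rw [h2, show (2 : ℝ≥0∞) = ENNReal.ofReal 2 by simp, ← ENNReal.ofReal_mul zero_le_two]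
    congr 1
    simp only [Icc.coe_zero]
    rcases le_total (t : ℝ) (1 / 2) with h | h
    · rw [min_eq_left h, min_eq_left (by linarith), min_eq_left (by norm_num)]; ring
    · rw [min_eq_right h, min_eq_right (by linarith), min_eq_left (by norm_num)]; ring

/-- The time change that traverses `[0, 1]` during the second half of the time interval. -/
lemma isTimeChange_right : IsTimeChange (fun t : I => ⟨max (2 * t - 1) 0, le_max_right _ _, by
      have := t.2.2; exact max_le (by linarith) zero_le_one⟩)
    (fun t => if (t : ℝ) ≤ 1 / 2 then 0 else 2) := by
  refine IsTimeChange.of_setLIntegral (Continuous.subtype_mk (by fun_prop) _) ?_ ?_ ?_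
  · intro a b hab
    have : (a : ℝ) ≤ b := hab
    exact max_le_max (sub_le_sub_right (mul_le_mul_of_nonneg_left this zero_le_two) 1) le_rfl
  · exact Measurable.ite (measurableSet_le measurable_subtype_coe measurable_const)
      measurable_const measurable_const
  · intro t
    let c : I := ⟨1 / 2, by norm_num, by norm_num⟩
    have h1 : (fun r : I => (((if (r : ℝ) ≤ 1 / 2 then 0 else 2 : ℝ≥0)) : ℝ≥0∞)) =
        (Ioi c).indicator fun _ => 2 := by
      funext r
      by_cases hr : (r : ℝ) ≤ 1 / 2
      · rw [if_pos hr, indicator_of_notMem (show r ∉ Ioi c from not_lt.2 hr)]; rfl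
      · rw [if_neg hr, indicator_of_mem (show r ∈ Ioi c from not_le.1 hr)]; rfl
    have h0 : (0 : I) ⊔ c = c := sup_eq_right.2 (show (0 : I) ≤ c from c.2.1)
    rw [h1, setLIntegral_indicator measurableSet_Ioi, setLIntegral_const, inter_comm,
      Ioc_inter_Ioi, unitInterval.volume_Ioc, h0,
      show (2 : ℝ≥0∞) = ENNReal.ofReal 2 by simp, ← ENNReal.ofReal_mul zero_le_two]
    simp only [Icc.coe_zero, c]
    rcases le_total (t : ℝ) (1 / 2) with h | h
    · rw [max_eq_right (by linarith), max_eq_right (by norm_num), ENNReal.ofReal_of_nonpos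
        (by linarith)]
      simp
    · rw [max_eq_left (by linarith), max_eq_right (by norm_num)]
      congr 1; ring

open Classical in
/-- Curves of finite length can be concatenated; the lengths add. -/
lemma IsFiniteLengthCurve.exists_concat (hδ : 0 < δ) (h : IsFiniteLengthCurve D δ μ ν ζ)
    {μ' : I → FiniteMeasure (closure D)} {ν' : I → VectorMeasure (closure D) (Space d)}
    {ζ' : I → SignedMeasure (closure D)} (h' : IsFiniteLengthCurve D δ μ' ν' ζ')
    (hmid : μ 1 = μ' 0) :
    ∃ (μ₀ : I → FiniteMeasure (closure D)) (ν₀ : I → VectorMeasure (closure D) (Space d))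
      (ζ₀ : I → SignedMeasure (closure D)), IsFiniteLengthCurve D δ μ₀ ν₀ ζ₀ ∧ μ₀ 0 = μ 0 ∧
        μ₀ 1 = μ' 1 ∧ ∫⁻ t, speed D δ μ₀ ν₀ ζ₀ t ≤
          (∫⁻ t, speed D δ μ ν ζ t) + ∫⁻ t, speed D δ μ' ν' ζ' t := by
  obtain ⟨τ₁, q₁, h1, hq₁, hτ₁, hτ₁0⟩ : ∃ (τ : I → I) (q : I → ℝ≥0), IsTimeChange τ q ∧
      (∀ t : I, 1 / 2 < (t : ℝ) → q t = 0) ∧ (∀ t : I, 1 / 2 ≤ (t : ℝ) → τ t = 1) ∧ τ 0 = 0 :=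
    ⟨_, _, isTimeChange_left, fun t ht => if_neg (not_le.2 ht),
      fun t ht => Subtype.ext (min_eq_right (by linarith)), Subtype.ext (by simp)⟩
  obtain ⟨τ₂, q₂, h2, hq₂, hτ₂, hτ₂1⟩ : ∃ (τ : I → I) (q : I → ℝ≥0), IsTimeChange τ q ∧
      (∀ t : I, (t : ℝ) ≤ 1 / 2 → q t = 0) ∧ (∀ t : I, (t : ℝ) ≤ 1 / 2 → τ t = 0) ∧ τ 1 = 1 :=
    ⟨_, _, isTimeChange_right, fun t ht => if_pos ht,
      fun t ht => Subtype.ext (max_eq_right (by linarith)), Subtype.ext (by norm_num)⟩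
  have c1 := h.timeChange h1
  have c2 := h'.timeChange h2
  let μ₀ : I → FiniteMeasure (closure D) := fun t =>
    if (t : ℝ) ≤ 1 / 2 then (μ ∘ τ₁) t else (μ' ∘ τ₂) t
  let ν₀ : I → VectorMeasure (closure D) (Space d) := fun t =>
    (q₁ t : ℝ) • ν (τ₁ t) + (q₂ t : ℝ) • ν' (τ₂ t)
  let ζ₀ : I → SignedMeasure (closure D) := fun t =>
    (q₁ t : ℝ) • ζ (τ₁ t) + (q₂ t : ℝ) • ζ' (τ₂ t)
  have hcont : Continuous μ₀ := Continuous.if_le c1.continuous_mass c2.continuous_mass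
    continuous_subtype_val continuous_const fun t ht => by
      rw [Function.comp_apply, Function.comp_apply, hτ₁ t ht.ge, hτ₂ t ht.le, hmid]
  have hνm : ∀ B, MeasurableSet B → Measurable fun t => ν₀ t B := fun B hB =>
    (c1.measurable_momentum B hB).add (c2.measurable_momentum B hB)
  have hζm : ∀ B, MeasurableSet B → Measurable fun t => ζ₀ t B := fun B hB =>
    (c1.measurable_source B hB).add (c2.measurable_source B hB)
  have z1 : ∀ x : VectorMeasure (closure D) (Space d), (0 : ℝ) • x = 0 := fun x => zero_smul ℝ x
  have z2 : ∀ x : SignedMeasure (closure D), (0 : ℝ) • x = 0 := fun x => zero_smul ℝ x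
  have hspeed : ∀ t, speed D δ μ₀ ν₀ ζ₀ t ≤
      speed D δ (μ ∘ τ₁) (fun t => (q₁ t : ℝ) • ν (τ₁ t)) (fun t => (q₁ t : ℝ) • ζ (τ₁ t)) t +
      speed D δ (μ' ∘ τ₂) (fun t => (q₂ t : ℝ) • ν' (τ₂ t)) (fun t => (q₂ t : ℝ) • ζ' (τ₂ t)) t := by
    intro t
    rcases le_or_gt (t : ℝ) (1 / 2) with ht | ht
    · refine le_trans (le_of_eq ?_) le_self_add
      simp only [speed, actionAt, μ₀, ν₀, ζ₀, if_pos ht, hq₂ t ht, NNReal.coe_zero, z1, z2,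
        add_zero]
    · refine le_trans (le_of_eq ?_) le_add_self
      simp only [speed, actionAt, μ₀, ν₀, ζ₀, if_neg (not_le.2 ht), hq₁ t ht, NNReal.coe_zero,
        z1, z2, zero_add]
  have hlen : ∫⁻ t, speed D δ μ₀ ν₀ ζ₀ t ≤
      (∫⁻ t, speed D δ μ ν ζ t) + ∫⁻ t, speed D δ μ' ν' ζ' t := by
    refine (lintegral_mono hspeed).trans ?_
    rw [lintegral_add_left c1.measurable_speed, h.lintegral_speed_timeChange h1,
      h'.lintegral_speed_timeChange h2]
    exact add_le_add (setLIntegral_le_lintegral _ _) (setLIntegral_le_lintegral _ _)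
  refine ⟨μ₀, ν₀, ζ₀, ⟨⟨hcont, hνm, hζm, hlen.trans_lt
    (ENNReal.add_lt_top.2 ⟨h.length_lt_top, h'.length_lt_top⟩)⟩, fun f hf s t hst => ?_⟩, ?_, ?_,
    hlen⟩
  · -- the first half contributes the mass of the first curve, the second half that of the second
    have hval : ∀ t, ∫ x : closure D, f x ∂(μ₀ t : Measure (closure D)) =
        (∫ x : closure D, f x ∂((μ ∘ τ₁) t : Measure (closure D))) +
          (∫ x : closure D, f x ∂((μ' ∘ τ₂) t : Measure (closure D))) -
          ∫ x : closure D, f x ∂(μ 1 : Measure (closure D)) := by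
      intro t
      simp only [μ₀, Function.comp_apply]
      rcases le_or_gt (t : ℝ) (1 / 2) with ht | ht
      · rw [if_pos ht, hτ₂ t ht, ← hmid]; ring
      · rw [if_neg (not_le.2 ht), hτ₁ t ht.le]; ring
    have hrate : ∀ r, rate ν₀ ζ₀ hf r =
        rate (fun t => (q₁ t : ℝ) • ν (τ₁ t)) (fun t => (q₁ t : ℝ) • ζ (τ₁ t)) hf r +
        rate (fun t => (q₂ t : ℝ) • ν' (τ₂ t)) (fun t => (q₂ t : ℝ) • ζ' (τ₂ t)) hf r := fun r => by
      simp only [rate, ν₀, ζ₀, pairing_add]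
      ring
    have b1 := c1.balance f hf s t hst
    have b2 := c2.balance f hf s t hst
    simp_rw [hrate]
    rw [integral_add (c1.integrable_rate hδ hf).integrableOn
      (c2.integrable_rate hδ hf).integrableOn, ← b1, ← b2, hval, hval]
    ring
  · have : ((0 : I) : ℝ) ≤ 1 / 2 := by norm_num
    simp only [μ₀, if_pos this, Function.comp_apply, hτ₁0]
  · have : ¬ ((1 : I) : ℝ) ≤ 1 / 2 := by norm_num
    simp only [μ₀, if_neg this, Function.comp_apply, hτ₂1]

end GeneralizedTransport

/-! ### Arclength, triangle inequality and constant speed -/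

namespace GeneralizedTransport

open Filter Topology NNReal

/-- Reparametrization proportionally to the arclength `v(t) dt`, regularized by `ε` in order to
have a strictly increasing arclength function. -/
lemma exists_arclength_timeChange {v : I → ℝ} (hv : Measurable v) (hvi : Integrable v)
    (hv0 : ∀ t, 0 ≤ v t) {ε : ℝ} (hε : 0 < ε) : ∃ (τ : I → I) (q : I → ℝ≥0),
      IsTimeChange τ q ∧ τ 0 = 0 ∧ τ 1 = 1 ∧
        ∀ t, q t = Real.toNNReal (((∫ r, v r) + ε) / (v (τ t) + ε)) := by
  let l : ℝ := (∫ r, v r) + ε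
  have hl : 0 < l := add_pos_of_nonneg_of_pos (integral_nonneg hv0) hε
  -- `c` is the normalized arclength, with derivative `p`; `τ` is its inverse function.
  let p : I → ℝ := fun t => (v t + ε) / l
  have hp0 : ∀ t, ε / l ≤ p t := fun t => by
    have := hv0 t
    simp only [p]; gcongr; linarith
  have hε' : 0 < ε / l := by positivity
  have hpp : ∀ t, 0 < p t := fun t => hε'.trans_le (hp0 t)
  have hpm : Measurable p := (hv.add_const ε).div_const l
  have hpi : Integrable p := (hvi.add (integrable_const ε)).div_const l
  let c : I → ℝ := fun t => ∫ r in Ioc 0 t, p r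
  have hc0 : c 0 = 0 := by simp [c]
  have hc1 : c 1 = 1 := by
    simp only [c, setIntegral_Ioc_zero_one, p]
    rw [integral_div, integral_add hvi (integrable_const ε)]
    simp only [integral_const, probReal_univ, one_smul]
    exact div_self hl.ne'
  have hcc : Continuous c := by
    have h1 : c = fun t : I => ∫ r in (0 : ℝ)..t, extendZero p r := by
      funext t
      have := setIntegral_Ioc_coe (extendZero p) (s := 0) (t := t) t.2.1
      simp_rw [extendZero_coe] at this
      exact this
    rw [h1]
    exact (intervalIntegral.continuous_primitive
      (fun a b => (integrable_extendZero hpi).intervalIntegrable) 0).comp continuous_subtype_val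
  have hmono : StrictMono c := fun s t hst => by
    have h1 : c t = c s + ∫ r in Ioc s t, p r := setIntegral_Ioc_add hpi s.2.1 hst.le
    have h2 : ∫ r in Ioc s t, (ε / l) ≤ ∫ r in Ioc s t, p r :=
      integral_mono (integrable_const _) hpi.integrableOn hp0
    rw [setIntegral_const, measureReal_def, unitInterval.volume_Ioc,
      ENNReal.toReal_ofReal (sub_nonneg.2 hst.le), smul_eq_mul] at h2
    have h3 : (0 : ℝ) < t - s := sub_pos.2 hst
    have := mul_pos h3 hε'
    linarith
  let S : I → I := fun t => ⟨c t, hc0 ▸ hmono.monotone (show (0 : I) ≤ t from t.2.1),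
    hc1 ▸ hmono.monotone (show t ≤ (1 : I) from t.2.2)⟩
  have hSc : Continuous S := hcc.subtype_mk _
  have hS0 : S 0 = 0 := Subtype.ext hc0
  have hS1 : S 1 = 1 := Subtype.ext hc1
  have hSm : StrictMono S := fun s t hst => hmono hst
  have hSs : Function.Surjective S := fun y => by
    obtain ⟨x, -, hx⟩ := intermediate_value_Icc (a := (0 : I)) (b := 1) zero_le_one
      hSc.continuousOn (show y ∈ Icc (S 0) (S 1) by rw [hS0, hS1]; exact ⟨y.2.1, y.2.2⟩)
    exact ⟨x, hx⟩
  have hSt : IsTimeChange S fun t => Real.toNNReal (p t) := by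
    refine IsTimeChange.of_setLIntegral hSc hSm.monotone hpm.real_toNNReal fun t => ?_
    have h1 := ofReal_integral_eq_lintegral_ofReal (μ := volume.restrict (Ioc 0 t)) (f := p)
      hpi.integrableOn (Eventually.of_forall fun t => (hpp t).le)
    rw [hS0, Icc.coe_zero, sub_zero]
    exact h1.symm
  have hmap := hSt.map_eq
  have hI : Icc (0 : I) 1 = univ := eq_univ_of_forall fun t => ⟨t.2.1, t.2.2⟩
  rw [hS0, hS1, hI, Measure.restrict_univ] at hmap
  let e : I ≃o I := StrictMono.orderIsoOfSurjective S hSm hSs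
  have hTS : ∀ t, e.symm (S t) = t := fun t => e.symm_apply_apply t
  have hTc : Continuous e.symm := e.symm.continuous
  have hT0 : e.symm 0 = 0 := by rw [← hS0, hTS, hS0]
  have hT1 : e.symm 1 = 1 := by rw [← hS1, hTS, hS1]
  have hq : Measurable fun t => Real.toNNReal (l / (v (e.symm t) + ε)) :=
    (measurable_const.div ((hv.comp hTc.measurable).add_const ε)).real_toNNReal
  refine ⟨e.symm, fun t => Real.toNNReal (l / (v (e.symm t) + ε)),
    IsTimeChange.of_setLIntegral hTc e.symm.monotone hq fun t => ?_, hT0, hT1, fun t => rfl⟩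
  have hset : S ⁻¹' Ioc 0 t = Ioc 0 (e.symm t) := by
    ext r
    have h1 : 0 < S r ↔ 0 < r := by
      have := hSm.lt_iff_lt (a := 0) (b := r)
      rwa [hS0] at this
    have h2 : S r ≤ t ↔ r ≤ e.symm t := (e.le_symm_apply (x := r) (y := t)).symm
    rw [mem_preimage, mem_Ioc, mem_Ioc, h1, h2]
  rw [hT0, Icc.coe_zero, sub_zero, ← hmap,
    setLIntegral_map measurableSet_Ioc hq.coe_nnreal_ennreal hSc.measurable, hset,
    setLIntegral_withDensity_eq_setLIntegral_mul _ hpm.real_toNNReal.coe_nnreal_ennreal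
      (show Measurable fun x => ((Real.toNNReal (l / (v (e.symm (S x)) + ε)) : ℝ≥0) : ℝ≥0∞) from
        hq.coe_nnreal_ennreal.comp hSc.measurable) measurableSet_Ioc]
  have h1 : ∀ r, ((fun t => (Real.toNNReal (p t) : ℝ≥0∞)) * fun t =>
      (Real.toNNReal (l / (v (e.symm (S t)) + ε)) : ℝ≥0∞)) r = 1 := fun r => by
    simp only [Pi.mul_apply, hTS]
    rw [← ENNReal.coe_mul, ← Real.toNNReal_mul (hpp r).le]
    have h2 : v r + ε ≠ 0 := by have := hv0 r; positivity
    have h3 : p r * (l / (v r + ε)) = 1 := by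
      simp only [p]; field_simp
    rw [h3, Real.toNNReal_one, ENNReal.coe_one]
  rw [lintegral_congr h1, setLIntegral_one, unitInterval.volume_Ioc, Icc.coe_zero, sub_zero]

variable {d : ℕ} {D : Set (Space d)} {δ : ℝ}
  {μ : I → FiniteMeasure (closure D)} {ν : I → VectorMeasure (closure D) (Space d)}
  {ζ : I → SignedMeasure (closure D)}

lemma W_le_of_connects {a b : FiniteMeasure (closure D)} (h : Connects D a b μ ν ζ) :
    W D δ a b ≤ (∫⁻ t : I, actionAt D δ μ ν ζ t) ^ (1 / 2 : ℝ) :=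
  iInf_le_of_le μ (iInf_le_of_le ν (iInf_le_of_le ζ (iInf_le_of_le h le_rfl)))

lemma actionAt_eq_speed_sq (t : I) : actionAt D δ μ ν ζ t = speed D δ μ ν ζ t ^ 2 := by
  rw [speed, ← ENNReal.rpow_natCast, ← ENNReal.rpow_mul]
  norm_num

variable [CompactSpace (closure D)] [IsFiniteMeasure (lebesgue D)]

/-- The length of a curve is at most the square root of its action. -/
lemma lintegral_speed_le (hμ : Continuous μ)
    (hν : ∀ B, MeasurableSet B → Measurable fun t => ν t B)
    (hζ : ∀ B, MeasurableSet B → Measurable fun t => ζ t B) :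
    ∫⁻ t, speed D δ μ ν ζ t ≤ (∫⁻ t, actionAt D δ μ ν ζ t) ^ (1 / 2 : ℝ) := by
  have hm : Measurable (speed D δ μ ν ζ) := (measurable_actionAt hμ hν hζ).pow_const _
  have h := ENNReal.lintegral_mul_le_Lp_mul_Lq volume Real.HolderConjugate.two_two
    hm.aemeasurable (measurable_const (a := (1 : ℝ≥0∞))).aemeasurable
  simp only [Pi.mul_apply, mul_one, ENNReal.one_rpow, lintegral_one, measure_univ] at h
  simp_rw [actionAt_eq_speed_sq]
  exact_mod_cast h

/-- A curve can be reparametrized so that its speed nowhere exceeds its length, up to `ε`. -/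
lemma IsFiniteLengthCurve.exists_speed_le (h : IsFiniteLengthCurve D δ μ ν ζ) {ε : ℝ}
    (hε : 0 < ε) : ∃ (μ' : I → FiniteMeasure (closure D))
      (ν' : I → VectorMeasure (closure D) (Space d)) (ζ' : I → SignedMeasure (closure D)),
      IsFiniteLengthCurve D δ μ' ν' ζ' ∧ μ' 0 = μ 0 ∧ μ' 1 = μ 1 ∧
        ∀ᵐ t, speed D δ μ' ν' ζ' t ≤ ENNReal.ofReal ((∫⁻ t, speed D δ μ ν ζ t).toReal + ε) := by
  rw [← integral_toReal h.measurable_speed.aemeasurable h.ae_speed_lt_top]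
  obtain ⟨τ, q, hτ, h0, h1, hq⟩ := exists_arclength_timeChange h.measurable_speed.ennreal_toReal
    h.integrable_speed (fun t => ENNReal.toReal_nonneg) hε
  have c := h.timeChange hτ
  refine ⟨_, _, _, c, by rw [Function.comp_apply, h0], by rw [Function.comp_apply, h1], ?_⟩
  filter_upwards [c.ae_speed_lt_top] with t ht
  rw [speed_timeChange] at ht ⊢
  have hden : 0 < (speed D δ μ ν ζ (τ t)).toReal + ε :=
    add_pos_of_nonneg_of_pos ENNReal.toReal_nonneg hε
  have hnum : 0 < (∫ r, (speed D δ μ ν ζ r).toReal) + (ε : ℝ) :=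
    add_pos_of_nonneg_of_pos (integral_nonneg fun _ => ENNReal.toReal_nonneg)
      hε
  have hq0 : (q t : ℝ≥0∞) ≠ 0 := by
    rw [hq t]
    exact ENNReal.coe_ne_zero.2 (Real.toNNReal_pos.2 (div_pos hnum hden)).ne'
  have hfin : speed D δ μ ν ζ (τ t) ≠ ⊤ := fun hcon => by
    rw [hcon, ENNReal.mul_top hq0] at ht
    exact lt_irrefl _ ht
  rw [← ENNReal.ofReal_toReal hfin, hq t]
  rw [← ENNReal.ofReal, ← ENNReal.ofReal_mul (div_pos hnum hden).le]
  refine ENNReal.ofReal_le_ofReal ?_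
  rw [div_mul_eq_mul_div, div_le_iff₀ hden]
  refine mul_le_mul_of_nonneg_left ?_ hnum.le
  linarith

omit [CompactSpace (closure D)] [IsFiniteMeasure (lebesgue D)] in
lemma lintegral_actionAt_le {r : ℝ≥0∞} (h : ∀ᵐ t, speed D δ μ ν ζ t ≤ r) :
    ∫⁻ t, actionAt D δ μ ν ζ t ≤ r ^ 2 := by
  simp_rw [actionAt_eq_speed_sq]
  refine (lintegral_mono_ae (g := fun _ => r ^ 2) ?_).trans (by simp)
  filter_upwards [h] with t ht
  gcongr

/-- The distance of the end points of a curve is at most its length. -/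
lemma IsFiniteLengthCurve.W_le_lintegral_speed (hδ : 0 < δ) (h : IsFiniteLengthCurve D δ μ ν ζ) :
    W D δ (μ 0) (μ 1) ≤ ∫⁻ t, speed D δ μ ν ζ t := by
  refine ENNReal.le_of_forall_pos_le_add fun ε hε _ => ?_
  obtain ⟨μ', ν', ζ', c, h0, h1, hle⟩ := h.exists_speed_le (NNReal.coe_pos.2 hε)
  rw [ENNReal.ofReal_add ENNReal.toReal_nonneg ε.coe_nonneg, ENNReal.ofReal_coe_nnreal,
    ENNReal.ofReal_toReal h.length_lt_top.ne] at hle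
  refine (W_le_of_connects ⟨c.continuityEquation hδ, h0, h1⟩).trans ?_
  refine (ENNReal.rpow_le_rpow (lintegral_actionAt_le hle) one_half_pos.le).trans ?_
  rw [← ENNReal.rpow_natCast, ← ENNReal.rpow_mul]
  norm_num

lemma IsFiniteLengthCurve.W_le_setLIntegral_speed (hδ : 0 < δ)
    (h : IsFiniteLengthCurve D δ μ ν ζ) {s t : I} (hst : s ≤ t) :
    W D δ (μ s) (μ t) ≤ ∫⁻ r in Icc s t, speed D δ μ ν ζ r := by
  obtain ⟨τ, q, hτ, h0, h1⟩ := exists_affine_timeChange hst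
  have := (h.timeChange hτ).W_le_lintegral_speed hδ
  rwa [h.lintegral_speed_timeChange hτ, Function.comp_apply, Function.comp_apply, h0, h1] at this

lemma exists_curve_of_W_lt (hδ : 0 < δ) (hD : Bornology.IsBounded D)
    {a b : FiniteMeasure (closure D)} {r : ℝ≥0∞} (h : W D δ a b < r) :
    ∃ (μ : I → FiniteMeasure (closure D)) (ν : I → VectorMeasure (closure D) (Space d))
      (ζ : I → SignedMeasure (closure D)), IsFiniteLengthCurve D δ μ ν ζ ∧ μ 0 = a ∧ μ 1 = b ∧
        ∫⁻ t, speed D δ μ ν ζ t < r := by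
  simp only [W, iInf_lt_iff] at h
  obtain ⟨μ, ν, ζ, hc, h⟩ := h
  have h1 := (lintegral_speed_le (δ := δ) hc.continuityEquation.continuous_mass
    hc.continuityEquation.measurable_momentum hc.continuityEquation.measurable_source).trans_lt h
  exact ⟨μ, ν, ζ, .of_continuityEquation hδ hD hc.continuityEquation (h1.trans_le le_top),
    hc.initial, hc.final, h1⟩

/-- Almost optimal curves can be parametrized so that their speed is almost everywhere bounded. -/
lemma exists_curve_speed_le (hδ : 0 < δ) (hD : Bornology.IsBounded D)
    {a b : FiniteMeasure (closure D)} {r : ℝ} (h : W D δ a b < ENNReal.ofReal r) :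
    ∃ (μ : I → FiniteMeasure (closure D)) (ν : I → VectorMeasure (closure D) (Space d))
      (ζ : I → SignedMeasure (closure D)), IsFiniteLengthCurve D δ μ ν ζ ∧ μ 0 = a ∧ μ 1 = b ∧
        ∀ᵐ t, speed D δ μ ν ζ t ≤ ENNReal.ofReal r := by
  obtain ⟨μ, ν, ζ, hc, h0, h1, hl⟩ := exists_curve_of_W_lt hδ hD h
  obtain ⟨μ', ν', ζ', hc', h0', h1', hle⟩ :=
    hc.exists_speed_le (sub_pos.2 ((ENNReal.lt_ofReal_iff_toReal_lt hl.ne_top).1 hl))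
  rw [add_sub_cancel] at hle
  exact ⟨μ', ν', ζ', hc', h0'.trans h0, h1'.trans h1, hle⟩

/-- Concatenate almost optimal curves. -/
lemma W_triangle (hδ : 0 < δ) (hD : Bornology.IsBounded D) (a b c : FiniteMeasure (closure D)) :
    W D δ a c ≤ W D δ a b + W D δ b c := by
  refine ENNReal.le_of_forall_pos_le_add fun ε hε hfin => ?_
  obtain ⟨h1, h2⟩ := ENNReal.add_lt_top.1 hfin
  have hε2 : (ε : ℝ≥0∞) / 2 ≠ 0 := by
    rw [Ne, ENNReal.div_eq_zero_iff, not_or]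
    exact ⟨ENNReal.coe_ne_zero.2 hε.ne', by simp⟩
  obtain ⟨μ, ν, ζ, h, h0, hm, hl⟩ :=
    exists_curve_of_W_lt hδ hD (ENNReal.lt_add_right h1.ne hε2)
  obtain ⟨μ', ν', ζ', h', hm', h1', hl'⟩ :=
    exists_curve_of_W_lt hδ hD (ENNReal.lt_add_right h2.ne hε2)
  obtain ⟨μ₀, ν₀, ζ₀, hc, hc0, hc1, hcl⟩ := h.exists_concat hδ h' (hm.trans hm'.symm)
  have h3 := hc.W_le_lintegral_speed hδ
  rw [hc0, hc1, h0, h1'] at h3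
  refine h3.trans (hcl.trans ((add_le_add hl.le hl'.le).trans_eq ?_))
  rw [add_add_add_comm, ENNReal.add_halves]

lemma W_symm_le (hδ : 0 < δ) (hD : Bornology.IsBounded D) (a b : FiniteMeasure (closure D)) :
    W D δ a b ≤ W D δ b a := by
  refine le_of_forall_gt fun r hr => ?_
  obtain ⟨μ, ν, ζ, h, h0, h1, hl⟩ := exists_curve_of_W_lt hδ hD hr
  have h2 := h.reverse.W_le_lintegral_speed hδ
  rw [unitInterval.symm_zero, unitInterval.symm_one, h0, h1, h.lintegral_speed_reverse] at h2
  exact h2.trans_lt hl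

lemma W_comm (hδ : 0 < δ) (hD : Bornology.IsBounded D) (a b : FiniteMeasure (closure D)) :
    W D δ a b = W D δ b a :=
  le_antisymm (W_symm_le hδ hD a b) (W_symm_le hδ hD b a)

/-- The distance is the infimum of the lengths of the connecting curves. -/
lemma W_eq_iInf_length (hδ : 0 < δ) (hD : Bornology.IsBounded D)
    (a b : FiniteMeasure (closure D)) :
    W D δ a b = ⨅ (μ : I → FiniteMeasure (closure D))
        (ν : I → VectorMeasure (closure D) (Space d)) (ζ : I → SignedMeasure (closure D))
        (_ : Connects D a b μ ν ζ), ∫⁻ t : I, actionAt D δ μ ν ζ t ^ (1 / 2 : ℝ) := by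
  -- `≤` is reparametrization by arclength, `≥` is the Cauchy-Schwarz inequality.
  refine le_antisymm (le_iInf fun μ => le_iInf fun ν => le_iInf fun ζ => le_iInf fun h => ?_)
    (iInf_mono fun μ => iInf_mono fun ν => iInf_mono fun ζ => iInf_mono fun h =>
      lintegral_speed_le h.continuityEquation.continuous_mass
        h.continuityEquation.measurable_momentum h.continuityEquation.measurable_source)
  rcases eq_or_ne (∫⁻ t : I, speed D δ μ ν ζ t) ⊤ with htop | htop
  · exact le_top.trans_eq htop.symm
  · have h1 := (IsFiniteLengthCurve.of_continuityEquation hδ hD h.continuityEquation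
      htop.lt_top).W_le_lintegral_speed hδ
    rwa [h.initial, h.final] at h1

/-- A minimizer has constant speed. -/
lemma IsMinimizer.speed_ae_eq (hδ : 0 < δ) (hD : Bornology.IsBounded D)
    {a b : FiniteMeasure (closure D)} (hW : W D δ a b < ⊤) (h : IsMinimizer D δ a b μ ν ζ) :
    IsFiniteLengthCurve D δ μ ν ζ ∧ ∀ᵐ t, speed D δ μ ν ζ t = W D δ a b := by
  obtain ⟨hc, hmin⟩ := h
  have hle := lintegral_speed_le (δ := δ) hc.continuityEquation.continuous_mass
    hc.continuityEquation.measurable_momentum hc.continuityEquation.measurable_source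
  rw [hmin] at hle
  have hcurve := IsFiniteLengthCurve.of_continuityEquation hδ hD hc.continuityEquation
    (hle.trans_lt hW)
  refine ⟨hcurve, ?_⟩
  have hge := hcurve.W_le_lintegral_speed hδ
  rw [hc.initial, hc.final] at hge
  have heq : ∫⁻ t, speed D δ μ ν ζ t = W D δ a b := le_antisymm hle hge
  let w : ℝ := (W D δ a b).toReal
  let v : I → ℝ := fun t => (speed D δ μ ν ζ t).toReal
  have hv1 : ∫ t, v t = w := by
    rw [integral_toReal hcurve.measurable_speed.aemeasurable hcurve.ae_speed_lt_top, heq]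
  have hact : ∫⁻ t, actionAt D δ μ ν ζ t = W D δ a b ^ 2 := by
    rw [← hmin, ← ENNReal.rpow_natCast, ← ENNReal.rpow_mul]
    norm_num
  have hactm := measurable_actionAt (δ := δ) (D := D) hcurve.continuous_mass
    hcurve.measurable_momentum hcurve.measurable_source
  have hactf : ∫⁻ t, actionAt D δ μ ν ζ t ≠ ⊤ := hact ▸ ENNReal.pow_ne_top hW.ne
  have hv2i : Integrable fun t => v t ^ 2 := by
    have := integrable_toReal_of_lintegral_ne_top hactm.aemeasurable hactf
    simp_rw [HasFiniteLength.toReal_actionAt] at this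
    exact this
  have hv2 : ∫ t, v t ^ 2 = w ^ 2 := by
    have := integral_toReal hactm.aemeasurable (ae_lt_top hactm hactf)
    simp_rw [HasFiniteLength.toReal_actionAt] at this
    rw [this, hact, ENNReal.toReal_pow]
  have hvi : Integrable v := hcurve.integrable_speed
  -- equality in the Cauchy-Schwarz inequality
  have hvar : ∫ t, (v t - w) ^ 2 = 0 := by
    have e : ∀ t, (v t - w) ^ 2 = v t ^ 2 - 2 * w * v t + w ^ 2 := fun t => by ring
    have i1 : Integrable fun t => v t ^ 2 - 2 * w * v t := hv2i.sub (hvi.const_mul _)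
    simp_rw [e]
    rw [integral_add i1 (integrable_const _), integral_sub hv2i (hvi.const_mul _),
      integral_const_mul, hv1, hv2]
    simp
    ring
  have hvari : Integrable fun t => (v t - w) ^ 2 := by
    have e : (fun t => (v t - w) ^ 2) = fun t => v t ^ 2 - 2 * w * v t + w ^ 2 :=
      funext fun t => by ring
    rw [e]
    exact (hv2i.sub (hvi.const_mul _)).add (integrable_const _)
  have h0 := (integral_eq_zero_iff_of_nonneg (fun t => sq_nonneg (v t - w)) hvari).1 hvar
  filter_upwards [h0, hcurve.ae_speed_lt_top] with t ht ht'
  have h1 : v t = w := by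
    have : (v t - w) ^ 2 = 0 := ht
    exact sub_eq_zero.1 (pow_eq_zero_iff two_ne_zero |>.1 this)
  rw [← ENNReal.ofReal_toReal ht'.ne, ← ENNReal.ofReal_toReal hW.ne]
  exact congrArg ENNReal.ofReal h1

/-- Minimizers are constant speed geodesics: constancy of the speed gives `≤` for each pair of times,
and the triangle inequality along `0 ≤ s ≤ t ≤ 1` forces equality. -/
lemma IsMinimizer.W_eq (hδ : 0 < δ) (hD : Bornology.IsBounded D)
    {a b : FiniteMeasure (closure D)} (hW : W D δ a b < ⊤) (h : IsMinimizer D δ a b μ ν ζ)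
    (s t : I) : W D δ (μ s) (μ t) = ENNReal.ofReal |(s : ℝ) - t| * W D δ a b := by
  wlog hst : s ≤ t generalizing s t
  · rw [W_comm hδ hD, abs_sub_comm]
    exact this t s (le_of_not_ge hst)
  obtain ⟨hcurve, hspeed⟩ := h.speed_ae_eq hδ hD hW
  have hle : ∀ s t : I, s ≤ t → W D δ (μ s) (μ t) ≤ ENNReal.ofReal ((t : ℝ) - s) * W D δ a b := by
    intro s t hst
    refine (hcurve.W_le_setLIntegral_speed hδ hst).trans_eq ?_
    rw [lintegral_congr_ae (ae_restrict_of_ae hspeed), setLIntegral_const,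
      unitInterval.volume_Icc, mul_comm]
  have hst' : (0 : ℝ) ≤ t - s := sub_nonneg.2 hst
  rw [abs_sub_comm, abs_of_nonneg hst']
  refine le_antisymm (hle s t hst) ?_
  have h1 : W D δ a b ≤ ENNReal.ofReal (s : ℝ) * W D δ a b +
      (W D δ (μ s) (μ t) + ENNReal.ofReal (1 - t) * W D δ a b) := by
    have h2 := hle 0 s s.2.1
    have h3 := hle t 1 t.2.2
    rw [Icc.coe_zero, sub_zero] at h2
    rw [Icc.coe_one] at h3
    calc W D δ a b = W D δ (μ 0) (μ 1) := by rw [h.1.initial, h.1.final]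
      _ ≤ W D δ (μ 0) (μ s) + W D δ (μ s) (μ 1) := W_triangle hδ hD _ _ _
      _ ≤ W D δ (μ 0) (μ s) + (W D δ (μ s) (μ t) + W D δ (μ t) (μ 1)) := by
        gcongr; exact W_triangle hδ hD _ _ _
      _ ≤ _ := by gcongr
  have hfin : W D δ (μ s) (μ t) ≠ ⊤ :=
    ((hle s t hst).trans_lt (ENNReal.mul_lt_top ENNReal.ofReal_lt_top hW)).ne
  lift W D δ a b to ℝ≥0 using hW.ne with w
  lift W D δ (μ s) (μ t) to ℝ≥0 using hfin with u
  have hs := s.2.1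
  have ht : (0 : ℝ) ≤ 1 - t := sub_nonneg.2 t.2.2
  simp only [ENNReal.ofReal] at h1 ⊢
  norm_cast at h1 ⊢
  rw [← NNReal.coe_le_coe] at h1 ⊢
  push_cast [Real.coe_toNNReal _ hs, Real.coe_toNNReal _ ht, Real.coe_toNNReal _ hst'] at h1 ⊢
  linarith

end GeneralizedTransport

/-! ### Weak compactness of momenta and sources -/

namespace GeneralizedTransport

open Filter Topology NNReal ProbabilityTheory

section SpaceTime

variable {X : Type*} [MetricSpace X] [CompactSpace X] [MeasurableSpace X] [BorelSpace X]
  {E : Type*} [NormedAddCommGroup E] [InnerProductSpace ℝ E] [FiniteDimensional ℝ E]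
  {m : I → FiniteMeasure X} {ν : I → VectorMeasure X E}

omit [CompactSpace X] in
/-- The measure of a closed set is a limit of integrals of continuous functions. -/
lemma measurable_coe_of_continuous (hm : Continuous m) :
    Measurable fun t => (m t : Measure X) := by
  have key : ∀ s : Set X, IsClosed s → Measurable fun t => (m t : Measure X) s := fun s hs => by
    refine measurable_of_tendsto_metrizable (f := fun n t => ∫⁻ x, hs.apprSeq n x ∂(m t : Measure X))
      (fun n => ?_) (tendsto_pi_nhds.2 fun t =>
        HasOuterApproxClosed.tendsto_lintegral_apprSeq hs _)
    have h1 : Continuous fun t => (m t).testAgainstNN (hs.apprSeq n) :=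
      (FiniteMeasure.continuous_testAgainstNN_eval _).comp hm
    have h2 : (fun t => ∫⁻ x, hs.apprSeq n x ∂(m t : Measure X)) =
        fun t => ((m t).testAgainstNN (hs.apprSeq n) : ℝ≥0∞) :=
      funext fun t => FiniteMeasure.testAgainstNN_coe_eq.symm
    rw [h2]
    exact (ENNReal.continuous_coe.comp h1).measurable
  refine Measurable.measure_of_isPiSystem (S := {s | IsClosed s}) ?_ isPiSystem_isClosed key
    (key _ isClosed_univ)
  rw [← borel_eq_generateFrom_isClosed]
  exact BorelSpace.measurable_eq

/-- A weak-* continuous curve of measures, as a transition kernel. -/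
noncomputable def massKernel (hm : Continuous m) : Kernel I X :=
  ⟨fun t => (m t : Measure X), measurable_coe_of_continuous hm⟩

instance (hm : Continuous m) : IsFiniteKernel (massKernel hm) := by
  have h1 : Continuous fun t => ((m t).mass : ℝ≥0) := FiniteMeasure.continuous_mass.comp hm
  obtain ⟨M, hM⟩ := (isCompact_range h1).bddAbove
  refine ⟨M, ENNReal.coe_lt_top, fun t => ?_⟩
  change (m t : Measure X) univ ≤ M
  rw [← FiniteMeasure.ennreal_mass]
  exact ENNReal.coe_le_coe.2 (hM (mem_range_self t))

omit [MeasurableSpace X] [BorelSpace X] [InnerProductSpace ℝ E] [FiniteDimensional ℝ E] in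
lemma continuous_normSq {b : I → C(X, E)} (hb : Continuous b) :
    Continuous fun t => normSq (b t) := by
  refine ContinuousMap.continuous_of_continuous_uncurry _ ?_
  change Continuous fun p : I × X => ‖b p.1 p.2‖ ^ 2
  fun_prop

lemma integrable_integral_pair (hm : Continuous m) {a : I → C(X, ℝ)} (ha : Continuous a) :
    Integrable fun t => ∫ x, a t x ∂(m t : Measure X) := by
  have : Continuous fun t => ∫ x, a t x ∂(m t : Measure X) :=
    continuous_integral_pair.comp (ha.prodMk hm)
  exact this.integrable_of_hasCompactSupport (HasCompactSupport.of_compactSpace _)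

variable [MeasurableSpace E] [BorelSpace E]

lemma measurable_energy_of_continuous (hm : Continuous m)
    (hν : ∀ B, MeasurableSet B → Measurable fun t => ν t B) :
    Measurable fun t => energy (m t : Measure X) (ν t) :=
  measurable_energy (fun f => ((continuous_integral_left f).comp hm).measurable) hν

lemma integrable_pairing_of_energy (hm : Continuous m)
    (hν : ∀ B, MeasurableSet B → Measurable fun t => ν t B)
    (he : ∫⁻ t, energy (m t : Measure X) (ν t) ≠ ⊤) {b : I → C(X, E)} (hb : Continuous b) :
    Integrable fun t => pairing (ν t) (b t) := by
  have hem := measurable_energy_of_continuous hm hν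
  have i1 : Integrable fun t => ∫ x, ‖b t x‖ ^ 2 ∂(m t : Measure X) :=
    integrable_integral_pair hm (continuous_normSq hb)
  have i2 : Integrable fun t => (energy (m t : Measure X) (ν t)).toReal :=
    integrable_toReal_of_lintegral_ne_top hem.aemeasurable he
  refine (i1.add i2).mono (measurable_pairing_of_continuous hν hb).aestronglyMeasurable ?_
  filter_upwards [ae_lt_top hem he] with t ht
  have h1 := two_mul_pairing_sub_le ht (b t)
  have h2 := two_mul_pairing_sub_le ht (-b t)
  have h3 : ∫ x, ‖(-b t) x‖ ^ 2 ∂(m t : Measure X) = ∫ x, ‖b t x‖ ^ 2 ∂(m t : Measure X) := by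
    simp
  rw [map_neg, h3] at h2
  have h4 : 0 ≤ ∫ x, ‖b t x‖ ^ 2 ∂(m t : Measure X) := integral_nonneg fun x => sq_nonneg _
  have h5 : 0 ≤ (energy (m t : Measure X) (ν t)).toReal := ENNReal.toReal_nonneg
  rw [Real.norm_eq_abs, Real.norm_eq_abs]
  refine le_trans ?_ (le_abs_self _)
  rw [Pi.add_apply]
  exact abs_le.2 ⟨by linarith, by linarith⟩

/-- The dual inequality between pairing and energy, integrated in time. Both sides pass to the limit
along convergent curves, which is what makes the energy lower semicontinuous. -/
lemma two_mul_integral_pairing_sub_le (hm : Continuous m)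
    (hν : ∀ B, MeasurableSet B → Measurable fun t => ν t B)
    (he : ∫⁻ t, energy (m t : Measure X) (ν t) ≠ ⊤) {b : I → C(X, E)} (hb : Continuous b) (c : ℝ) :
    2 * (c * ∫ t, pairing (ν t) (b t)) - c ^ 2 * ∫ t, ∫ x, ‖b t x‖ ^ 2 ∂(m t : Measure X) ≤
      (∫⁻ t, energy (m t : Measure X) (ν t)).toReal := by
  have hem := measurable_energy_of_continuous hm hν
  have i0 := integrable_pairing_of_energy hm hν he hb
  have i1 : Integrable fun t => ∫ x, ‖b t x‖ ^ 2 ∂(m t : Measure X) :=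
    integrable_integral_pair hm (continuous_normSq hb)
  have i2 : Integrable fun t => (energy (m t : Measure X) (ν t)).toReal :=
    integrable_toReal_of_lintegral_ne_top hem.aemeasurable he
  rw [← integral_toReal hem.aemeasurable (ae_lt_top hem he), ← integral_const_mul,
    ← integral_const_mul, ← integral_const_mul,
    ← integral_sub ((i0.const_mul c).const_mul 2) (i1.const_mul _)]
  refine integral_mono_ae (((i0.const_mul c).const_mul 2).sub (i1.const_mul _)) i2 ?_
  filter_upwards [ae_lt_top hem he] with t ht
  have h1 := two_mul_pairing_sub_le ht (c • b t)
  rw [map_smul, smul_eq_mul, integral_norm_smul_sq] at h1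
  exact h1

/-- Weak compactness of momenta with bounded energy. If curves of measures converge (in the sense
of space-time measures) along an ultrafilter, momenta with converging energies converge to a
momentum whose energy does not exceed the limit. The limit is the density, with respect to the
limiting space-time measure, of the limit functional. -/
lemma exists_limit_momentum {U : Ultrafilter ℕ} {m : ℕ → I → FiniteMeasure X}
    (hm : ∀ n, Continuous (m n)) {μ : I → FiniteMeasure X} (hμ : Continuous μ)
    (hconv : ∀ a : C(I × X, ℝ), Tendsto (fun n => ∫ t, ∫ x, a (t, x) ∂(m n t : Measure X)) U
      (𝓝 (∫ t, ∫ x, a (t, x) ∂(μ t : Measure X))))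
    {ν : ℕ → I → VectorMeasure X E} (hν : ∀ n B, MeasurableSet B → Measurable fun t => ν n t B)
    {α : ℝ} (he : ∀ n, ∫⁻ t, energy (m n t : Measure X) (ν n t) ≠ ⊤)
    (hα : Tendsto (fun n => (∫⁻ t, energy (m n t : Measure X) (ν n t)).toReal) U (𝓝 α)) :
    ∃ ν' : I → VectorMeasure X E, (∀ B, MeasurableSet B → Measurable fun t => ν' t B) ∧
      ∫⁻ t, energy (μ t : Measure X) (ν' t) ≤ ENNReal.ofReal α ∧
      ∀ b : C(I × X, E), Tendsto (fun n => ∫ t, pairing (ν n t) (b.curry t)) U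
        (𝓝 (∫ t, pairing (ν' t) (b.curry t))) := by
  have hα0 : 0 ≤ α := ge_of_tendsto' hα fun n => ENNReal.toReal_nonneg
  have hineq := fun n (b : C(I × X, E)) c =>
    two_mul_integral_pairing_sub_le (hm n) (hν n) (he n) b.curry.continuous c
  have hsq : ∀ b : C(I × X, E), Tendsto
      (fun n => ∫ t, ∫ x, ‖b.curry t x‖ ^ 2 ∂(m n t : Measure X)) U
      (𝓝 (∫ t, ∫ x, ‖b.curry t x‖ ^ 2 ∂(μ t : Measure X))) := fun b => hconv (normSq b)
  have hlim : ∀ b : C(I × X, E), ∃ l : ℝ,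
      Tendsto (fun n => ∫ t, pairing (ν n t) (b.curry t)) U (𝓝 l) := fun b => by
    obtain ⟨C, hC⟩ : ∃ C, ∀ᶠ n in (U : Filter ℕ),
        (∫ t, ∫ x, ‖b.curry t x‖ ^ 2 ∂(m n t : Measure X)) +
          (∫⁻ t, energy (m n t : Measure X) (ν n t)).toReal ≤ C :=
      ⟨_, ((hsq b).add hα).eventually_le_const (lt_add_one _)⟩
    have hmem : ∀ᶠ n in (U : Filter ℕ),
        ∫ t, pairing (ν n t) (b.curry t) ∈ Icc (-(C / 2)) (C / 2) := by
      filter_upwards [hC] with n hn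
      have h1 := hineq n b 1
      have h2 := hineq n b (-1)
      constructor <;> linarith
    obtain ⟨l, -, hl⟩ := isCompact_Icc.ultrafilter_le_nhds
      (U.map fun n => ∫ t, pairing (ν n t) (b.curry t)) (le_principal_iff.2 hmem)
    exact ⟨l, hl⟩
  choose L hL using hlim
  let Λ : C(I × X, E) →ₗ[ℝ] ℝ :=
    { toFun := L
      map_add' := fun b₁ b₂ => by
        refine tendsto_nhds_unique (hL (b₁ + b₂)) (((hL b₁).add (hL b₂)).congr fun n => ?_)
        rw [← integral_add
          (integrable_pairing_of_energy (hm n) (hν n) (he n) b₁.curry.continuous)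
          (integrable_pairing_of_energy (hm n) (hν n) (he n) b₂.curry.continuous)]
        refine integral_congr_ae (Eventually.of_forall fun t => ?_)
        exact (map_add (pairing (ν n t)) (b₁.curry t) (b₂.curry t)).symm
      map_smul' := fun c b => by
        refine tendsto_nhds_unique (hL (c • b)) (((hL b).const_mul c).congr fun n => ?_)
        rw [← integral_const_mul]
        refine integral_congr_ae (Eventually.of_forall fun t => ?_)
        exact (map_smul (pairing (ν n t)) c (b.curry t)).symm }
  -- The limit functional `Λ` is represented by a density in `L²` of the space-time measure `μ_t dt`.
  let κ : Kernel I X := massKernel hμ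
  let Q : Measure (I × X) := (volume : Measure I) ⊗ₘ κ
  have hQ : ∀ g : C(I × X, ℝ), ∫ p, g p ∂Q = ∫ t, ∫ x, g (t, x) ∂(μ t : Measure X) := fun g =>
    Measure.integral_compProd (integrable_continuousMap Q g)
  obtain ⟨v, hvm, hv2, hvL, hvle⟩ := exists_density_of_sq_le Q Λ hα0 fun b => by
    refine sq_le_of_forall_two_mul_sub_le fun c => ?_
    have h1 : ∫ p, ‖b p‖ ^ 2 ∂Q = ∫ t, ∫ x, ‖b.curry t x‖ ^ 2 ∂(μ t : Measure X) := hQ (normSq b)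
    rw [h1]
    exact le_of_tendsto_of_tendsto' (((hL b).const_mul c |>.const_mul 2).sub
      ((hsq b).const_mul (c ^ 2))) hα fun n => hineq n b c
  have hvt : ∀ t, StronglyMeasurable fun x => v (t, x) := fun t =>
    hvm.comp_measurable measurable_prodMk_left
  have hlint : ∫⁻ t, ∫⁻ x, ‖v (t, x)‖ₑ ^ 2 ∂(μ t : Measure X) = ∫⁻ p, ‖v p‖ₑ ^ 2 ∂Q :=
    (Measure.lintegral_compProd (μ := (volume : Measure I)) (κ := κ) (hvm.enorm.pow_const 2)).symm
  have hmeas : Measurable fun t => ∫⁻ x, ‖v (t, x)‖ₑ ^ 2 ∂(μ t : Measure X) :=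
    Measurable.lintegral_kernel_prod_right' (κ := κ) (hvm.enorm.pow_const 2)
  have hae : ∀ᵐ t, MemLp (fun x => v (t, x)) 2 (μ t : Measure X) := by
    filter_upwards [ae_lt_top hmeas ((hlint.trans_le hvle).trans_lt ENNReal.ofReal_lt_top).ne]
      with t ht
    exact (memLp_two_iff_lintegral (hvt t).aestronglyMeasurable).2 ht
  refine ⟨fun t => (μ t : Measure X).withDensityᵥ fun x => v (t, x), fun B hB => ?_, ?_,
    fun b => ?_⟩
  · have h1 : MeasurableSet {t | Integrable (fun x => v (t, x)) (κ t)} :=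
      measurableSet_kernel_integrable hvm
    have h2 : Measurable fun t => ∫ x, B.indicator (fun x => v (t, x)) x ∂(κ t) :=
      (StronglyMeasurable.integral_kernel_prod_right' (κ := κ)
        (f := fun p => (Prod.snd ⁻¹' B).indicator v p)
        (hvm.indicator (measurable_snd hB))).measurable
    have h3 : (fun t => ((μ t : Measure X).withDensityᵥ fun x => v (t, x)) B) =
        {t | Integrable (fun x => v (t, x)) (κ t)}.indicator
          fun t => ∫ x, B.indicator (fun x => v (t, x)) x ∂(κ t) := by
      funext t
      by_cases ht : Integrable (fun x => v (t, x)) (κ t)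
      · rw [indicator_of_mem (show t ∈ {t | Integrable (fun x => v (t, x)) (κ t)} from ht),
          integral_indicator hB]
        exact withDensityᵥ_apply ht hB
      · rw [indicator_of_notMem (show t ∉ {t | Integrable (fun x => v (t, x)) (κ t)} from ht)]
        have h4 : (μ t : Measure X).withDensityᵥ (fun x => v (t, x)) = 0 := dif_neg ht
        rw [h4, FunLike.coe_zero, Pi.zero_apply]
    rw [h3]
    exact h2.indicator h1
  · refine le_trans (lintegral_mono fun t => ?_) (hlint.trans_le hvle)
    rcases eq_or_ne (∫⁻ x, ‖v (t, x)‖ₑ ^ 2 ∂(μ t : Measure X)) ⊤ with h | h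
    · rw [h]; exact le_top
    · exact (energy_withDensityᵥ ((memLp_two_iff_lintegral
        (hvt t).aestronglyMeasurable).2 h.lt_top)).le
  · have h1 : Integrable (fun p => (inner ℝ (b p) (v p) : ℝ)) Q := by
      refine ((hv2.integrable one_le_two).norm.const_mul ‖b‖).mono'
        ((stronglyMeasurable_continuousMap b).inner hvm).aestronglyMeasurable
        (Eventually.of_forall fun p => (norm_inner_le_norm _ _).trans ?_)
      gcongr
      exact b.norm_coe_le_norm p
    have h2 : L b = ∫ t, ∫ x, (inner ℝ (b (t, x)) (v (t, x)) : ℝ) ∂(μ t : Measure X) :=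
      (hvL b).trans (Measure.integral_compProd h1)
    have h3 : ∫ t, pairing ((μ t : Measure X).withDensityᵥ fun x => v (t, x)) (b.curry t) = L b := by
      rw [h2]
      refine integral_congr_ae (hae.mono fun t ht => ?_)
      exact pairing_withDensityᵥ (ht.integrable one_le_two) (b.curry t)
    rw [h3]
    exact hL b

end SpaceTime

end GeneralizedTransport

/-! ### Compactness of curves of measures -/

namespace GeneralizedTransport

open Filter Topology NNReal

variable {d : ℕ} {D : Set (Space d)} [CompactSpace (closure D)] {δ : ℝ}

/-- Restrictions of `C¹` functions are dense in the continuous functions (Stone-Weierstrass). -/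
lemma exists_contDiff_near (g : C(closure D, ℝ)) {ε : ℝ} (hε : 0 < ε) :
    ∃ (f : Space d → ℝ) (hf : ContDiff ℝ 1 f), ‖valueMap D hf - g‖ < ε := by
  let A : Subalgebra ℝ C(closure D, ℝ) :=
    { carrier := {g | ∃ (f : Space d → ℝ) (hf : ContDiff ℝ 1 f), valueMap D hf = g}
      mul_mem' := by
        rintro _ _ ⟨f₁, h₁, rfl⟩ ⟨f₂, h₂, rfl⟩
        exact ⟨_, h₁.mul h₂, rfl⟩
      add_mem' := by
        rintro _ _ ⟨f₁, h₁, rfl⟩ ⟨f₂, h₂, rfl⟩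
        exact ⟨_, h₁.add h₂, rfl⟩
      algebraMap_mem' := fun r => ⟨fun _ => r, contDiff_const, rfl⟩ }
  have hA : A.SeparatesPoints := by
    intro x y hxy
    obtain ⟨i, hi⟩ : ∃ i, (x : Space d) i ≠ (y : Space d) i := by
      by_contra! hcon
      exact hxy (Subtype.ext (PiLp.ext hcon))
    have hf : ContDiff ℝ 1 fun z : Space d => z i :=
      (EuclideanSpace.proj i : Space d →L[ℝ] ℝ).contDiff
    exact ⟨_, ⟨valueMap D hf, ⟨_, hf, rfl⟩, rfl⟩, hi⟩
  obtain ⟨⟨_, f, hf, rfl⟩, h⟩ :=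
    ContinuousMap.exists_mem_subalgebra_near_continuousMap_of_separatesPoints A hA g ε hε
  exact ⟨f, hf, h⟩

variable [IsFiniteMeasure (lebesgue D)]

section Bounds

variable {μ : I → FiniteMeasure (closure D)} {ν : I → VectorMeasure (closure D) (Space d)}
  {ζ : I → SignedMeasure (closure D)}

omit [IsFiniteMeasure (lebesgue D)] in
lemma IsFiniteLengthCurve.abs_integral_sub_le (h : IsFiniteLengthCurve D δ μ ν ζ)
    {f : Space d → ℝ} (hf : ContDiff ℝ 1 f) {K : ℝ} (hK : ∀ᵐ r, |rate ν ζ hf r| ≤ K) (s t : I) :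
    |(∫ x : closure D, f x ∂(μ t : Measure (closure D))) -
      ∫ x : closure D, f x ∂(μ s : Measure (closure D))| ≤ K * |(t : ℝ) - s| := by
  wlog hst : s ≤ t generalizing s t
  · rw [abs_sub_comm, abs_sub_comm (t : ℝ)]
    exact this t s (le_of_not_ge hst)
  rw [h.balance f hf s t hst]
  have h1 := norm_setIntegral_le_of_norm_le_const_ae (μ := volume) (s := Ioc s t)
    (f := rate ν ζ hf) (C := K) (measure_lt_top _ _) (ae_restrict_of_ae hK)
  rwa [measureReal_def, unitInterval.volume_Ioc, ENNReal.toReal_ofReal (sub_nonneg.2 hst),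
    ← abs_of_nonneg (sub_nonneg.2 (show (s : ℝ) ≤ t from hst))] at h1

/-- The mass along a curve is bounded in terms of the initial mass and of the speed. -/
lemma IsFiniteLengthCurve.mass_le (hδ : 0 < δ) (h : IsFiniteLengthCurve D δ μ ν ζ) {R : ℝ}
    (hR : 0 ≤ R) (hs : ∀ᵐ t, speed D δ μ ν ζ t ≤ ENNReal.ofReal R) (t : I) :
    ((μ t).mass : ℝ) ≤ (μ 0).mass + √((lebesgue D).real univ * δ) * R := by
  have hf : ContDiff ℝ 1 fun _ : Space d => (1 : ℝ) := contDiff_const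
  have hgrad : gradientMap D hf = 0 := by
    ext1 x
    exact gradient_const (F := Space d) (x : Space d) (1 : ℝ)
  have hval : ‖valueMap D hf‖ ≤ 1 := by
    rw [ContinuousMap.norm_le _ zero_le_one]
    intro x
    exact norm_one.le
  have hrate : ∀ᵐ r, |rate ν ζ hf r| ≤ √((lebesgue D).real univ * δ) * R := by
    filter_upwards [hs] with r hr
    rw [rate, hgrad, map_zero, zero_add]
    refine (HasFiniteLength.abs_pairing_source_le hδ (hr.trans_lt ENNReal.ofReal_lt_top) _).trans ?_
    gcongr
    · exact mul_le_of_le_one_left (Real.sqrt_nonneg _) hval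
    · exact ENNReal.toReal_le_of_le_ofReal hR hr
  have h1 := h.abs_integral_sub_le hf hrate 0 t
  have h2 : ∀ t, ∫ _ : closure D, (1 : ℝ) ∂(μ t : Measure (closure D)) = (μ t).mass := fun t => by
    rw [integral_const, smul_eq_mul, mul_one]
    rfl
  rw [h2, h2, Icc.coe_zero, sub_zero, abs_of_nonneg t.2.1] at h1
  have h3 : √((lebesgue D).real univ * δ) * R * t ≤ √((lebesgue D).real univ * δ) * R :=
    mul_le_of_le_one_right (by positivity) t.2.2
  linarith [le_abs_self (((μ t).mass : ℝ) - (μ 0).mass)]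

lemma IsFiniteLengthCurve.abs_rate_le (hδ : 0 < δ) {R M : ℝ}
    (hR : 0 ≤ R) (hs : ∀ᵐ t, speed D δ μ ν ζ t ≤ ENNReal.ofReal R)
    (hM : ∀ t, ((μ t).mass : ℝ) ≤ M) {f : Space d → ℝ} (hf : ContDiff ℝ 1 f) :
    ∀ᵐ r, |rate ν ζ hf r| ≤ ‖gradientMap D hf‖ * √M * R +
      ‖valueMap D hf‖ * √((lebesgue D).real univ * δ) * R := by
  filter_upwards [hs] with r hr
  have hlt := hr.trans_lt ENNReal.ofReal_lt_top
  have hr' := ENNReal.toReal_le_of_le_ofReal hR hr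
  refine (abs_add_le _ _).trans (add_le_add
    ((HasFiniteLength.abs_pairing_momentum_le hlt _).trans ?_)
    ((HasFiniteLength.abs_pairing_source_le hδ hlt _).trans ?_))
  · gcongr
    exact hM r
  · gcongr

end Bounds

section Compactness

variable {U : Ultrafilter ℕ} {m : ℕ → I → FiniteMeasure (closure D)}

omit [IsFiniteMeasure (lebesgue D)] in
/-- Families of curves of measures that are equi-Lipschitz against `C¹` functions are equicontinuous
against continuously varying test functions. -/
lemma equicontinuous_integral {M : ℝ} (hM : ∀ n t, ((m n t).mass : ℝ) ≤ M)
    (hlip : ∀ (f : Space d → ℝ), ContDiff ℝ 1 f → ∃ K : ℝ, 0 ≤ K ∧ ∀ n (s t : I),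
      |(∫ x : closure D, f x ∂(m n t : Measure (closure D))) -
        ∫ x : closure D, f x ∂(m n s : Measure (closure D))| ≤ K * |(t : ℝ) - s|)
    {a : I → C(closure D, ℝ)} (ha : Continuous a) :
    Equicontinuous fun n t => ∫ x, a t x ∂(m n t : Measure (closure D)) := by
  have hM0 : 0 ≤ M := NNReal.zero_le_coe.trans (hM 0 0)
  intro s
  rw [Metric.equicontinuousAt_iff]
  intro ε hε
  have hε1 : 0 < ε / (4 * (M + 1)) := by positivity
  obtain ⟨f, hf, hfa⟩ := exists_contDiff_near (a s) hε1
  obtain ⟨K, hK0, hK⟩ := hlip f hf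
  obtain ⟨κ, hκ, haκ⟩ := Metric.continuous_iff.1 ha s _ hε1
  refine ⟨min κ (ε / (4 * (K + 1))), by positivity, fun t ht n => ?_⟩
  rw [lt_min_iff] at ht
  have hsub : ∀ (g g' : C(closure D, ℝ)) (r : I), |(∫ x, g x ∂(m n r : Measure (closure D))) -
      ∫ x, g' x ∂(m n r : Measure (closure D))| ≤ ‖g - g'‖ * M := fun g g' r => by
    rw [← integral_sub (integrable_continuousMap _ _) (integrable_continuousMap _ _)]
    exact (abs_integral_le_norm_mul_mass (m n r) (g - g')).trans
      (mul_le_mul_of_nonneg_left (hM n r) (norm_nonneg _))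
  have e1 := hsub (a t) (a s) t
  have e2 := hsub (valueMap D hf) (a s) t
  have e3 := hsub (valueMap D hf) (a s) s
  have e4 : |(∫ x, valueMap D hf x ∂(m n t : Measure (closure D))) -
      ∫ x, valueMap D hf x ∂(m n s : Measure (closure D))| ≤ K * |(t : ℝ) - s| := hK n s t
  have h1 : ‖a t - a s‖ < ε / (4 * (M + 1)) := by
    rw [← dist_eq_norm]; exact haκ t ht.1
  have h2 : |(t : ℝ) - s| < ε / (4 * (K + 1)) := ht.2
  have h3 : ε / (4 * (M + 1)) * M ≤ ε / 4 := by
    rw [div_mul_eq_mul_div, div_le_div_iff₀ (by positivity) (by positivity)]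
    nlinarith
  have h4 : K * |(t : ℝ) - s| < ε / 4 := by
    have h5 : K * |(t : ℝ) - s| ≤ K * (ε / (4 * (K + 1))) := by gcongr
    refine h5.trans_lt ?_
    rw [← mul_div_assoc, div_lt_div_iff₀ (by positivity) (by positivity)]
    nlinarith
  have h5 : ‖a t - a s‖ * M ≤ ε / 4 := (mul_le_mul_of_nonneg_right h1.le hM0).trans h3
  have h6 : ‖valueMap D hf - a s‖ * M ≤ ε / 4 := (mul_le_mul_of_nonneg_right hfa.le hM0).trans h3
  rw [Real.dist_eq]
  rw [abs_le] at e1 e2 e3 e4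
  rw [abs_lt]
  constructor <;> linarith [e1.1, e1.2, e2.1, e2.2, e3.1, e3.2, e4.1, e4.2]

omit [IsFiniteMeasure (lebesgue D)] in
/-- Compactness of curves of measures with bounded mass that are equi-Lipschitz against `C¹`
functions. Limits are taken along an ultrafilter, separately at each time; equicontinuity makes the
convergence of integrals uniform in time. -/
lemma exists_limit_curve (hm : ∀ n, Continuous (m n)) {M : ℝ} (hM : ∀ n t, ((m n t).mass : ℝ) ≤ M)
    (hlip : ∀ (f : Space d → ℝ), ContDiff ℝ 1 f → ∃ K : ℝ, 0 ≤ K ∧ ∀ n (s t : I),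
      |(∫ x : closure D, f x ∂(m n t : Measure (closure D))) -
        ∫ x : closure D, f x ∂(m n s : Measure (closure D))| ≤ K * |(t : ℝ) - s|) :
    ∃ μ : I → FiniteMeasure (closure D), Continuous μ ∧
      (∀ t, Tendsto (fun n => m n t) U (𝓝 (μ t))) ∧
      ∀ a : C(I × closure D, ℝ),
        Tendsto (fun n => ∫ t, ∫ x, a (t, x) ∂(m n t : Measure (closure D))) U
          (𝓝 (∫ t, ∫ x, a (t, x) ∂(μ t : Measure (closure D)))) := by
  have hM0 : 0 ≤ M := NNReal.zero_le_coe.trans (hM 0 0)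
  have hlim : ∀ t, ∃ l : FiniteMeasure (closure D), Tendsto (fun n => m n t) U (𝓝 l) := fun t => by
    obtain ⟨l, -, hl⟩ := (isCompact_setOfPred_finiteMeasure_le_of_compactSpace (closure D)
      (Real.toNNReal M)).ultrafilter_le_nhds (U.map fun n => m n t)
      (le_principal_iff.2 (Eventually.of_forall (f := U) (p := fun n => (m n t).mass ≤ _)
        fun n => NNReal.le_toNNReal_of_coe_le (hM n t)))
    exact ⟨l, hl⟩
  choose μ hμ using hlim
  have hunif : ∀ a : I → C(closure D, ℝ), Continuous a →
      TendstoUniformly (fun n t => ∫ x, a t x ∂(m n t : Measure (closure D)))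
        (fun t => ∫ x, a t x ∂(μ t : Measure (closure D))) U := fun a ha => by
    have h1 := (equicontinuous_integral hM hlip ha).tendsto_uniformFun_iff_pi U
      (fun t => ∫ x, a t x ∂(μ t : Measure (closure D)))
    rw [UniformFun.tendsto_iff_tendstoUniformly] at h1
    exact h1.2 (tendsto_pi_nhds.2 fun t => ((continuous_integral_left (a t)).tendsto _).comp (hμ t))
  have hcont : Continuous μ := by
    rw [continuous_iff_continuousAt]
    intro t
    refine FiniteMeasure.tendsto_iff_forall_integral_tendsto.2 fun f => ?_
    have h1 := (hunif (fun _ => f.toContinuousMap) continuous_const).continuous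
      (Frequently.of_forall fun n => (continuous_integral_left f.toContinuousMap).comp (hm n))
    exact h1.tendsto t
  refine ⟨μ, hcont, hμ, fun a => ?_⟩
  have ha := a.curry.continuous
  rw [Metric.tendsto_nhds]
  intro ε hε
  filter_upwards [Metric.tendstoUniformly_iff.1 (hunif _ ha) (ε / 2) (by positivity)] with n hn
  have i1 := integrable_integral_pair (hm n) ha
  have i2 := integrable_integral_pair hcont ha
  have h1 : dist (∫ t, ∫ x, a.curry t x ∂(m n t : Measure (closure D)))
      (∫ t, ∫ x, a.curry t x ∂(μ t : Measure (closure D))) ≤ ε / 2 := by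
    rw [dist_eq_norm, ← integral_sub i1 i2]
    refine (norm_integral_le_of_norm_le_const (C := ε / 2)
      (Eventually.of_forall fun t => ?_)).trans_eq (by simp)
    rw [← dist_eq_norm, dist_comm]
    exact (hn t).le
  exact h1.trans_lt (by linarith)

end Compactness

end GeneralizedTransport

/-! ### Existence of minimizers -/

namespace GeneralizedTransport

open Filter Topology NNReal

variable {d : ℕ} {D : Set (Space d)} [CompactSpace (closure D)] {δ : ℝ}

/-- The weak equation, written with duality pairings. -/
lemma ContinuityEquation.weak_equation_pairing {μ : I → FiniteMeasure (closure D)}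
    {ν : I → VectorMeasure (closure D) (Space d)} {ζ : I → SignedMeasure (closure D)}
    (h : ContinuityEquation D μ ν ζ) {η : ℝ × Space d → ℝ} (hη : ContDiff ℝ 1 η)
    (hηc : HasCompactSupport η) (hηs : tsupport η ⊆ Ioo (0 : ℝ) 1 ×ˢ (univ : Set (Space d))) :
    (∫ t : I, ∫ x, timeDerivMap D hη t x ∂(μ t : Measure (closure D))) +
      (∫ t : I, pairing (ν t) (gradientMap D (contDiff_slice hη t))) +
      ∫ t : I, pairing (ζ t) (valueMap D (contDiff_slice hη t)) = 0 := by
  have h1 := h.weak_equation η hη hηc hηs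
  rw [lsmul_eq_innerSL] at h1
  exact h1

lemma tendsto_of_bounded (U : Ultrafilter ℕ) {u : ℕ → ℝ} {C : ℝ} (h0 : ∀ n, 0 ≤ u n)
    (hC : ∀ n, u n ≤ C) : ∃ l, Tendsto u U (𝓝 l) := by
  obtain ⟨l, -, hl⟩ := isCompact_Icc.ultrafilter_le_nhds (U.map u)
    (le_principal_iff.2 (Eventually.of_forall (f := U) (p := fun n => u n ∈ Icc 0 C)
      fun n => ⟨h0 n, hC n⟩))
  exact ⟨l, hl⟩

variable [IsFiniteMeasure (lebesgue D)]

/-- Existence of minimizers, by the direct method: a minimizing sequence of curves, parametrized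
almost proportionally to arclength, has a limit along an ultrafilter, and the action is lower
semicontinuous. -/
lemma exists_isMinimizer (hδ : 0 < δ) (hD : Bornology.IsBounded D)
    {a b : FiniteMeasure (closure D)} (hW : W D δ a b < ⊤) :
    ∃ (μ : I → FiniteMeasure (closure D)) (ν : I → VectorMeasure (closure D) (Space d))
      (ζ : I → SignedMeasure (closure D)), IsMinimizer D δ a b μ ν ζ := by
  let w : ℝ := (W D δ a b).toReal
  have hw : W D δ a b = ENNReal.ofReal w := (ENNReal.ofReal_toReal hW.ne).symm
  have hw0 : 0 ≤ w := ENNReal.toReal_nonneg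
  let r : ℕ → ℝ := fun n => w + 1 / ((n : ℝ) + 1)
  have hr0 : ∀ n, 0 ≤ r n := fun n => by positivity
  have hr1 : ∀ n, r n ≤ w + 1 := fun n => by
    have : 1 / ((n : ℝ) + 1) ≤ 1 := by
      rw [div_le_one (by positivity)]
      have := n.cast_nonneg (α := ℝ)
      linarith
    simp only [r]; linarith
  have hrlim : Tendsto r atTop (𝓝 w) := by
    have := (tendsto_one_div_add_atTop_nhds_zero_nat (𝕜 := ℝ)).const_add w
    rwa [add_zero] at this
  have hex : ∀ n, ∃ (μ : I → FiniteMeasure (closure D))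
      (ν : I → VectorMeasure (closure D) (Space d)) (ζ : I → SignedMeasure (closure D)),
      IsFiniteLengthCurve D δ μ ν ζ ∧ μ 0 = a ∧ μ 1 = b ∧
        ∀ᵐ t, speed D δ μ ν ζ t ≤ ENNReal.ofReal (r n) := fun n => by
    refine exists_curve_speed_le hδ hD ?_
    have h1 : 0 < 1 / ((n : ℝ) + 1) := by positivity
    have h2 : w < r n := by simp only [r]; linarith
    rw [hw, ENNReal.ofReal_lt_ofReal_iff (hw0.trans_lt h2)]
    exact h2
  choose m ν ζ hc h0 h1 hs using hex
  -- compactness of the masses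
  have hR : 0 ≤ w + 1 := by positivity
  have hs' : ∀ n, ∀ᵐ t, speed D δ (m n) (ν n) (ζ n) t ≤ ENNReal.ofReal (w + 1) := fun n =>
    (hs n).mono fun t ht => ht.trans (ENNReal.ofReal_le_ofReal (hr1 n))
  let M : ℝ := (a.mass : ℝ) + √((lebesgue D).real univ * δ) * (w + 1)
  have hM : ∀ n t, ((m n t).mass : ℝ) ≤ M := fun n t => by
    have := (hc n).mass_le hδ hR (hs' n) t
    rwa [h0 n] at this
  let U : Ultrafilter ℕ := hyperfilter ℕ
  have hU : (U : Filter ℕ) ≤ atTop := Nat.hyperfilter_le_atTop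
  obtain ⟨μ, hμ, hμlim, hμint⟩ := exists_limit_curve (U := U) (fun n => (hc n).continuous_mass) hM
    fun f hf => ⟨_, by positivity, fun n s t => (hc n).abs_integral_sub_le hf
      (IsFiniteLengthCurve.abs_rate_le hδ hR (hs' n) (hM n) hf) s t⟩
  have hstart : μ 0 = a := tendsto_nhds_unique (hμlim 0)
    (tendsto_const_nhds.congr fun n => (h0 n).symm)
  have hend : μ 1 = b := tendsto_nhds_unique (hμlim 1)
    (tendsto_const_nhds.congr fun n => (h1 n).symm)
  -- compactness of momenta and sources
  let L : FiniteMeasure (closure D) := ⟨lebesgue D, inferInstance⟩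
  let e : ℕ → ℝ≥0∞ := fun n => ∫⁻ t, energy (m n t : Measure (closure D)) (ν n t)
  let z : ℕ → ℝ≥0∞ := fun n => ∫⁻ t, energy (L : Measure (closure D)) (ζ n t)
  have hem : ∀ n, Measurable fun t => energy (m n t : Measure (closure D)) (ν n t) := fun n =>
    measurable_energy_of_continuous (hc n).continuous_mass (hc n).measurable_momentum
  have hact : ∀ (m : I → FiniteMeasure (closure D)) (ν : I → VectorMeasure (closure D) (Space d))
      (ζ : I → SignedMeasure (closure D)), Continuous m →
      (∀ B, MeasurableSet B → Measurable fun t => ν t B) →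
      (∀ B, MeasurableSet B → Measurable fun t => ζ t B) → ∫⁻ t, actionAt D δ m ν ζ t =
      (∫⁻ t, energy (m t : Measure (closure D)) (ν t)) +
        ENNReal.ofReal (1 / δ) * ∫⁻ t, energy (L : Measure (closure D)) (ζ t) := by
    intro m ν ζ hm hν hζ
    simp_rw [actionAt_eq]
    rw [lintegral_add_left (measurable_energy_of_continuous hm hν), lintegral_const_mul]
    · rfl
    · exact measurable_energy_of_continuous (m := fun _ => L) continuous_const hζ
  have hδ' : 0 < 1 / δ := by positivity
  have hsum : ∀ n, e n + ENNReal.ofReal (1 / δ) * z n ≤ ENNReal.ofReal (r n ^ 2) := fun n => by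
    rw [← hact _ _ _ (hc n).continuous_mass (hc n).measurable_momentum (hc n).measurable_source,
      ENNReal.ofReal_pow (hr0 n)]
    exact lintegral_actionAt_le (hs n)
  have hetop : ∀ n, e n ≠ ⊤ := fun n =>
    ((le_self_add.trans (hsum n)).trans_lt ENNReal.ofReal_lt_top).ne
  have hztop : ∀ n, z n ≠ ⊤ := fun n hcon => by
    have := (le_add_self.trans (hsum n)).trans_lt ENNReal.ofReal_lt_top
    rw [hcon, ENNReal.mul_top (by simpa using hδ)] at this
    exact lt_irrefl _ this
  have hsum' : ∀ n, (e n).toReal + 1 / δ * (z n).toReal ≤ r n ^ 2 := fun n => by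
    have := ENNReal.toReal_le_of_le_ofReal (sq_nonneg _) (hsum n)
    rwa [ENNReal.toReal_add (hetop n) (ENNReal.mul_ne_top ENNReal.ofReal_ne_top (hztop n)),
      ENNReal.toReal_mul, ENNReal.toReal_ofReal hδ'.le] at this
  have hr2 : ∀ n, r n ^ 2 ≤ (w + 1) ^ 2 := fun n => pow_le_pow_left₀ (hr0 n) (hr1 n) 2
  obtain ⟨α, hα⟩ := tendsto_of_bounded U (u := fun n => (e n).toReal) (C := (w + 1) ^ 2)
    (fun n => ENNReal.toReal_nonneg) fun n => by
      have h2 : 0 ≤ 1 / δ * (z n).toReal := mul_nonneg hδ'.le ENNReal.toReal_nonneg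
      linarith [hsum' n, hr2 n]
  obtain ⟨β, hβ⟩ := tendsto_of_bounded U (u := fun n => (z n).toReal) (C := δ * (w + 1) ^ 2)
    (fun n => ENNReal.toReal_nonneg) fun n => by
      have h2 : 0 ≤ (e n).toReal := ENNReal.toReal_nonneg
      have h3 : 1 / δ * (z n).toReal ≤ (w + 1) ^ 2 := by linarith [hsum' n, hr2 n]
      rwa [one_div, inv_mul_le_iff₀ hδ] at h3
  have hαβ : α + 1 / δ * β ≤ w ^ 2 :=
    le_of_tendsto_of_tendsto' (hα.add (hβ.const_mul _)) ((hrlim.mono_left hU).pow 2) hsum'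
  have hα0 : 0 ≤ α := ge_of_tendsto' hα fun n => ENNReal.toReal_nonneg
  have hβ0 : 0 ≤ β := ge_of_tendsto' hβ fun n => ENNReal.toReal_nonneg
  obtain ⟨ν', hν'm, hν'e, hν'lim⟩ := exists_limit_momentum (fun n => (hc n).continuous_mass) hμ
    hμint (fun n => (hc n).measurable_momentum) hetop hα
  obtain ⟨ζ', hζ'm, hζ'e, hζ'lim⟩ := exists_limit_momentum (U := U) (m := fun _ _ => L)
    (μ := fun _ => L) (fun n => continuous_const) continuous_const
    (fun a => tendsto_const_nhds) (fun n => (hc n).measurable_source) hztop hβ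
  -- lower semicontinuity of the action
  have hle : ∫⁻ t, actionAt D δ μ ν' ζ' t ≤ ENNReal.ofReal (w ^ 2) := by
    rw [hact _ _ _ hμ hν'm hζ'm]
    calc _ ≤ ENNReal.ofReal α + ENNReal.ofReal (1 / δ) * ENNReal.ofReal β := by gcongr
      _ = ENNReal.ofReal (α + 1 / δ * β) := by
        rw [← ENNReal.ofReal_mul hδ'.le, ENNReal.ofReal_add hα0 (by positivity)]
      _ ≤ _ := ENNReal.ofReal_le_ofReal hαβ
  have hle' : (∫⁻ t, actionAt D δ μ ν' ζ' t) ^ (1 / 2 : ℝ) ≤ W D δ a b := by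
    refine (ENNReal.rpow_le_rpow hle one_half_pos.le).trans_eq ?_
    rw [hw, ENNReal.ofReal_pow hw0, ← ENNReal.rpow_natCast, ← ENNReal.rpow_mul]
    norm_num
  have hfl : HasFiniteLength D δ μ ν' ζ' :=
    ⟨hμ, hν'm, hζ'm, ((lintegral_speed_le hμ hν'm hζ'm).trans hle').trans_lt hW⟩
  have hCE : ContinuityEquation D μ ν' ζ' :=
    { continuous_mass := hμ
      measurable_momentum := hν'm
      measurable_source := hζ'm
      integrable_momentum := hfl.lintegral_variation_momentum_lt_top
      integrable_source := hfl.lintegral_variation_source_lt_top hδ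
      weak_equation := fun η hη hηc hηs => by
        have hA : Continuous fun p : I × closure D => timeDerivMap D hη p.1 p.2 :=
          ContinuousMap.continuous_uncurry_of_continuous ⟨_, continuous_timeDerivMap (D := D) hη⟩
        have hB : Continuous fun p : I × closure D =>
            gradientMap D (contDiff_slice hη p.1) p.2 :=
          ContinuousMap.continuous_uncurry_of_continuous
            ⟨_, continuous_gradientMap_slice (D := D) hη⟩
        have hC : Continuous fun p : I × closure D => valueMap D (contDiff_slice hη p.1) p.2 :=
          ContinuousMap.continuous_uncurry_of_continuous ⟨_, continuous_valueMap_slice (D := D) hη⟩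
        have hlim := ((hμint ⟨_, hA⟩).add (hν'lim ⟨_, hB⟩)).add (hζ'lim ⟨_, hC⟩)
        have hzero := tendsto_nhds_unique hlim (tendsto_const_nhds.congr fun n =>
          (((hc n).continuityEquation hδ).weak_equation_pairing hη hηc hηs).symm)
        rw [lsmul_eq_innerSL]
        exact hzero }
  have hconn : Connects D a b μ ν' ζ' := ⟨hCE, hstart, hend⟩
  exact ⟨μ, ν', ζ', hconn, le_antisymm hle' (W_le_of_connects hconn)⟩

omit [CompactSpace (closure D)] [IsFiniteMeasure (lebesgue D)] in
lemma compactSpace_closure (hD : Bornology.IsBounded D) : CompactSpace (closure D) :=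
  isCompact_iff_compactSpace.1 hD.isCompact_closure

omit [CompactSpace (closure D)] [IsFiniteMeasure (lebesgue D)] in
lemma isFiniteMeasure_lebesgue (hD : Bornology.IsBounded D) : IsFiniteMeasure (lebesgue D) := by
  refine ⟨?_⟩
  rw [lebesgue, (MeasurableEmbedding.subtype_coe isClosed_closure.measurableSet).comap_apply,
    image_univ, Subtype.range_coe]
  exact hD.closure.measure_lt_top

end GeneralizedTransport

theorem mainTheorem1 {d : ℕ} (D : Set (GeneralizedTransport.Space d))
    (hD : GeneralizedTransport.IsBoundedLipschitzDomain D) (δ : ℝ) (hδ : 0 < δ)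
    (μA μB : FiniteMeasure (closure D)) (hW : GeneralizedTransport.W D δ μA μB < ⊤) :
    (∃ (μ : I → FiniteMeasure (closure D))
        (ν : I → VectorMeasure (closure D) (GeneralizedTransport.Space d))
        (ζ : I → SignedMeasure (closure D)),
        GeneralizedTransport.IsMinimizer D δ μA μB μ ν ζ) ∧
    (∀ (μ : I → FiniteMeasure (closure D))
        (ν : I → VectorMeasure (closure D) (GeneralizedTransport.Space d))
        (ζ : I → SignedMeasure (closure D)),
        GeneralizedTransport.IsMinimizer D δ μA μB μ ν ζ →
        ∀ s t : I, GeneralizedTransport.W D δ (μ s) (μ t) =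
          ENNReal.ofReal |(s : ℝ) - (t : ℝ)| * GeneralizedTransport.W D δ μA μB) ∧
    GeneralizedTransport.W D δ μA μB =
      ⨅ (μ : I → FiniteMeasure (closure D))
        (ν : I → VectorMeasure (closure D) (GeneralizedTransport.Space d))
        (ζ : I → SignedMeasure (closure D))
        (_ : GeneralizedTransport.Connects D μA μB μ ν ζ),
        ∫⁻ t : I, GeneralizedTransport.actionAt D δ μ ν ζ t ^ (1 / 2 : ℝ) := by
  have hcompact := GeneralizedTransport.compactSpace_closure hD.isBounded
  have hfinite := GeneralizedTransport.isFiniteMeasure_lebesgue hD.isBounded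
  exact ⟨GeneralizedTransport.exists_isMinimizer hδ hD.isBounded hW,
    fun μ ν ζ h => h.W_eq hδ hD.isBounded hW,
    GeneralizedTransport.W_eq_iInf_length hδ hD.isBounded μA μB⟩
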